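/- Let $R=(R_1,\dots,R_k)$ be a sequence of rectangular partitions, $R_m=(s_m^{r_m})$ with $r_m,s_m>0$ ($r_m$ rows, $s_m$ columns), and let $n\ge 3$. Let $B^R=B^{R_1}\otimes\cdots\otimes B^{R_k}$ be the set of tuples $T=T_1\otimes\cdots\otimes T_k$ of semistandard tableaux $T_m$ of shape $R_m$ with entries in $[n]=\{1,\dots,n\}$ (English notation). The row-reading word $\mathsf{rw}(T_m)$ reads the rows from bottom to top, each from left to right, and $\mathsf{rw}(T)=\mathsf{rw}(T_1)\cdots\mathsf{rw}(T_k)$. Let $V$ be the set of weight-$0$ elements of $B^R$, i.e. those in which each of $1,\dots,n$ occurs exactly once (so $V=\emptyset$ unless $n=\sum_m r_ms_m$). *Jeu de taquin.* A hole moves inward by repeatedly exchanging it with the larger of its upper and left neighbours (the upper one in a tie), and outward by exchanging it with the smaller of its lower and right neighbours (the lower one in a tie), until there is no such neighbour. Promotion $\mathrm{pr}$ acts on each factor: remove all entries $n$, slide the resulting holes inward one after the other from left to right, fill the final holes with $0$, and add $1$ to all entries. It is a bijection of $B^R$. *Crystal operators.* For $1\le i\le n-1$, replace each $i+1$ in $\mathsf{rw}(T)$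 by "(" and each $i$ by ")" and match parentheses; $f_i$ changes the right-most unmatched $i$ into $i+1$, and $e_i$ changes the left-most unmatched $i+1$ into $i$ (in the corresponding box of $T$); if there is no such letter, $T$ is unchanged. Put $f_n=\mathrm{pr}^{-1}\circ f_1\circ\mathrm{pr}$ and $e_n=\mathrm{pr}^{-1}\circ e_1\circ\mathrm{pr}$. For $i\in[n]$ let $C_i=e_ie_{i+1}f_if_{i+1}$ (the right-most operator acts first), with $i+1$ read modulo $n$, so that $C_n=e_ne_1f_nf_1$. *The graph.* For $T\in V$ the descent set $D(T)\subseteq[n]$ consists of the $i\in[n-1]$ such that $i+1$ is to the left of $i$ in $\mathsf{rw}(T)$, together with $n$ if $1\in D(\mathrm{pr}(T))$. The Kirillov–Reshetikhin dual equivalence graph $\mathcal T(R)$ is the undirected graph with vertex set $V$ in which $T,T'\in V$ are joined by an edge if one of them is obtained from the other by one of the following moves $T\mapsto T'$: 1. ($t_i$, $1\le i\le n-1$) swap $i$ and $i+1$, provided that $D(T)$ and $D(T')$ are incomparable under inclusion; 2. ($t_n$) if $n\in T_\ell$ and $1\in T_j$ with $\ell\ne j$: remove $n$ from $T_\ell$,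 slide the hole inward and fill it with $1$; remove $1$ from $T_j$, slide the hole outward and fill it with $n$; provided that $D(T)$ and $D(T')$ are incomparable under inclusion; 3. ($\bar t_1$) if $1,2,n$ lie in the same factor $T_j$, $\mathsf{rw}(T_j)$ has the form $\cdots n\cdots 1\,2\cdots$ (with $1,2$ adjacent), and $n\in D(T)$: remove $n$ from $T_j$ and slide the hole inward, swap $1$ and $2$, slide the hole outward and fill it with $n$; 4. ($\bar t_{n-1}$) if $1,n-1,n$ lie in the same factor $T_j$, $n$ is to the left of both $n-1$ and $1$ in $\mathsf{rw}(T_j)$, and $n\notin D(T)$: remove $n$ from $T_j$, slide the hole inward and fill it with $1$; remove $n-1$ and slide the hole inward to a box $*$; remove the $1$ of the first row, slide the hole outward and fill it with $n-1$; slide the hole $*$ outward and fill it with $n$. **Theorem.** For all $T,T'\in V$: $T$ and $T'$ are joined by an edge of $\mathcal T(R)$ if and only if $\mathsf{rw}(T)\neq\mathsf{rw}(T')$ and there is $i\in[n]$ with $C_i(T)=T'$ or $C_i(T')=T$. -/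

import Mathlib

/-!
Fillings of sequences of rectangles, jeu de taquin, promotion, crystal operators, and the
Kirillov-Reshetikhin dual equivalence graph.

Rows and columns are indexed from `0`, in English notation (row `0` is the top row).  The entries
of tableaux are the natural numbers `1, …, n`.
-/

namespace KR

/-! ### Fillings and reading words -/

/-- A filling of one rectangle with `r` rows and `s` columns. -/
abbrev Fac (r s : ℕ) : Type := Fin r → Fin s → ℕ

/-- A filling `T_1 ⊗ ⋯ ⊗ T_k` of a sequence `R` of rectangles, where `R m = (r, s)` is the
rectangle with `r` rows and `s` columns. -/
abbrev Filling {k : ℕ} (R : Fin k → ℕ × ℕ) : Type := ∀ m : Fin k, Fac (R m).1 (R m).2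

/-- The boxes of a sequence of rectangles. -/
abbrev Box {k : ℕ} (R : Fin k → ℕ × ℕ) : Type := Σ m : Fin k, Fin (R m).1 × Fin (R m).2

/-- The boxes of a rectangle in row-reading order: rows from bottom to top, and each row from left
to right. -/
def facBoxes (r s : ℕ) : List (Fin r × Fin s) :=
  (List.finRange r).reverse.flatMap fun i => (List.finRange s).map fun j => (i, j)

/-- The boxes of a sequence of rectangles in row-reading order: the rectangles from left to right,
each in row-reading order. -/
def boxes {k : ℕ} (R : Fin k → ℕ × ℕ) : List (Box R) :=
  (List.finRange k).flatMap fun m => (facBoxes (R m).1 (R m).2).map fun c => ⟨m, c⟩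

/-- The entry of `T` in a box. -/
def entry {k : ℕ} {R : Fin k → ℕ × ℕ} (T : Filling R) (c : Box R) : ℕ := T c.1 c.2.1 c.2.2

/-- The row-reading word of one tensor factor. -/
def facWord {r s : ℕ} (t : Fac r s) : List ℕ := (facBoxes r s).map fun c => t c.1 c.2

/-- The row-reading word of `T_1 ⊗ ⋯ ⊗ T_k`. -/
def rw {k : ℕ} {R : Fin k → ℕ × ℕ} (T : Filling R) : List ℕ := (boxes R).map (entry T)

/-- `t` is a semistandard tableau with entries in `{1, …, n}`. -/
structure IsSSYT (n : ℕ) {r s : ℕ} (t : Fac r s) : Prop where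
  pos : ∀ i j, 1 ≤ t i j
  le : ∀ i j, t i j ≤ n
  row_weak : ∀ i j j', j < j' → t i j ≤ t i j'
  col_strict : ∀ i i' j, i < i' → t i j < t i' j

/-- The elements of `B^R = B^{R_1} ⊗ ⋯ ⊗ B^{R_k}`: each factor is a semistandard tableau with
entries in `{1, …, n}`. -/
def crystal (n : ℕ) {k : ℕ} (R : Fin k → ℕ × ℕ) : Set (Filling R) :=
  {T | ∀ m, IsSSYT n (T m)}

/-- Weight `0`: every letter of `{1, …, n}` occurs exactly once.  (So such elements of `B^R` exist
only if `n` is the total number of boxes of `R`.) -/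
def IsWeightZero (n : ℕ) {k : ℕ} {R : Fin k → ℕ × ℕ} (T : Filling R) : Prop :=
  ∀ x, 1 ≤ x → x ≤ n → (rw T).count x = 1

/-! ### Jeu de taquin -/

/-- A partial filling of the quarter plane by natural numbers; `none` marks an empty box. -/
abbrev Grid : Type := ℕ × ℕ → Option ℕ

/-- The grid of a filled rectangle. -/
def toGrid {r s : ℕ} (t : Fac r s) : Grid := fun c =>
  if h : c.1 < r ∧ c.2 < s then some (t ⟨c.1, h.1⟩ ⟨c.2, h.2⟩) else none

/-- The `r × s` rectangle cut out of a grid (it is only used for grids without empty boxes in that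
rectangle). -/
def ofGrid (r s : ℕ) (g : Grid) : Fac r s := fun i j => (g (i, j)).getD 0

/-- The box whose entry slides into the hole `c` when the hole moves up or left: the one with the
larger entry, and the upper one in case of a tie; `none` if there is no such box. -/
def nextIn (g : Grid) (c : ℕ × ℕ) : Option (ℕ × ℕ) :=
  match (if c.1 = 0 then none else g (c.1 - 1, c.2)),
      (if c.2 = 0 then none else g (c.1, c.2 - 1)) with
  | none, none => none
  | some _, none => some (c.1 - 1, c.2)
  | none, some _ => some (c.1, c.2 - 1)
  | some u, some l => if l ≤ u then some (c.1 - 1, c.2) else some (c.1, c.2 - 1)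

/-- The box whose entry slides into the hole `c` when the hole moves down or right: the one with
the smaller entry, and the lower one in case of a tie; `none` if there is no such box. -/
def nextOut (g : Grid) (c : ℕ × ℕ) : Option (ℕ × ℕ) :=
  match g (c.1 + 1, c.2), g (c.1, c.2 + 1) with
  | none, none => none
  | some _, none => some (c.1 + 1, c.2)
  | none, some _ => some (c.1, c.2 + 1)
  | some d, some l => if d ≤ l then some (c.1 + 1, c.2) else some (c.1, c.2 + 1)

/-- Repeat the slides given by `next` (at most `N` of them), starting from the hole `p.2` in the
grid `p.1`.  The result is the final grid together with the final position of the hole. -/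
def slide (next : Grid → ℕ × ℕ → Option (ℕ × ℕ)) : ℕ → Grid × (ℕ × ℕ) → Grid × (ℕ × ℕ)
  | 0, p => p
  | N + 1, p =>
    match next p.1 p.2 with
    | none => p
    | some d => slide next N (Function.update (Function.update p.1 p.2 (p.1 d)) d none, d)

/-- Empty the box `c` of a grid supported in the `r × s` rectangle and slide the hole up and left
to the inner boundary.  (A hole makes fewer than `r + s` moves in that rectangle.) -/
def jdtIn (r s : ℕ) (g : Grid) (c : ℕ × ℕ) : Grid × (ℕ × ℕ) :=
  slide nextIn (r + s) (Function.update g c none, c)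

/-- Empty the box `c` of a grid supported in the `r × s` rectangle and slide the hole down and
right to the outer boundary. -/
def jdtOut (r s : ℕ) (g : Grid) (c : ℕ × ℕ) : Grid × (ℕ × ℕ) :=
  slide nextOut (r + s) (Function.update g c none, c)

/-- The boxes of the `r × s` rectangle with entry `x`, in row-reading order. -/
def boxesWith (r s : ℕ) (g : Grid) (x : ℕ) : List (ℕ × ℕ) :=
  ((facBoxes r s).map fun c => ((c.1 : ℕ), (c.2 : ℕ))).filter fun c => g c = some x

/-- The box of the `r × s` rectangle with entry `x` (it is only used if there is exactly one). -/
def boxOf (r s : ℕ) (g : Grid) (x : ℕ) : ℕ × ℕ := (boxesWith r s g x).headD (0, 0)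

/-! ### Promotion -/

/-- Promotion of a semistandard tableau of rectangular shape with entries at most `n`: remove all
entries `n`, slide the resulting holes to the inner boundary one after the other, put `0` into the
holes, and increase all entries by one. -/
def facPr (n : ℕ) {r s : ℕ} (t : Fac r s) : Fac r s :=
  let holes := boxesWith r s (toGrid t) n
  let g := holes.foldl (fun g c => Function.update g c none) (toGrid t)
  let g' := holes.foldl (fun g c => (jdtIn r s g c).1) g
  fun i j => (g' (i, j)).getD 0 + 1

/-- Promotion on `B^R`, factor by factor. -/
def pr (n : ℕ) {k : ℕ} {R : Fin k → ℕ × ℕ} (T : Filling R) : Filling R :=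
  fun m => facPr n (T m)

/-- The inverse of promotion on `B^R`. -/
noncomputable def prInv (n : ℕ) {k : ℕ} {R : Fin k → ℕ × ℕ} : Filling R → Filling R :=
  Function.invFunOn (pr n) (crystal n R)

/-! ### Crystal operators -/

/-- One step of the bracketing: the letter `i + 1` opens and the letter `i` closes a bracket.  The
state consists of the boxes of the unmatched `i`s and of the unmatched `i + 1`s among those read so
far, both with the most recent (right-most) one first. -/
def bracketStep {α : Type*} (i : ℕ) (val : α → ℕ) (st : List α × List α) (c : α) :
    List α × List α :=
  if val c = i + 1 then (st.1, c :: st.2)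
  else if val c = i then
    match st.2 with
    | [] => (c :: st.1, [])
    | _ :: o => (st.1, o)
  else st

/-- The boxes of the unmatched letters `i` and of the unmatched letters `i + 1` in the reading word
of `T`, both listed from right to left. -/
def brackets {k : ℕ} {R : Fin k → ℕ × ℕ} (i : ℕ) (T : Filling R) : List (Box R) × List (Box R) :=
  (boxes R).foldl (bracketStep i (entry T)) ([], [])

/-- Change the entry in one box. -/
def setEntry {k : ℕ} {R : Fin k → ℕ × ℕ} (T : Filling R) (c : Box R) (x : ℕ) : Filling R :=
  Function.update T c.1
    (Function.update (T c.1) c.2.1 (Function.update (T c.1 c.2.1) c.2.2 x))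

/-- The classical lowering operator: change the right-most unmatched `i` into `i + 1`; nothing
changes if there is none. -/
def fClassical {k : ℕ} {R : Fin k → ℕ × ℕ} (i : ℕ) (T : Filling R) : Filling R :=
  match (brackets i T).1.head? with
  | none => T
  | some c => setEntry T c (i + 1)

/-- The classical raising operator: change the left-most unmatched `i + 1` into `i`; nothing
changes if there is none. -/
def eClassical {k : ℕ} {R : Fin k → ℕ × ℕ} (i : ℕ) (T : Filling R) : Filling R :=
  match (brackets i T).2.getLast? with
  | none => T
  | some c => setEntry T c i

/-- The lowering operators `f_1, …, f_n` of `B^R`, with `f_n = pr⁻¹ ∘ f_1 ∘ pr`. -/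
noncomputable def f (n i : ℕ) {k : ℕ} {R : Fin k → ℕ × ℕ} (T : Filling R) : Filling R :=
  if i = n then prInv n (fClassical 1 (pr n T)) else fClassical i T

/-- The raising operators `e_1, …, e_n` of `B^R`, with `e_n = pr⁻¹ ∘ e_1 ∘ pr`. -/
noncomputable def e (n i : ℕ) {k : ℕ} {R : Fin k → ℕ × ℕ} (T : Filling R) : Filling R :=
  if i = n then prInv n (eClassical 1 (pr n T)) else eClassical i T

/-- The successor of an index of `{1, …, n}`, modulo `n`. -/
def succIdx (n i : ℕ) : ℕ := if i = n then 1 else i + 1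

/-- The crystal commutator `C_i = e_i e_{i+1} f_i f_{i+1}` (the right-most operator acts first),
with `i + 1` read modulo `n`. -/
noncomputable def commutator (n i : ℕ) {k : ℕ} {R : Fin k → ℕ × ℕ} (T : Filling R) : Filling R :=
  e n i (e n (succIdx n i) (f n i (f n (succIdx n i) T)))

/-! ### The dual equivalence graph -/

/-- The vertices: the weight `0` elements of `B^R`. -/
structure Vertex (n : ℕ) {k : ℕ} (R : Fin k → ℕ × ℕ) where
  /-- the underlying filling -/
  val : Filling R
  mem_crystal : val ∈ crystal n R
  weight_zero : IsWeightZero n val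

/-- The descents in `{1, …, n - 1}`: those `i` for which `i + 1` appears to the left of `i`. -/
def classicalDescents (n : ℕ) {k : ℕ} {R : Fin k → ℕ × ℕ} (T : Filling R) : Set ℕ :=
  {i | 1 ≤ i ∧ i < n ∧ [i + 1, i].Sublist (rw T)}

/-- The descent set `D(T)`; here `n` is a descent of `T` if `1` is a descent of `pr(T)`. -/
def descents (n : ℕ) {k : ℕ} {R : Fin k → ℕ × ℕ} (T : Filling R) : Set ℕ :=
  classicalDescents n T ∪ {i | i = n ∧ 1 ∈ classicalDescents n (pr n T)}

/-- `D(T)` and `D(T')` are incomparable with respect to inclusion. -/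
def Incomparable (n : ℕ) {k : ℕ} {R : Fin k → ℕ × ℕ} (T T' : Filling R) : Prop :=
  ¬ descents n T ⊆ descents n T' ∧ ¬ descents n T' ⊆ descents n T

/-- `t_i(T) = T'` for `1 ≤ i ≤ n - 1`: swap `i` and `i + 1`. -/
def MoveT (n i : ℕ) {k : ℕ} {R : Fin k → ℕ × ℕ} (T T' : Filling R) : Prop :=
  (∀ c, entry T' c = Equiv.swap i (i + 1) (entry T c)) ∧ Incomparable n T T'

/-- Slide `n` out of a factor and put `1` into the created inner box. -/
def replaceMax (n : ℕ) {r s : ℕ} (t : Fac r s) : Fac r s :=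
  let p := jdtIn r s (toGrid t) (boxOf r s (toGrid t) n)
  ofGrid r s (Function.update p.1 p.2 (some 1))

/-- Slide `1` out of a factor and put `n` into the created outer box. -/
def replaceMin (n : ℕ) {r s : ℕ} (t : Fac r s) : Fac r s :=
  let p := jdtOut r s (toGrid t) (boxOf r s (toGrid t) 1)
  ofGrid r s (Function.update p.1 p.2 (some n))

/-- `t_n(T) = T'`, which needs `n` and `1` to lie in different tensor factors. -/
def MoveTn (n : ℕ) {k : ℕ} {R : Fin k → ℕ × ℕ} (T T' : Filling R) : Prop :=
  ∃ l j : Fin k, l ≠ j ∧ n ∈ facWord (T l) ∧ 1 ∈ facWord (T j) ∧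
    T' = Function.update (Function.update T l (replaceMax n (T l))) j (replaceMin n (T j)) ∧
    Incomparable n T T'

/-- The moves on a factor for `t̄_1`: slide `n` to the inner boundary, switch `1` and `2`, slide
the inner hole to the outer boundary, and fill it with `n`. -/
def facTbarOne (n : ℕ) {r s : ℕ} (t : Fac r s) : Fac r s :=
  let p := jdtIn r s (toGrid t) (boxOf r s (toGrid t) n)
  let g : Grid := fun c => (p.1 c).map (Equiv.swap 1 2)
  let q := jdtOut r s g p.2
  ofGrid r s (Function.update q.1 q.2 (some n))

/-- `t̄_1(T) = T'`: the letters `1, 2, n` lie in the same factor `T_j`, the reading word of `T_j`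
has the form `⋯ n ⋯ 1 2 ⋯`, and `n` is a descent of `T`. -/
def MoveTbarOne (n : ℕ) {k : ℕ} {R : Fin k → ℕ × ℕ} (T T' : Filling R) : Prop :=
  ∃ j : Fin k, (∃ u v : List ℕ, facWord (T j) = u ++ [1, 2] ++ v ∧ n ∈ u) ∧
    n ∈ descents n T ∧ T' = Function.update T j (facTbarOne n (T j))

/-- The moves on a factor for `t̄_{n-1}`: slide `n` to the inner boundary and fill the inner box
with `1`; slide `n - 1` to the inner boundary, which leaves an inner hole; slide the `1` of the
first row to the outer boundary, then the inner hole; the two outer boxes get the entries `n - 1`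
and `n`, in this order. -/
def facTbarLast (n : ℕ) {r s : ℕ} (t : Fac r s) : Fac r s :=
  let p := jdtIn r s (toGrid t) (boxOf r s (toGrid t) n)
  let g₁ : Grid := Function.update p.1 p.2 (some 1)
  let q := jdtIn r s g₁ (boxOf r s g₁ (n - 1))
  let c : ℕ × ℕ := (((boxesWith r s q.1 1).filter fun b => b.1 = 0).headD (0, 0))
  let u := jdtOut r s q.1 c
  let g₂ : Grid := Function.update u.1 u.2 (some (n - 1))
  let v := jdtOut r s g₂ q.2
  ofGrid r s (Function.update v.1 v.2 (some n))

/-- `t̄_{n-1}(T) = T'`: the letters `1, n - 1, n` lie in the same factor `T_j`, in the reading word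
of `T_j` the letter `n` precedes both `n - 1` and `1`, and `n` is not a descent of `T`. -/
def MoveTbarLast (n : ℕ) {k : ℕ} {R : Fin k → ℕ × ℕ} (T T' : Filling R) : Prop :=
  ∃ j : Fin k, [n, n - 1].Sublist (facWord (T j)) ∧ [n, 1].Sublist (facWord (T j)) ∧
    n ∉ descents n T ∧ T' = Function.update T j (facTbarLast n (T j))

/-- `g(T) = T'` for some `g` among `t_1, …, t_n, t̄_1, t̄_{n-1}`. -/
def Move (n : ℕ) {k : ℕ} {R : Fin k → ℕ × ℕ} (T T' : Filling R) : Prop :=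
  (∃ i, 1 ≤ i ∧ i < n ∧ MoveT n i T T') ∨ MoveTn n T T' ∨ MoveTbarOne n T T' ∨
    MoveTbarLast n T T'

/-- Adjacency in the (undirected) Kirillov-Reshetikhin dual equivalence graph `𝒯(R)`. -/
def Adj {n k : ℕ} {R : Fin k → ℕ × ℕ} (T T' : Vertex n R) : Prop :=
  Move n T.val T'.val ∨ Move n T'.val T.val

end KR

/-! Weight-zero fillings are standard fillings, and on them both adjacency relations are compared
with a third one. Elementary dual equivalence `DualStep i` swaps `i`, `i + 1` when `i + 2` lies
between them in the reading word, or swaps `i + 1`, `i + 2` when `i` lies between them. In either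
sense, T and T' are adjacent exactly when `DualStep i` relates T and T' for some `i ≤ n - 2`, or
`DualStep 1` relates pr T and pr T', or `DualStep 1` relates pr² T and pr² T'. This is
`IsStd.move_or_move_iff` for the moves and `IsStd.commutator_iff` for the commutators.

Commutators. For `i ≤ n - 2` the bracketing sees only the letters `i`, `i + 1`, `i + 2`, so C_i
depends only on their relative order, and a check over S_3 shows that it sends 213 to 312 and 231 to
132 and fixes the other four orders (`wordComm_table`). For the two affine commutators, pr C_n = C_1
pr and pr² C_{n-1} = C_1 pr² hold on standard fillings (`IsStd.commutator_self`,
`IsStd.commutator_pred`). The intermediate fillings have a repeated letter; they are followed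
explicitly, as standard fillings with two consecutive letters merged. Since `prInv` only chooses
some semistandard preimage, each use of it needs an argument that this preimage is the expected one.

Moves. Promotion turns a descent `i ≤ n - 2` into `i + 1` (`IsStd.descent_pr`), and the descent `n -
1` of T becomes the descent 1 of pr² T (`IsStd.descent_pr_pr`). Swapping `i` and `i + 1` reverses
the descent `i`; for the descent sets to be incomparable another descent has to change in the
opposite direction. Only `i - 1`, `i + 1` and `n` qualify, and `n` only if `i = 1` or `i = n - 1`,
by `IsStd.descents_mono`. The move t_n is the swap of 1 and 2 in pr T; the two barred moves swap the
2 and the 3 of a hook in the inner corner of pr T and of pr² T.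

The facts about jeu de taquin behind this are: a slide keeps the relative order of the rows of `x`
and `x + 1` (`Punctured.path_row_lt`); two successive slides from the corner do not cross
(`Punctured.path_stays_right`); outward slides undo inward ones (`Punctured.path_reverse`); and a
swap of two letters moves the path of a slide to one side only (`path_last_step_mono`). -/

namespace KR

/-! ### One rectangle: slides, promotion and the moves on a single tensor factor. -/

/-! ### Slides as paths -/

/-- Move the hole of a punctured grid to the box `d`. -/
def moveHole (p : Grid × (ℕ × ℕ)) (d : ℕ × ℕ) : Grid × (ℕ × ℕ) :=
  (Function.update (Function.update p.1 p.2 (p.1 d)) d none, d)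

/-- `Path next k p q`: the rule `next` moves the hole in `k` steps from `p` to `q`. -/
inductive Path (next : Grid → ℕ × ℕ → Option (ℕ × ℕ)) :
    ℕ → Grid × (ℕ × ℕ) → Grid × (ℕ × ℕ) → Prop
  | refl (p) : Path next 0 p p
  | head {k p q d} : next p.1 p.2 = some d → Path next k (moveHole p d) q → Path next (k + 1) p q

/-- Replaces the recursion with a step budget by a path; unused budget is harmless because the hole
is stuck at the end of the path. -/
theorem slide_eq_of_path {next : Grid → ℕ × ℕ → Option (ℕ × ℕ)} {k : ℕ} {p q : Grid × (ℕ × ℕ)}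
    (h : Path next k p q) (hq : next q.1 q.2 = none) {N : ℕ} (hN : k ≤ N) :
    slide next N p = q := by
  induction h generalizing N with
  | refl p => cases N <;> simp [slide, hq]
  | head h1 _ ih =>
    obtain ⟨N, rfl⟩ : ∃ M, N = M + 1 := ⟨N - 1, by omega⟩
    simp only [slide, h1]
    exact ih hq (by omega)

theorem Path.tail {next : Grid → ℕ × ℕ → Option (ℕ × ℕ)} {k : ℕ} {p q : Grid × (ℕ × ℕ)}
    {d : ℕ × ℕ} (h : Path next k p q) (hd : next q.1 q.2 = some d) :
    Path next (k + 1) p (moveHole q d) := by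
  induction h with
  | refl p => exact .head hd (.refl _)
  | head h1 _ ih => exact .head h1 (ih hd)

/-- The tie rule shows up as `≤` against the left neighbour and `<` against the upper one. -/
theorem nextIn_eq_some {g : Grid} {c d : ℕ × ℕ} :
    nextIn g c = some d ↔
      (∃ a b u, c = (a + 1, b) ∧ d = (a, b) ∧ g (a, b) = some u ∧
        ∀ b' l, b = b' + 1 → g (a + 1, b') = some l → l ≤ u) ∨
      (∃ a b l, c = (a, b + 1) ∧ d = (a, b) ∧ g (a, b) = some l ∧
        ∀ a' u, a = a' + 1 → g (a', b + 1) = some u → u < l) := by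
  obtain ⟨a, b⟩ := c
  rcases a with _ | a <;> rcases b with _ | b
  · simp [nextIn]
  · rcases h : g (0, b) with _ | l
    · simp [nextIn, h]
    · simp [nextIn, h, eq_comm]
  · rcases h : g (a, 0) with _ | l
    · simp [nextIn, h]
    · simp [nextIn, h, eq_comm]
  · rcases h : g (a, b + 1) with _ | u <;> rcases h' : g (a + 1, b) with _ | l
    · simp [nextIn, h, h']
    · simp only [nextIn]
      grind
    · simp only [nextIn]
      grind
    · simp only [nextIn]
      grind

theorem nextIn_eq_none {g : Grid} {a b : ℕ} :
    nextIn g (a, b) = none ↔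
      (∀ a', a = a' + 1 → g (a', b) = none) ∧ ∀ b', b = b' + 1 → g (a, b') = none := by
  rcases a with _ | a <;> rcases b with _ | b
  · simp [nextIn]
  · rcases h : g (0, b) with _ | l <;> simp [nextIn, h]
  · rcases h : g (a, 0) with _ | l <;> simp [nextIn, h]
  · rcases h : g (a, b + 1) with _ | u <;> rcases h' : g (a + 1, b) with _ | l
    · simp [nextIn, h, h']
    · simp [nextIn, h, h']
    · simp [nextIn, h, h']
    · by_cases hlu : l ≤ u <;> simp [nextIn, h, h', hlu]

theorem nextOut_down {g : Grid} {a b x : ℕ} (h : g (a + 1, b) = some x)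
    (h' : ∀ y, g (a, b + 1) = some y → x ≤ y) : nextOut g (a, b) = some (a + 1, b) := by
  rcases hy : g (a, b + 1) with _ | y
  · simp [nextOut, h, hy]
  · simp [nextOut, h, hy, h' y hy]

theorem nextOut_right {g : Grid} {a b x : ℕ} (h : g (a, b + 1) = some x)
    (h' : ∀ y, g (a + 1, b) = some y → x < y) : nextOut g (a, b) = some (a, b + 1) := by
  rcases hy : g (a + 1, b) with _ | y
  · simp [nextOut, h, hy]
  · simp [nextOut, h, hy, h' y hy]

theorem nextOut_eq_none {g : Grid} {a b : ℕ} (h : g (a + 1, b) = none) (h' : g (a, b + 1) = none) :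
    nextOut g (a, b) = none := by
  simp [nextOut, h, h']

theorem nextIn_le {g : Grid} {c d : ℕ × ℕ} (h : nextIn g c = some d) : d ≤ c := by
  rcases nextIn_eq_some.1 h with ⟨a, b, u, rfl, rfl, -⟩ | ⟨a, b, u, rfl, rfl, -⟩ <;>
    simp [Prod.le_def]

theorem nextIn_sum {g : Grid} {c d : ℕ × ℕ} (h : nextIn g c = some d) :
    d.1 + d.2 + 1 = c.1 + c.2 := by
  rcases nextIn_eq_some.1 h with ⟨a, b, u, rfl, rfl, -⟩ | ⟨a, b, u, rfl, rfl, -⟩ <;>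
    simp <;> omega

theorem nextIn_ne {g : Grid} {c d : ℕ × ℕ} (h : nextIn g c = some d) : d ≠ c := by
  rintro rfl
  have := nextIn_sum h
  omega

theorem nextIn_filled {g : Grid} {c d : ℕ × ℕ} (h : nextIn g c = some d) : g d ≠ none := by
  rcases nextIn_eq_some.1 h with ⟨a, b, u, rfl, rfl, h, -⟩ | ⟨a, b, u, rfl, rfl, h, -⟩ <;>
    simp [h]

theorem moveHole_apply (p : Grid × (ℕ × ℕ)) (d x : ℕ × ℕ) :
    (moveHole p d).1 x = if x = d then none else if x = p.2 then p.1 d else p.1 x := by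
  simp only [moveHole, Function.update_apply]

@[simp] theorem moveHole_snd (p : Grid × (ℕ × ℕ)) (d : ℕ × ℕ) : (moveHole p d).2 = d := rfl

theorem exists_path_nextIn (p : Grid × (ℕ × ℕ)) :
    ∃ k q, Path nextIn k p q ∧ nextIn q.1 q.2 = none ∧ k ≤ p.2.1 + p.2.2 := by
  induction hs : p.2.1 + p.2.2 generalizing p with
  | zero =>
    refine ⟨0, p, .refl p, ?_, le_rfl⟩
    by_contra h
    obtain ⟨d, hd⟩ := Option.ne_none_iff_exists'.1 h
    have := nextIn_sum hd
    omega
  | succ m ih =>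
    rcases h : nextIn p.1 p.2 with _ | d
    · exact ⟨0, p, .refl p, h, by omega⟩
    · have := nextIn_sum h
      obtain ⟨k, q, h1, h2, h3⟩ := ih (moveHole p d) (by simp; omega)
      exact ⟨k + 1, q, .head h h1, h2, by omega⟩

theorem path_sum {k : ℕ} {p q : Grid × (ℕ × ℕ)} (h : Path nextIn k p q) :
    q.2.1 + q.2.2 + k = p.2.1 + p.2.2 := by
  induction h with
  | refl p => rfl
  | head h1 _ ih =>
    have := nextIn_sum h1
    simp only [moveHole_snd] at ih
    omega

/-- A slide does not change the entries outside the rectangle spanned by the first hole. -/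
theorem path_apply_of_not_le {k : ℕ} {p q : Grid × (ℕ × ℕ)} (h : Path nextIn k p q)
    {x : ℕ × ℕ} (hx : ¬ x ≤ p.2) : q.1 x = p.1 x := by
  induction h with
  | refl p => rfl
  | @head k p q d h1 _ ih =>
    have hd := nextIn_le h1
    rw [ih (fun h => hx (h.trans hd)), moveHole_apply, if_neg, if_neg]
    · rintro rfl; exact hx le_rfl
    · rintro rfl; exact hx hd

/-! ### Punctured standard tableaux -/

/-- A standard filling, with a hole at `c`, of an upper order ideal of the `r × s` rectangle. -/
structure Punctured (r s : ℕ) (g : Grid) (c : ℕ × ℕ) : Prop where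
  hole : g c = none
  out : ∀ p, g p ≠ none → p.1 < r ∧ p.2 < s
  mem : c.1 < r ∧ c.2 < s
  up : ∀ p q, p ≤ q → q.1 < r → q.2 < s → q ≠ c → g p ≠ none → g q ≠ none
  inc : ∀ p q x y, g p = some x → g q = some y → p ≤ q → p ≠ q → x < y
  inj : ∀ p q x, g p = some x → g q = some x → p = q

/-- The entry that moves is the larger neighbour of the hole, so in its new box it still exceeds
everything weakly above and to the left; all other comparisons are inherited. -/
theorem Punctured.step {r s : ℕ} {g : Grid} {c d : ℕ × ℕ} (h : Punctured r s g c)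
    (hd : nextIn g c = some d) : Punctured r s (moveHole (g, c) d).1 d := by
  have hdc := nextIn_le hd
  have hne := nextIn_ne hd
  have hf := nextIn_filled hd
  have hc := h.hole
  have happ : ∀ x, (moveHole (g, c) d).1 x = if x = d then none else if x = c then g d else g x :=
    fun x => moveHole_apply (g, c) d x
  -- An entry in the rectangle spanned by the hole is weakly above and to the left of one of its two
  -- neighbours, and the chosen neighbour is the larger of the two.
  have hmax : ∀ p x y, g p = some x → g d = some y → p ≤ c → p ≠ d → x < y := by
    intro p x y hp hy hpc hpd
    have hpc' : p ≠ c := by rintro rfl; simp [hc] at hp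
    rcases nextIn_eq_some.1 hd with ⟨a, b, u, rfl, rfl, hu, hl⟩ | ⟨a, b, l, rfl, rfl, hl, hu⟩
    · by_cases hpa : p ≤ (a, b)
      · exact h.inc _ _ _ _ hp hy hpa hpd
      · obtain ⟨p1, p2⟩ := p
        simp only [Prod.mk_le_mk, Prod.mk.injEq, ne_eq] at hpc hpa hpc'
        obtain rfl : p1 = a + 1 := by omega
        obtain ⟨b', rfl⟩ : ∃ b', b = b' + 1 := ⟨b - 1, by omega⟩
        have hlf : g (a + 1, b') ≠ none := by
          refine h.up (a + 1, p2) _ ?_ h.mem.1 ?_ ?_ (by simp [hp])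
          · simp; omega
          · have := h.mem.2; simp at this ⊢; omega
          · simp
        obtain ⟨l, hl'⟩ := Option.ne_none_iff_exists'.1 hlf
        have h1 := hl _ _ rfl hl'
        have hyu : y = u := by simpa [hy] using hu
        have h2 : l ≠ u := by
          rintro rfl
          have := h.inj _ _ _ hl' hu
          simp at this
        by_cases hpl : p2 = b'
        · subst hpl
          rw [hp] at hl'
          simp at hl'; omega
        · have := h.inc _ _ _ _ hp hl' (by simp; omega) (by simpa using hpl)
          omega
    · by_cases hpa : p ≤ (a, b)
      · exact h.inc _ _ _ _ hp hy hpa hpd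
      · obtain ⟨p1, p2⟩ := p
        simp only [Prod.mk_le_mk, Prod.mk.injEq, ne_eq] at hpc hpa hpc'
        obtain rfl : p2 = b + 1 := by omega
        obtain ⟨a', rfl⟩ : ∃ a', a = a' + 1 := ⟨a - 1, by omega⟩
        have hlf : g (a', b + 1) ≠ none := by
          refine h.up (p1, b + 1) _ ?_ ?_ h.mem.2 ?_ (by simp [hp])
          · simp; omega
          · have := h.mem.1; simp at this ⊢; omega
          · simp
        obtain ⟨u, hu'⟩ := Option.ne_none_iff_exists'.1 hlf
        have h1 := hu _ _ rfl hu'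
        have hyu : y = l := by simpa [hy] using hl
        by_cases hpl : p1 = a'
        · subst hpl
          rw [hp] at hu'
          simp at hu'; omega
        · have := h.inc _ _ _ _ hp hu' (by simp; omega) (by simpa using hpl)
          omega
  refine ⟨by simp [happ], ?_, ?_, ?_, ?_, ?_⟩
  · intro p hp
    rw [happ] at hp
    split_ifs at hp with h1 h2
    · exact absurd rfl hp
    · rw [h2]; exact h.mem
    · exact h.out p hp
  · exact h.out d hf
  · intro p q hpq hq1 hq2 hqd hp
    rw [happ] at hp ⊢
    rw [if_neg hqd]
    split_ifs at hp with h1 h2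
    · exact absurd rfl hp
    · split_ifs with h3
      · exact hf
      · exact h.up d q (hdc.trans (h2 ▸ hpq)) hq1 hq2 h3 hf
    · split_ifs with h3
      · exact hf
      · exact h.up p q hpq hq1 hq2 h3 hp
  · intro p q x y hx hy hpq hne'
    rw [happ] at hx hy
    split_ifs at hx with h1 h2 <;> split_ifs at hy with h3 h4
    · exact absurd (h2.trans h4.symm) hne'
    · exact h.inc _ _ _ _ hx hy (hdc.trans (h2 ▸ hpq)) (Ne.symm h3)
    · exact hmax _ _ _ hx hy (h4 ▸ hpq) h1
    · exact h.inc _ _ _ _ hx hy hpq hne'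
  · intro p q x hx hy
    rw [happ] at hx hy
    split_ifs at hx with h1 h2 <;> split_ifs at hy with h3 h4
    · exact h2.trans h4.symm
    · exact absurd (h.inj _ _ _ hx hy).symm h3
    · exact absurd (h.inj _ _ _ hx hy) h1
    · exact h.inj _ _ _ hx hy

theorem Punctured.path {r s k : ℕ} {p q : Grid × (ℕ × ℕ)} (h : Punctured r s p.1 p.2)
    (hpq : Path nextIn k p q) : Punctured r s q.1 q.2 := by
  induction hpq with
  | refl p => exact h
  | head h1 _ ih => exact ih (h.step h1)

theorem moveHole_moveHole {g : Grid} {c d : ℕ × ℕ} (hc : g c = none) (hne : d ≠ c) :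
    moveHole (moveHole (g, c) d) c = (g, c) := by
  refine Prod.ext (funext fun x => ?_) rfl
  rw [moveHole_apply]
  simp only [moveHole_snd, moveHole_apply]
  by_cases h1 : x = c
  · simp [h1, hc]
  · by_cases h2 : x = d
    · simp [h2, hne, hne.symm]
    · simp [h1, h2]

/-- Outward slides undo inward slides. -/
theorem Punctured.nextOut_moveHole {r s : ℕ} {g : Grid} {c d : ℕ × ℕ} (h : Punctured r s g c)
    (hd : nextIn g c = some d) : nextOut (moveHole (g, c) d).1 d = some c := by
  rcases nextIn_eq_some.1 hd with ⟨a, b, u, rfl, rfl, hu, -⟩ | ⟨a, b, l, rfl, rfl, hl, -⟩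
  · refine nextOut_down (x := u) ?_ fun y hy => ?_
    · simp [moveHole_apply, hu]
    · rw [moveHole_apply] at hy
      simp at hy
      exact (h.inc _ _ _ _ hu hy (by simp) (by simp)).le
  · refine nextOut_right (x := l) ?_ fun y hy => ?_
    · simp [moveHole_apply, hl]
    · rw [moveHole_apply] at hy
      simp at hy
      exact h.inc _ _ _ _ hl hy (by simp) (by simp)

/-- This is what inverts promotion and evaluates the outward slides in the moves. -/
theorem Punctured.path_reverse {r s k : ℕ} {p q : Grid × (ℕ × ℕ)} (h : Punctured r s p.1 p.2)
    (hpq : Path nextIn k p q) : Path nextOut k q p := by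
  induction hpq with
  | refl p => exact .refl p
  | @head k p q d h1 _ ih =>
    have := (ih (h.step h1)).tail (d := p.2) (h.nextOut_moveHole h1)
    rwa [moveHole_moveHole h.hole (nextIn_ne h1)] at this

/-! ### Relabelling and changing unseen entries -/

/-- A slide depends only on comparisons between the upper and the left neighbour of a hole, and
neither of these is the origin when both exist. Hence `φ` may be arbitrary on the entry at the
origin. -/
theorem path_map {φ : ℕ → ℕ} {k : ℕ} {p q : Grid × (ℕ × ℕ)} (h : Path nextIn k p q)
    (hφ : ∀ c d x y, c ≠ (0, 0) → d ≠ (0, 0) → p.1 c = some x → p.1 d = some y →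
      (x ≤ y ↔ φ x ≤ φ y)) :
    Path nextIn k (fun c => (p.1 c).map φ, p.2) (fun c => (q.1 c).map φ, q.2) := by
  induction h with
  | refl p => exact .refl _
  | @head k p q d h1 h2 ih =>
    have hmove : moveHole (fun c => (p.1 c).map φ, p.2) d =
        (fun c => ((moveHole p d).1 c).map φ, (moveHole p d).2) := by
      refine Prod.ext (funext fun x => ?_) rfl
      simp only [moveHole_apply]
      split_ifs <;> rfl
    have hnext : nextIn (fun c => (p.1 c).map φ) p.2 = some d := by
      rcases nextIn_eq_some.1 h1 with ⟨a, b, u, hp, rfl, hu, hl⟩ | ⟨a, b, l, hp, rfl, hl, hu⟩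
      · refine nextIn_eq_some.2 (.inl ⟨a, b, φ u, hp, rfl, by simp [hu], ?_⟩)
        rintro b' l rfl h
        obtain ⟨l, hl', rfl⟩ := Option.map_eq_some_iff.1 h
        exact (hφ _ _ _ _ (by simp) (by simp) hl' hu).1 (hl _ _ rfl hl')
      · refine nextIn_eq_some.2 (.inr ⟨a, b, φ l, hp, rfl, by simp [hl], ?_⟩)
        rintro a' u rfl h
        obtain ⟨u, hu', rfl⟩ := Option.map_eq_some_iff.1 h
        have h3 := hφ _ _ _ _ (by simp) (by simp) hl hu'
        have := hu _ _ rfl hu'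
        by_contra h4
        exact absurd (h3.2 (not_lt.1 h4)) (not_le.2 this)
    refine .head hnext ?_
    rw [hmove]
    -- Once the hole is at the origin it stops, so the entry that has just left the origin is never
    -- compared.
    by_cases hd : d = (0, 0)
    · subst hd
      cases h2 with
      | refl => exact .refl _
      | head h3 _ => exact absurd (nextIn_sum h3) (by simp)
    · refine ih fun c e x y hc he hx hy => ?_
      rw [moveHole_apply] at hx hy
      split_ifs at hx with h3 h4 <;> split_ifs at hy with h5 h6
      · exact hφ _ _ _ _ hd hd hx hy
      · exact hφ _ _ _ _ hd he hx hy
      · exact hφ _ _ _ _ hc hd hx hy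
      · exact hφ _ _ _ _ hc he hx hy

/-- The slides of a hole into the inner corner, when the hole would otherwise stop next to it. -/
theorem path_update_corner {k : ℕ} {p q : Grid × (ℕ × ℕ)} (h : Path nextIn k p q)
    (h0 : p.1 (0, 0) = none) (hq : q.2 = (0, 1) ∨ q.2 = (1, 0)) (v : ℕ) :
    Path nextIn (k + 1) (Function.update p.1 (0, 0) (some v), p.2)
      (Function.update (Function.update q.1 q.2 (some v)) (0, 0) none, (0, 0)) := by
  induction h with
  | refl p =>
    refine .head (d := (0, 0)) (nextIn_eq_some.2 ?_) ?_
    · rcases hq with h | h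
      · exact .inr ⟨0, 0, v, h, rfl, by simp, by simp⟩
      · exact .inl ⟨0, 0, v, h, rfl, by simp, by simp⟩
    · convert Path.refl _ using 1
      refine Prod.ext (funext fun x => ?_) rfl
      simp only [moveHole_apply, Function.update_apply]
      split_ifs <;> simp_all
  | @head k p q d h1 h2 ih =>
    have hsum := path_sum h2
    have hsum' := nextIn_sum h1
    have hd : d ≠ (0, 0) := by
      rintro rfl
      rcases hq with h | h <;> simp [h] at hsum
    have hp : p.2 ≠ (0, 0) := by
      intro h
      simp [h] at hsum'
    have hp1 : p.2.1 + p.2.2 ≠ 1 := by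
      intro h
      exact hd (Prod.ext (by simp; omega) (by simp; omega))
    have hmove : moveHole (Function.update p.1 (0, 0) (some v), p.2) d =
        (Function.update (moveHole p d).1 (0, 0) (some v), (moveHole p d).2) := by
      refine Prod.ext (funext fun x => ?_) rfl
      simp only [moveHole_apply, Function.update_apply]
      split_ifs <;> simp_all
    have hnext : nextIn (Function.update p.1 (0, 0) (some v)) p.2 = some d := by
      have hu : ∀ x, x ≠ (0, 0) → Function.update p.1 (0, 0) (some v) x = p.1 x :=
        fun x hx => Function.update_of_ne hx _ _
      rcases nextIn_eq_some.1 h1 with ⟨a, b, u, hp', rfl, hu', hl⟩ | ⟨a, b, l, hp', rfl, hl, hu'⟩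
      · refine nextIn_eq_some.2 (.inl ⟨a, b, u, hp', rfl, by rw [hu _ hd, hu'], ?_⟩)
        rintro b' l rfl h
        rw [hu _ (by simp)] at h
        exact hl _ _ rfl h
      · refine nextIn_eq_some.2 (.inr ⟨a, b, l, hp', rfl, by rw [hu _ hd, hl], ?_⟩)
        rintro a' u rfl h
        rw [hu _ (by simp)] at h
        exact hu' _ _ rfl h
    refine .head hnext ?_
    rw [hmove]
    refine ih ?_ hq
    rw [moveHole_apply, if_neg hd.symm, if_neg hp.symm, h0]

/-- A slide only inspects boxes weakly above and to the left of its first hole. -/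
theorem path_update_of_not_le {k : ℕ} {p q : Grid × (ℕ × ℕ)} (h : Path nextIn k p q)
    {z : ℕ × ℕ} (hz : ¬ z ≤ p.2) (v : Option ℕ) :
    Path nextIn k (Function.update p.1 z v, p.2) (Function.update q.1 z v, q.2) := by
  induction h with
  | refl p => exact .refl _
  | @head k p q d h1 h2 ih =>
    have hd := nextIn_le h1
    have hzd : z ≠ d := by rintro rfl; exact hz hd
    have hzp : z ≠ p.2 := by rintro rfl; exact hz le_rfl
    have hu : ∀ x, x ≤ p.2 → Function.update p.1 z v x = p.1 x :=
      fun x hx => Function.update_of_ne (by rintro rfl; exact hz hx) _ _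
    have hmove : moveHole (Function.update p.1 z v, p.2) d =
        (Function.update (moveHole p d).1 z v, (moveHole p d).2) := by
      refine Prod.ext (funext fun x => ?_) rfl
      simp only [moveHole_apply, Function.update_apply]
      split_ifs <;> simp_all
    have hnext : nextIn (Function.update p.1 z v) p.2 = some d := by
      rcases nextIn_eq_some.1 h1 with ⟨a, b, u, hp', rfl, hu', hl⟩ | ⟨a, b, l, hp', rfl, hl, hu'⟩
      · refine nextIn_eq_some.2 (.inl ⟨a, b, u, hp', rfl, by rw [hu _ hd, hu'], ?_⟩)
        rintro b' l rfl h
        rw [hu _ (by rw [hp']; simp)] at h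
        exact hl _ _ rfl h
      · refine nextIn_eq_some.2 (.inr ⟨a, b, l, hp', rfl, by rw [hu _ hd, hl], ?_⟩)
        rintro a' u rfl h
        rw [hu _ (by rw [hp']; simp)] at h
        exact hu' _ _ rfl h
    refine .head hnext ?_
    rw [hmove]
    exact ih (fun h => hz (h.trans hd))

/-! ### Transposition -/

/-- The transpose of a grid. -/
def transpose (g : Grid) : Grid := fun p => g p.swap

theorem Punctured.transpose {r s : ℕ} {g : Grid} {c : ℕ × ℕ} (h : Punctured r s g c) :
    Punctured s r (transpose g) c.swap where
  hole := by simpa [KR.transpose] using h.hole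
  out p hp := (h.out p.swap hp).symm
  mem := h.mem.symm
  up p q hpq hq1 hq2 hqc hp := by
    refine h.up p.swap q.swap (Prod.swap_le_swap.2 hpq) hq2 hq1 (fun h => hqc ?_) hp
    rw [← h, Prod.swap_swap]
  inc p q x y hx hy hpq hne :=
    h.inc p.swap q.swap x y hx hy (Prod.swap_le_swap.2 hpq) (fun h => hne (Prod.swap_inj.1 h))
  inj p q x hx hy := Prod.swap_inj.1 (h.inj p.swap q.swap x hx hy)

/-- The tie rule is not symmetric under transposition, but distinct entries leave no ties. -/
theorem nextIn_transpose {r s : ℕ} {g : Grid} {c d : ℕ × ℕ} (h : Punctured r s g c)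
    (hd : nextIn g c = some d) : nextIn (transpose g) c.swap = some d.swap := by
  rcases nextIn_eq_some.1 hd with ⟨a, b, u, rfl, rfl, hu, hl⟩ | ⟨a, b, l, rfl, rfl, hl, hu⟩
  · refine nextIn_eq_some.2 (.inr ⟨b, a, u, rfl, rfl, hu, ?_⟩)
    rintro a' l rfl hl'
    refine lt_of_le_of_ne (hl _ _ rfl hl') ?_
    rintro rfl
    have := h.inj _ _ _ hu hl'
    simp at this
  · exact nextIn_eq_some.2 (.inl ⟨b, a, l, rfl, rfl, hl, fun b' u hb hu' => (hu _ _ hb hu').le⟩)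

theorem Punctured.path_transpose {r s k : ℕ} {p q : Grid × (ℕ × ℕ)}
    (hp : Punctured r s p.1 p.2) (h : Path nextIn k p q) :
    Path nextIn k (KR.transpose p.1, p.2.swap) (KR.transpose q.1, q.2.swap) := by
  induction h with
  | refl p => exact .refl _
  | @head k p q d h1 h2 ih =>
    refine .head (nextIn_transpose hp h1) ?_
    convert ih (hp.step h1) using 1
    refine Prod.ext (funext fun x => ?_) rfl
    simp only [moveHole_apply, KR.transpose, Prod.swap_swap]
    have h1 : x = d.swap ↔ x.swap = d := by
      rw [← Prod.swap_inj, Prod.swap_swap]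
    have h2 : x = p.2.swap ↔ x.swap = p.2 := by
      rw [← Prod.swap_inj, Prod.swap_swap]
    simp only [h1, h2]

/-! ### Slides preserve descents -/

/-- Only a vertical move changes rows, and it moves one entry from row `a` to row `a + 1`. If that
entry is `x`, an `x + 1` in row `a + 1` left of the hole would have forced a horizontal move, and
one to the right would leave an entry strictly between `x` and `x + 1`. If it is `x + 1`, an `x` in
row `a` would force the left neighbour of the hole to be `x + 1` as well. -/
theorem Punctured.step_row_lt {r s : ℕ} {g : Grid} {c d p q p' q' : ℕ × ℕ} {x : ℕ}
    (h : Punctured r s g c) (hd : nextIn g c = some d) (hp : g p = some x)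
    (hq : g q = some (x + 1)) (hp' : p' = if p = d then c else p)
    (hq' : q' = if q = d then c else q) : p.1 < q.1 ↔ p'.1 < q'.1 := by
  have hc := h.hole
  have hpc : p ≠ c := by rintro rfl; simp [hc] at hp
  have hqc : q ≠ c := by rintro rfl; simp [hc] at hq
  have hpq : p ≠ q := by rintro rfl; simp [hp] at hq
  rcases nextIn_eq_some.1 hd with ⟨a, b, u, rfl, rfl, hu, hl⟩ | ⟨a, b, l, rfl, rfl, hl, hu⟩
  · by_cases hp1 : p = (a, b)
    · have hqd : q ≠ (a, b) := by rintro rfl; exact hpq hp1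
      rw [if_pos hp1] at hp'
      rw [if_neg hqd] at hq'
      rw [hp', hq', hp1]
      clear hp' hq'
      subst hp1
      obtain rfl : x = u := by simpa [hp] using hu
      obtain ⟨q1, q2⟩ := q
      have hq1 : q1 ≠ a + 1 := by
        rintro rfl
        rcases lt_trichotomy q2 b with hlt | rfl | hgt
        · obtain ⟨b', rfl⟩ : ∃ b', b = b' + 1 := ⟨b - 1, by omega⟩
          have hf : g (a + 1, b') ≠ none := by
            refine h.up (a + 1, q2) _ ?_ h.mem.1 ?_ (by simp) (by simp [hq])
            · simp; omega
            · have := h.mem.2; simp at this ⊢; omega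
          obtain ⟨l, hl'⟩ := Option.ne_none_iff_exists'.1 hf
          have h1 := hl _ _ rfl hl'
          by_cases hqb : q2 = b'
          · subst hqb; rw [hq] at hl'; simp at hl'; omega
          · have := h.inc _ _ _ _ hq hl' (by simp; omega) (by simpa using hqb)
            omega
        · exact hqc rfl
        · have hm := h.out (a + 1, q2) (by simp [hq])
          simp only at hm
          have hf : g (a, b + 1) ≠ none := by
            refine h.up (a, b) _ (by simp) ?_ ?_ (by simp) (by simp [hp])
            · simp; omega
            · simp; omega
          obtain ⟨y, hy⟩ := Option.ne_none_iff_exists'.1 hf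
          have h1 := h.inc _ _ _ _ hp hy (by simp) (by simp)
          have h2 := h.inc _ _ _ _ hy hq (by simp; omega) (by simp)
          omega
      simp only
      omega
    · by_cases hq1 : q = (a, b)
      · rw [if_neg hp1] at hp'
        rw [if_pos hq1] at hq'
        rw [hp', hq', hq1]
        clear hp' hq'
        subst hq1
        obtain rfl : x + 1 = u := by simpa [hq] using hu
        obtain ⟨p1, p2⟩ := p
        have hp2 : p1 ≠ a := by
          rintro rfl
          have hlt : p2 < b := by
            by_contra hcon
            have := h.inc _ _ _ _ hq hp (by simp; omega) (by simpa using fun h => hp1 (by simp [h]))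
            omega
          obtain ⟨b', rfl⟩ : ∃ b', b = b' + 1 := ⟨b - 1, by omega⟩
          have hm := h.mem
          simp only at hm
          have hf : g (p1 + 1, b') ≠ none := by
            refine h.up (p1, p2) _ ?_ hm.1 ?_ (by simp) (by simp [hp])
            · simp; omega
            · simp; omega
          obtain ⟨l, hl'⟩ := Option.ne_none_iff_exists'.1 hf
          have h1 := hl _ _ rfl hl'
          have h2 := h.inc _ _ _ _ hp hl' (by simp; omega) (by simp)
          have h3 : l = x + 1 := by omega
          subst h3
          have := h.inj _ _ _ hl' hu
          simp at this
        simp only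
        omega
      · rw [if_neg hp1] at hp'
        rw [if_neg hq1] at hq'
        rw [hp', hq']
  · have h1 : p'.1 = p.1 := by
      rw [hp']; split_ifs with h
      · rw [h]
      · rfl
    have h2 : q'.1 = q.1 := by
      rw [hq']; split_ifs with h
      · rw [h]
      · rfl
    rw [h1, h2]

theorem moveHole_apply_ite {g : Grid} {c d p : ℕ × ℕ} {x : ℕ} (hc : g c = none)
    (hd : d ≠ c) (hp : g p = some x) :
    (moveHole (g, c) d).1 (if p = d then c else p) = some x := by
  have hpc : p ≠ c := by rintro rfl; simp [hc] at hp
  rw [moveHole_apply]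
  by_cases h1 : p = d
  · rw [if_pos h1, if_neg hd.symm, if_pos rfl, ← h1]
    exact hp
  · rw [if_neg h1, if_neg h1, if_neg hpc]
    exact hp

theorem Punctured.path_row_lt {r s k : ℕ} {P Q : Grid × (ℕ × ℕ)} {p q p' q' : ℕ × ℕ} {x : ℕ}
    (h : Punctured r s P.1 P.2) (hPQ : Path nextIn k P Q) (hp : P.1 p = some x)
    (hq : P.1 q = some (x + 1)) (hp' : Q.1 p' = some x) (hq' : Q.1 q' = some (x + 1)) :
    p.1 < q.1 ↔ p'.1 < q'.1 := by
  induction hPQ generalizing p q with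
  | refl P => rw [h.inj _ _ _ hp hp', h.inj _ _ _ hq hq']
  | @head k P Q d h1 h2 ih =>
    rw [h.step_row_lt h1 hp hq rfl rfl]
    exact ih (h.step h1) (moveHole_apply_ite h.hole (nextIn_ne h1) hp)
      (moveHole_apply_ite h.hole (nextIn_ne h1) hq) hp' hq'

/-! ### Two slides from the same outer corner -/

/-- `m a` is the column in which a slide leaves row `a`. -/
theorem Punctured.exists_leaving_columns {r s k : ℕ} {P Q : Grid × (ℕ × ℕ)}
    (h : Punctured r s P.1 P.2) (hPQ : Path nextIn k P Q) (hQ : Q.2 = (0, 0)) :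
    ∃ m : ℕ → ℕ, m 0 = 0 ∧ m P.2.1 ≤ P.2.2 ∧ (∀ a, a < P.2.1 → m a ≤ m (a + 1)) ∧
      ∀ a, a < P.2.1 → m (a + 1) + 1 < s → ∃ x y, Q.1 (a + 1, m (a + 1)) = some x ∧
        Q.1 (a, m (a + 1) + 1) = some y ∧ x < y := by
  induction hPQ with
  | refl P => exact ⟨fun _ => 0, rfl, by simp, by simp, by simp [hQ]⟩
  | @head k P Q d h1 h2 ih =>
    obtain ⟨m, hm0, hm1, hm2, hm3⟩ := ih (h.step h1) hQ
    obtain ⟨g, c⟩ := P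
    simp only [moveHole_snd] at hm1 hm2 hm3
    rcases nextIn_eq_some.1 h1 with ⟨a, b, u, rfl, rfl, hu, -⟩ | ⟨a, b, l, rfl, rfl, hl, -⟩
    · refine ⟨Function.update m (a + 1) b, ?_, by simp, ?_, ?_⟩
      · rw [Function.update_of_ne (by simp), hm0]
      · intro a' ha'
        simp only at ha' hm2 hm1
        rw [Function.update_of_ne (by omega)]
        by_cases haa : a' = a
        · subst haa; simpa using hm1
        · rw [Function.update_of_ne (by omega)]
          exact hm2 _ (by omega)
      · intro a' ha' hs
        simp only at ha'
        by_cases haa : a' = a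
        · subst haa
          rw [Function.update_self] at hs ⊢
          have hu : g (a', b) = some u := hu
          have hf : g (a', b + 1) ≠ none := by
            refine h.up (a', b) _ (by simp) ?_ hs (by simp) (by simp [hu])
            have := h.mem.1; simp at this ⊢; omega
          obtain ⟨y, hy⟩ := Option.ne_none_iff_exists'.1 hf
          refine ⟨u, y, ?_, ?_, h.inc _ _ _ _ hu hy (by simp) (by simp)⟩
          · rw [path_apply_of_not_le h2 (by simp)]
            simp [moveHole_apply, hu]
          · rw [path_apply_of_not_le h2 (by simp)]
            simp [moveHole_apply, hy]
        · rw [Function.update_of_ne (by omega)] at hs ⊢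
          exact hm3 _ (by simp; omega) hs
    · exact ⟨m, hm0, by simp at hm1 ⊢; omega, hm2, hm3⟩

/-- The columns `m` come from an earlier slide. If the hole touches that slide from the right, at
the box right of `(a + 1, m (a + 1))`, its left neighbour `x` is smaller than its upper neighbour
`y`, so it moves up. In row `0` it cannot cross because the origin is empty. Thus it stays strictly
to the right of the earlier path. -/
theorem Punctured.path_stays_right {r s k : ℕ} {P Q : Grid × (ℕ × ℕ)} {m : ℕ → ℕ}
    (h : Punctured r s P.1 P.2) (hPQ : Path nextIn k P Q) (h00 : P.1 (0, 0) = none)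
    (hm0 : m 0 = 0) (hm : ∀ a, a < P.2.1 → m a ≤ m (a + 1))
    (hlt : ∀ a, a < P.2.1 → m (a + 1) + 1 < s → ∃ x y, P.1 (a + 1, m (a + 1)) = some x ∧
        P.1 (a, m (a + 1) + 1) = some y ∧ x < y)
    (hP : m P.2.1 < P.2.2) : m Q.2.1 < Q.2.2 := by
  induction hPQ with
  | refl P => exact hP
  | @head k P Q d h1 h2 ih =>
    obtain ⟨g, c⟩ := P
    have hmem := h.mem
    rcases nextIn_eq_some.1 h1 with ⟨a, b, u, rfl, rfl, hu, -⟩ | ⟨a, b, l, rfl, rfl, hl, hu⟩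
    · simp only at hm hlt hP hmem
      have hma := hm a (by omega)
      refine ih (h.step h1) ?_ (fun a' ha' => hm a' ?_) (fun a' ha' hs => ?_) ?_
      · rw [moveHole_apply]; split_ifs with h3 h4
        · rfl
        · simp at h4
        · exact h00
      · simp at ha'; omega
      · simp only [moveHole_snd] at ha'
        obtain ⟨x, y, hx, hy, hxy⟩ := hlt a' (by omega) hs
        refine ⟨x, y, ?_, ?_, hxy⟩
        · rw [moveHole_apply, if_neg, if_neg]
          · exact hx
          · simp only [Prod.mk.injEq]; omega
          · simp only [Prod.mk.injEq]
            rintro ⟨rfl, rfl⟩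
            omega
        · rw [moveHole_apply, if_neg, if_neg]
          · exact hy
          · simp only [Prod.mk.injEq]; omega
          · simp only [Prod.mk.injEq]; omega
      · simp; omega
    · simp only at hm hlt hP hmem
      have hmb : m a < b := by
        rcases (Nat.lt_succ_iff.1 hP).lt_or_eq with h3 | h3
        · exact h3
        · exfalso
          rcases a with _ | a
          · rw [hm0] at h3
            rw [← h3] at hl
            simp only at h00
            simp [h00] at hl
          · obtain ⟨x, y, hx, hy, hxy⟩ := hlt a (by omega) (by omega)
            rw [h3] at hx hy
            have := hu _ _ rfl hy
            simp only at hx hl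
            rw [hx] at hl
            simp at hl; omega
      refine ih (h.step h1) ?_ (fun a' ha' => hm a' ?_) (fun a' ha' hs => ?_) ?_
      · rw [moveHole_apply]; split_ifs with h3 h4
        · rfl
        · simp at h4
        · exact h00
      · exact ha'
      · simp only [moveHole_snd] at ha'
        obtain ⟨x, y, hx, hy, hxy⟩ := hlt a' (by omega) hs
        refine ⟨x, y, ?_, ?_, hxy⟩
        · rw [moveHole_apply, if_neg, if_neg]
          · exact hx
          · simp only [Prod.mk.injEq]; rintro ⟨rfl, h4⟩; omega
          · simp only [Prod.mk.injEq]; rintro ⟨rfl, h4⟩; omega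
        · rw [moveHole_apply, if_neg, if_neg]
          · exact hy
          · simp only [Prod.mk.injEq]; omega
          · simp only [Prod.mk.injEq]; omega
      · simpa using hmb

/-! ### Slides that do not cross -/

/-- By `hle`, wherever the second slide moves up the first one would move up too. Started on the
same antidiagonal and not below the second, the first path therefore never gets below it. A first
path that enters the origin from `(1, 0)`, thereby leaving `v` there, forces the second to do the
same. -/
theorem path_last_step_mono {r s k k' : ℕ} {g₀ g₀' : Grid} {p q p' q' : Grid × (ℕ × ℕ)} {v : ℕ}
    (hp : Punctured r s p.1 p.2) (h : Path nextIn k p q) (h' : Path nextIn k' p' q')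
    (hq : q.2 = (0, 0)) (hq' : q'.2 = (0, 0)) (hp0 : p.2 ≠ (0, 0))
    (hg : ∀ c, c ≤ p.2 → c ≠ p.2 → p.1 c = g₀ c)
    (hg' : ∀ c, c ≤ p'.2 → c ≠ p'.2 → p'.1 c = g₀' c)
    (hnone : ∀ c, g₀ c = none → g₀' c = none) (hnone' : ∀ c, g₀' c = none → g₀ c = none)
    (hle : ∀ a b u l u' l', g₀ (a, b + 1) = some u → g₀ (a + 1, b) = some l →
      g₀' (a, b + 1) = some u' → g₀' (a + 1, b) = some l' → l' ≤ u' → l ≤ u)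
    (hsum : p.2.1 + p.2.2 = p'.2.1 + p'.2.2) (hrow : p.2.1 ≤ p'.2.1)
    (hv : g₀ (0, 0) = some v) (hv' : g₀' (0, 0) = some v)
    (hqv : q.1 (1, 0) = some v) : q'.1 (1, 0) = some v := by
  induction h generalizing p' k' with
  | refl p => exact absurd hq hp0
  | @head k p q d h1 h2 ih =>
    cases h' with
    | refl =>
      exfalso
      rw [hq'] at hsum
      exact hp0 (Prod.ext (by simp at hsum ⊢; omega) (by simp at hsum ⊢; omega))
    | @head k' _ _ d' h1' h2' =>
    have hs := nextIn_sum h1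
    have hs' := nextIn_sum h1'
    by_cases hd : d = (0, 0)
    · have hd' : d' = (0, 0) := by
        subst hd
        exact Prod.ext (by simp at hs ⊢; omega) (by simp at hs ⊢; omega)
      subst hd hd'
      have hp00 : p.1 (0, 0) = some v := by rw [hg _ (by simp [Prod.le_def]) hp0.symm, hv]
      have hp00' : p'.1 (0, 0) = some v := by
        rw [hg' _ (by simp [Prod.le_def]) ?_, hv']
        intro h; rw [← h] at hs'; simp at hs'
      cases h2 with
      | head h3 _ => exact absurd (nextIn_sum h3) (by simp)
      | refl =>
      cases h2' with
      | head h3 _ => exact absurd (nextIn_sum h3) (by simp)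
      | refl =>
      have hp10 : p.2 = (1, 0) := by
        by_contra hne
        rw [moveHole_apply, if_neg (by simp), if_neg (Ne.symm hne)] at hqv
        have := hp.inj _ _ _ hqv hp00
        simp at this
      have hp10' : p'.2 = (1, 0) := by
        rw [hp10] at hsum hrow
        exact Prod.ext (by simp at hsum hrow ⊢; omega) (by simp at hsum hrow ⊢; omega)
      rw [moveHole_apply, hp10']
      simpa using hp00'
    · have hle1 := nextIn_le h1
      have hle1' := nextIn_le h1'
      refine ih (hp.step h1) h2' hq hd (fun c hc hcd => ?_) (fun c hc hcd => ?_) ?_ ?_ hqv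
      · rw [moveHole_snd] at hc hcd
        rw [moveHole_apply, if_neg hcd, if_neg]
        · refine hg c (hc.trans hle1) ?_
          rintro rfl
          exact hcd (le_antisymm hc hle1)
        · rintro rfl
          exact hcd (le_antisymm hc hle1)
      · rw [moveHole_snd] at hc hcd
        rw [moveHole_apply, if_neg hcd, if_neg]
        · refine hg' c (hc.trans hle1') ?_
          rintro rfl
          exact hcd (le_antisymm hc hle1')
        · rintro rfl
          exact hcd (le_antisymm hc hle1')
      · simp; omega
      · simp only [moveHole_snd]
        rcases hrow.lt_or_eq with hlt | heq
        · have h3 : d.1 ≤ p.2.1 := hle1.1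
          have h4 : d'.2 ≤ p'.2.2 := hle1'.2
          omega
        · have hpp : p.2 = p'.2 := Prod.ext heq (by omega)
          rcases nextIn_eq_some.1 h1' with ⟨a, b, u', he', rfl, hu', hl'⟩ |
            ⟨a, b, l', he', rfl, -, -⟩
          · rcases nextIn_eq_some.1 h1 with ⟨a₁, b₁, u, he, rfl, -, -⟩ |
              ⟨a₁, b₁, l, he, rfl, hl, hu⟩
            · rw [hpp, he'] at he; simp at he; simp [he]
            · exfalso
              rw [hpp, he'] at he
              simp only [Prod.mk.injEq] at he
              obtain ⟨rfl, rfl⟩ := he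
              rw [hpp, he'] at hg
              rw [he'] at hg'
              rw [hg _ (by simp) (by simp)] at hl
              rw [hg' _ (by simp) (by simp)] at hu'
              obtain ⟨u, hu2⟩ := Option.ne_none_iff_exists'.1
                (fun h => by simp [hnone _ h] at hu' : g₀ (a, b₁ + 1) ≠ none)
              obtain ⟨l', hl2⟩ := Option.ne_none_iff_exists'.1
                (fun h => by simp [hnone' _ h] at hl : g₀' (a + 1, b₁) ≠ none)
              have h5 := hu _ _ rfl (by rw [hg _ (by simp) (by simp)]; exact hu2)
              have h6 := hl' _ _ rfl (by rw [hg' _ (by simp) (by simp)]; exact hl2)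
              exact absurd (hle _ _ _ _ _ _ hu2 hl hu' hl2 h6) (not_le.2 h5)
          · have h3 : d.1 ≤ p.2.1 := hle1.1
            rw [hpp, he'] at h3
            exact h3

/-! ### Reading order in a rectangle -/

/-- `p` is read before `q`: rows from bottom to top, each from left to right. -/
def ReadBefore (p q : ℕ × ℕ) : Prop := q.1 < p.1 ∨ p.1 = q.1 ∧ p.2 < q.2

theorem mem_facBoxes {r s : ℕ} (c : Fin r × Fin s) : c ∈ facBoxes r s := by
  simp only [facBoxes, List.mem_flatMap, List.mem_reverse, List.mem_map]
  exact ⟨c.1, List.mem_finRange _, c.2, List.mem_finRange _, rfl⟩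

theorem pairwise_facBoxes (r s : ℕ) :
    (facBoxes r s).Pairwise fun c d => ReadBefore (c.1, c.2) (d.1, d.2) := by
  rw [facBoxes, List.pairwise_flatMap]
  refine ⟨fun i _ => ?_, ?_⟩
  · rw [List.pairwise_map]
    exact (List.pairwise_lt_finRange s).imp fun h => .inr ⟨rfl, h⟩
  · rw [List.pairwise_reverse]
    refine (List.pairwise_lt_finRange r).imp fun h x hx y hy => ?_
    simp only [List.mem_map] at hx hy
    obtain ⟨_, _, rfl⟩ := hx
    obtain ⟨_, _, rfl⟩ := hy
    exact .inl h

theorem list_eq_of_pairwise {α : Type*} {lt : α → α → Prop} (hirr : ∀ a, ¬ lt a a)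
    (hasymm : ∀ a b, lt a b → ¬ lt b a) {l l' : List α} (h : l.Pairwise lt) (h' : l'.Pairwise lt)
    (hm : ∀ a, a ∈ l ↔ a ∈ l') : l = l' := by
  have nd : ∀ {l : List α}, l.Pairwise lt → l.Nodup := fun h =>
    h.imp (by rintro a _ h1 rfl; exact hirr a h1)
  refine List.Perm.eq_of_pairwise (le := lt) (fun a b _ _ h1 h2 => absurd h2 (hasymm a b h1)) h h' ?_
  exact (List.perm_ext_iff_of_nodup (nd h) (nd h')).2 hm

theorem boxesWith_eq {r s : ℕ} {g : Grid} {x : ℕ} {l : List (ℕ × ℕ)} (hl : l.Pairwise ReadBefore)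
    (hm : ∀ c, c ∈ l ↔ (c.1 < r ∧ c.2 < s) ∧ g c = some x) : boxesWith r s g x = l := by
  refine list_eq_of_pairwise (lt := ReadBefore) ?_ ?_ ?_ hl fun c => ?_
  · rintro a (h | h) <;> omega
  · rintro a b (h | h) (h' | h') <;> omega
  · refine List.Pairwise.filter _ ?_
    rw [List.pairwise_map]
    exact pairwise_facBoxes r s
  · rw [hm]
    simp only [boxesWith, List.mem_filter, List.mem_map, decide_eq_true_eq]
    constructor
    · rintro ⟨⟨d, -, rfl⟩, h⟩
      exact ⟨⟨d.1.2, d.2.2⟩, h⟩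
    · rintro ⟨h, h'⟩
      exact ⟨⟨(⟨c.1, h.1⟩, ⟨c.2, h.2⟩), mem_facBoxes _, rfl⟩, h'⟩

theorem mem_boxesWith {r s : ℕ} {g : Grid} {x : ℕ} {c : ℕ × ℕ} :
    c ∈ boxesWith r s g x ↔ (c.1 < r ∧ c.2 < s) ∧ g c = some x := by
  simp only [boxesWith, List.mem_filter, List.mem_map, decide_eq_true_eq]
  constructor
  · rintro ⟨⟨d, -, rfl⟩, h⟩
    exact ⟨⟨d.1.2, d.2.2⟩, h⟩
  · rintro ⟨h, h'⟩
    exact ⟨⟨(⟨c.1, h.1⟩, ⟨c.2, h.2⟩), mem_facBoxes _, rfl⟩, h'⟩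

theorem nodup_boxesWith (r s : ℕ) (g : Grid) (x : ℕ) : (boxesWith r s g x).Nodup := by
  refine List.Nodup.filter _ ?_
  refine List.Pairwise.imp (R := ReadBefore) ?_ ?_
  · rintro a _ (h | h) rfl <;> omega
  · rw [List.pairwise_map]
    exact pairwise_facBoxes r s

theorem toGrid_eq_some {r s : ℕ} {t : Fac r s} {c : ℕ × ℕ} {x : ℕ} :
    toGrid t c = some x ↔ ∃ h : c.1 < r ∧ c.2 < s, t ⟨c.1, h.1⟩ ⟨c.2, h.2⟩ = x := by
  unfold toGrid
  split_ifs with h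
  · simp [h]
  · simp [h]

@[simp] theorem toGrid_coe {r s : ℕ} (t : Fac r s) (i : Fin r) (j : Fin s) :
    toGrid t (i, j) = some (t i j) := toGrid_eq_some.2 ⟨⟨i.2, j.2⟩, rfl⟩

theorem toGrid_injective {r s : ℕ} : Function.Injective (toGrid : Fac r s → Grid) := by
  intro t t' h
  ext i j
  have := congrFun h (i, j)
  simpa using this

theorem ofGrid_toGrid {r s : ℕ} (t : Fac r s) : ofGrid r s (toGrid t) = t := by
  ext i j
  simp [ofGrid]

/-! ### Promotion permutes the boxes -/

/-- The effect of promotion on the entries. -/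
def cyc (n x : ℕ) : ℕ := if x = n then 1 else x + 1

/-- Each step exchanges the hole with a filled box, so nothing about the filling is needed. This
generality matters: the preimages chosen by `prInv` are only known to be semistandard. The last
clause keeps other holes in place, since a hole never enters an empty box. -/
theorem slide_perm (r s N : ℕ) {g : Grid} {c : ℕ × ℕ} (hg : g c = none) (hc : c.1 < r ∧ c.2 < s) :
    ∃ σ : Equiv.Perm (ℕ × ℕ), (∀ p, p.1 < r ∧ p.2 < s → (σ p).1 < r ∧ (σ p).2 < s) ∧
      (slide nextIn N (g, c)).1 = g ∘ σ ∧
      ∀ x, g x = none → x ≠ c → (slide nextIn N (g, c)).1 x = none := by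
  induction N generalizing g c with
  | zero => exact ⟨1, by simp, rfl, fun x hx _ => hx⟩
  | succ N ih =>
    rcases h : nextIn g c with _ | d
    · refine ⟨1, by simp, by simp [slide, h], fun x hx _ => by simpa [slide, h]⟩
    · have hd := nextIn_le h
      have hd' : d.1 < r ∧ d.2 < s := ⟨lt_of_le_of_lt hd.1 hc.1, lt_of_le_of_lt hd.2 hc.2⟩
      have happ : ∀ x, (moveHole (g, c) d).1 x =
        if x = d then none else if x = c then g d else g x := fun x => moveHole_apply (g, c) d x
      obtain ⟨σ, h1, h2, h3⟩ := ih (g := (moveHole (g, c) d).1) (c := d) (by simp [happ]) hd'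
      have hs : slide nextIn (N + 1) (g, c) = slide nextIn N ((moveHole (g, c) d).1, d) := by
        simp only [slide, h]; rfl
      have hmove : (moveHole (g, c) d).1 = g ∘ Equiv.swap c d := by
        funext x
        rw [happ, Function.comp_apply, Equiv.swap_apply_def]
        split_ifs with h4 h5 h5
        · rw [← h4, h5, hg]
        · rw [hg]
        · rfl
        · rfl
      refine ⟨Equiv.swap c d * σ, fun p hp => ?_, ?_, fun x hx hxc => ?_⟩
      · have := h1 p hp
        rw [Equiv.Perm.mul_apply, Equiv.swap_apply_def]
        split_ifs
        · exact hd'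
        · exact hc
        · exact this
      · rw [hs, h2, hmove]; rfl
      · rw [hs]
        have hxd : x ≠ d := by rintro rfl; exact nextIn_filled h hx
        refine h3 x ?_ hxd
        rw [happ, if_neg hxd, if_neg hxc, hx]

theorem foldl_jdtIn_perm (r s : ℕ) (l : List (ℕ × ℕ)) {g : Grid} (hl : l.Nodup)
    (hr : ∀ c ∈ l, c.1 < r ∧ c.2 < s) (hg : ∀ c ∈ l, g c = none) :
    ∃ σ : Equiv.Perm (ℕ × ℕ), (∀ p, p.1 < r ∧ p.2 < s → (σ p).1 < r ∧ (σ p).2 < s) ∧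
      l.foldl (fun g c => (jdtIn r s g c).1) g = g ∘ σ := by
  induction l generalizing g with
  | nil => exact ⟨1, by simp, rfl⟩
  | cons c l ih =>
    rw [List.nodup_cons] at hl
    have hgc := hg c (by simp)
    obtain ⟨σ, h1, h2, h3⟩ := slide_perm r s (r + s) hgc (hr c (by simp))
    have hj : (jdtIn r s g c).1 = (slide nextIn (r + s) (g, c)).1 := by
      rw [jdtIn, Function.update_eq_self_iff.2 hgc.symm]
    obtain ⟨τ, h4, h5⟩ := ih (g := (jdtIn r s g c).1) hl.2 (fun d hd => hr d (by simp [hd]))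
      (fun d hd => by
        rw [hj]
        refine h3 d (hg d (by simp [hd])) ?_
        rintro rfl
        exact hl.1 hd)
    refine ⟨σ * τ, fun p hp => h1 _ (h4 p hp), ?_⟩
    rw [List.foldl_cons, h5, hj, h2]
    rfl

theorem foldl_update_none (l : List (ℕ × ℕ)) (g : Grid) (p : ℕ × ℕ) :
    l.foldl (fun g c => Function.update g c none) g p = if p ∈ l then none else g p := by
  induction l generalizing g with
  | nil => simp
  | cons c l ih =>
    rw [List.foldl_cons, ih]
    by_cases h1 : p ∈ l
    · simp [h1]
    · by_cases h2 : p = c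
      · simp [h2]
      · simp [h1, h2]

theorem facPr_perm (n : ℕ) {r s : ℕ} (t : Fac r s) : ∃ σ : Equiv.Perm (Fin r × Fin s),
    ∀ i j, facPr n t i j = cyc n (t (σ (i, j)).1 (σ (i, j)).2) := by
  obtain ⟨σ, h1, h2⟩ := foldl_jdtIn_perm r s (boxesWith r s (toGrid t) n)
    (g := (boxesWith r s (toGrid t) n).foldl (fun g c => Function.update g c none) (toGrid t))
    (nodup_boxesWith ..) (fun c hc => (mem_boxesWith.1 hc).1)
    (fun c hc => by rw [foldl_update_none, if_pos hc])
  let τ : Fin r × Fin s → Fin r × Fin s := fun c =>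
    (⟨_, (h1 (c.1, c.2) ⟨c.1.2, c.2.2⟩).1⟩, ⟨_, (h1 (c.1, c.2) ⟨c.1.2, c.2.2⟩).2⟩)
  have hτ : Function.Injective τ := by
    intro c d h
    have h3 : σ (c.1, c.2) = σ (d.1, d.2) := by
      simp only [τ, Prod.mk.injEq, Fin.mk.injEq] at h
      exact Prod.ext h.1 h.2
    have := σ.injective h3
    simp only [Prod.mk.injEq, Fin.val_inj] at this
    exact Prod.ext this.1 this.2
  refine ⟨Equiv.ofBijective τ (Finite.injective_iff_bijective.1 hτ), fun i j => ?_⟩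
  simp only [facPr, h2, Function.comp_apply, foldl_update_none, Equiv.ofBijective_apply]
  have h3 : σ (i, j) = (((τ (i, j)).1 : ℕ), ((τ (i, j)).2 : ℕ)) := rfl
  -- A box that held `n` has been emptied, so the default value `0` is read there, and `0 + 1`
  -- agrees with `cyc n n`.
  rw [h3]
  by_cases hn : t (τ (i, j)).1 (τ (i, j)).2 = n
  · rw [if_pos (mem_boxesWith.2 ⟨⟨(τ (i, j)).1.2, (τ (i, j)).2.2⟩,
      (toGrid_coe t _ _).trans (congrArg some hn)⟩)]
    simp [cyc, hn]
  · rw [if_neg (fun h => hn (by simpa using (mem_boxesWith.1 h).2))]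
    simp [cyc, hn]

theorem facPr_of_forall_ne {n r s : ℕ} {t : Fac r s} (h : ∀ i j, t i j ≠ n) :
    facPr n t = fun i j => t i j + 1 := by
  have : boxesWith r s (toGrid t) n = [] := boxesWith_eq .nil fun c => by
    simp only [List.not_mem_nil, false_iff, toGrid_eq_some]
    rintro ⟨-, h1, h2⟩
    exact h _ _ h2
  ext i j
  simp [facPr, this]

theorem facPr_eq_of_path {n r s k : ℕ} {t : Fac r s} {c : ℕ × ℕ} {q : Grid × (ℕ × ℕ)}
    (h : ∀ d, toGrid t d = some n ↔ d = c)
    (hp : Path nextIn k (Function.update (toGrid t) c none, c) q)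
    (hq : nextIn q.1 q.2 = none) (i : Fin r) (j : Fin s) :
    facPr n t i j = (q.1 (i, j)).getD 0 + 1 := by
  have hc : c.1 < r ∧ c.2 < s := (toGrid_eq_some.1 ((h c).2 rfl)).1
  have hb : boxesWith r s (toGrid t) n = [c] := boxesWith_eq (by simp) fun d => by
    rw [List.mem_singleton, h]
    constructor
    · rintro rfl; exact ⟨hc, rfl⟩
    · exact fun h => h.2
  have hk : k ≤ r + s := by have := path_sum hp; simp at this; omega
  simp only [facPr, hb, List.foldl_cons, List.foldl_nil, jdtIn, Function.update_idem]
  rw [slide_eq_of_path hp hq hk]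

/-- For tableaux with two letters `n`, which occur as intermediate results of the affine crystal
operators. The box read first is slid first, while the other one is already empty. -/
theorem facPr_eq_of_path₂ {n r s k k' : ℕ} {t : Fac r s} {c d : ℕ × ℕ} {q q' : Grid × (ℕ × ℕ)}
    (h : ∀ e, toGrid t e = some n ↔ e = c ∨ e = d) (hcd : ReadBefore c d)
    (hp : Path nextIn k (Function.update (Function.update (toGrid t) c none) d none, c) q)
    (hq : nextIn q.1 q.2 = none)
    (hp' : Path nextIn k' (Function.update q.1 d none, d) q')
    (hq' : nextIn q'.1 q'.2 = none) (i : Fin r) (j : Fin s) :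
    facPr n t i j = (q'.1 (i, j)).getD 0 + 1 := by
  have hc : c.1 < r ∧ c.2 < s := (toGrid_eq_some.1 ((h c).2 (.inl rfl))).1
  have hd : d.1 < r ∧ d.2 < s := (toGrid_eq_some.1 ((h d).2 (.inr rfl))).1
  have hb : boxesWith r s (toGrid t) n = [c, d] := boxesWith_eq (by simpa using hcd) fun e => by
    rw [h]
    simp only [List.mem_cons, List.not_mem_nil, or_false]
    constructor
    · rintro (rfl | rfl)
      · exact ⟨hc, .inl rfl⟩
      · exact ⟨hd, .inr rfl⟩
    · exact fun h => h.2
  have hk : k ≤ r + s := by have := path_sum hp; simp at this; omega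
  have hk' : k' ≤ r + s := by have := path_sum hp'; simp at this; omega
  have hup : Function.update (Function.update (Function.update (toGrid t) c none) d none) c none =
      Function.update (Function.update (toGrid t) c none) d none := by
    funext x
    simp only [Function.update_apply]
    split_ifs <;> rfl
  simp only [facPr, hb, List.foldl_cons, List.foldl_nil, jdtIn, hup]
  rw [slide_eq_of_path hp hq hk, slide_eq_of_path hp' hq' hk']

/-! ### Promotion of standard tableaux -/

/-- A semistandard tableau with pairwise distinct entries. -/
structure FacStd (n : ℕ) {r s : ℕ} (t : Fac r s) : Prop where
  ssyt : IsSSYT n t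
  inj : ∀ i j i' j', t i j = t i' j' → i = i' ∧ j = j'

theorem FacStd.lt {n r s : ℕ} {t : Fac r s} (h : FacStd n t) {i i' : Fin r} {j j' : Fin s}
    (hi : i ≤ i') (hj : j ≤ j') (hne : ¬ (i = i' ∧ j = j')) : t i j < t i' j' := by
  have h1 : t i j ≤ t i' j := by
    rcases hi.lt_or_eq with h1 | rfl
    · exact (h.ssyt.col_strict _ _ _ h1).le
    · exact le_rfl
  have h2 : t i' j ≤ t i' j' := by
    rcases hj.lt_or_eq with h1 | rfl
    · exact h.ssyt.row_weak _ _ _ h1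
    · exact le_rfl
  exact lt_of_le_of_ne (h1.trans h2) fun h3 => hne (h.inj _ _ _ _ h3)

theorem FacStd.punctured {n r s : ℕ} {t : Fac r s} (h : FacStd n t) {c : ℕ × ℕ}
    (hc : c.1 < r ∧ c.2 < s) : Punctured r s (Function.update (toGrid t) c none) c where
  hole := by simp
  out p hp := by
    by_contra hcon
    apply hp
    by_cases hpc : p = c
    · simp [hpc]
    · rw [Function.update_of_ne hpc]
      simp [toGrid, hcon]
  mem := hc
  up p q _ h1 h2 h3 _ := by
    rw [Function.update_of_ne h3]
    simp [toGrid, h1, h2]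
  inc p q x y hx hy hpq hne := by
    have hpc : p ≠ c := by rintro rfl; simp at hx
    have hqc : q ≠ c := by rintro rfl; simp at hy
    rw [Function.update_of_ne hpc] at hx
    rw [Function.update_of_ne hqc] at hy
    obtain ⟨h1, rfl⟩ := toGrid_eq_some.1 hx
    obtain ⟨h2, rfl⟩ := toGrid_eq_some.1 hy
    refine h.lt hpq.1 hpq.2 ?_
    rintro ⟨h3, h4⟩
    simp only [Fin.mk.injEq] at h3 h4
    exact hne (Prod.ext h3 h4)
  inj p q x hx hy := by
    have hpc : p ≠ c := by rintro rfl; simp at hx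
    have hqc : q ≠ c := by rintro rfl; simp at hy
    rw [Function.update_of_ne hpc] at hx
    rw [Function.update_of_ne hqc] at hy
    obtain ⟨h1, rfl⟩ := toGrid_eq_some.1 hx
    obtain ⟨h2, h3⟩ := toGrid_eq_some.1 hy
    have := h.inj _ _ _ _ h3
    simp only [Fin.mk.injEq] at this
    exact (Prod.ext this.1 this.2).symm

theorem FacStd.eq_corner {n r s : ℕ} {t : Fac r s} (h : FacStd n t) {c : ℕ × ℕ}
    (hc : toGrid t c = some n) : c = (r - 1, s - 1) := by
  obtain ⟨h1, h2⟩ := toGrid_eq_some.1 hc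
  by_contra hne
  have hr : r - 1 < r := by omega
  have hs : s - 1 < s := by omega
  have := h.lt (i := ⟨c.1, h1.1⟩) (i' := ⟨r - 1, hr⟩) (j := ⟨c.2, h1.2⟩) (j' := ⟨s - 1, hs⟩)
    (by simp only [Fin.mk_le_mk]; omega) (by simp only [Fin.mk_le_mk]; omega) (by
      simp only [Fin.mk.injEq]
      rintro ⟨h3, h4⟩
      exact hne (Prod.ext h3 h4))
  have := h.ssyt.le ⟨r - 1, hr⟩ ⟨s - 1, hs⟩
  omega

theorem Punctured.eq_zero_of_nextIn {r s : ℕ} {g : Grid} {c : ℕ × ℕ} (h : Punctured r s g c)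
    (h0 : c = (0, 0) ∨ g (0, 0) ≠ none) (hc : nextIn g c = none) : c = (0, 0) := by
  rcases h0 with h0 | h0
  · exact h0
  obtain ⟨a, b⟩ := c
  have hm := h.mem
  simp only at hm
  rw [nextIn_eq_none] at hc
  rcases a with _ | a
  · rcases b with _ | b
    · rfl
    · exact absurd (hc.2 b rfl) (h.up (0, 0) _ (by simp) hm.1 (by simp; omega) (by simp) h0)
  · exact absurd (hc.1 a rfl) (h.up (0, 0) _ (by simp) (by simp; omega) hm.2 (by simp) h0)

theorem path_eq_none_iff {k : ℕ} {p q : Grid × (ℕ × ℕ)} (h : Path nextIn k p q)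
    (hp : p.1 p.2 = none) (x : ℕ × ℕ) :
    q.1 x = none ↔ x = q.2 ∨ p.1 x = none ∧ x ≠ p.2 := by
  induction h with
  | refl p =>
    by_cases hx : x = p.2
    · simp [hx, hp]
    · simp [hx]
  | @head k p q d h1 _ ih =>
    rw [ih (by simp [moveHole_apply]), moveHole_apply]
    have h2 := nextIn_ne h1
    have h3 := nextIn_filled h1
    by_cases hx : x = d
    · subst hx; simp [h3]
    · by_cases hx' : x = p.2
      · subst hx'; simp [hx, h3]
      · simp [hx, hx']

/-- The first slide of the promotion of a standard tableau containing `n`. -/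
theorem FacStd.exists_path {n r s : ℕ} {t : Fac r s} (h : FacStd n t)
    (hn : ∃ c, toGrid t c = some n) :
    ∃ k g, Path nextIn k (Function.update (toGrid t) (r - 1, s - 1) none, (r - 1, s - 1))
        (g, (0, 0)) ∧ Punctured r s g (0, 0) ∧
      (∀ c, g c ≠ none ↔ (c.1 < r ∧ c.2 < s) ∧ c ≠ (0, 0)) ∧
      (∀ d, toGrid t d = some n ↔ d = (r - 1, s - 1)) ∧
      ∀ i j, facPr n t i j = (g (i, j)).getD 0 + 1 := by
  obtain ⟨c, hc⟩ := hn
  obtain rfl := h.eq_corner hc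
  have hm := (toGrid_eq_some.1 hc).1
  simp only at hm
  have hP := h.punctured (c := (r - 1, s - 1)) hm
  obtain ⟨k, q, h1, h2, h3⟩ := exists_path_nextIn
    (Function.update (toGrid t) (r - 1, s - 1) none, (r - 1, s - 1))
  have hQ := hP.path h1
  have hd : ∀ d, toGrid t d = some n ↔ d = (r - 1, s - 1) :=
    fun d => ⟨h.eq_corner, by rintro rfl; exact hc⟩
  have hnone := path_eq_none_iff h1 hP.hole
  have hfull : ∀ c, q.1 c ≠ none ↔ (c.1 < r ∧ c.2 < s) ∧ c ≠ q.2 := by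
    intro c
    rw [Ne, hnone, not_or]
    constructor
    · rintro ⟨h4, h5⟩
      refine ⟨?_, h4⟩
      by_contra h6
      have : c ≠ (r - 1, s - 1) := by rintro rfl; exact h6 hm
      refine h5 ⟨?_, this⟩
      simp only
      rw [Function.update_of_ne this]
      simp [toGrid, h6]
    · rintro ⟨h4, h5⟩
      refine ⟨h5, ?_⟩
      rintro ⟨h6, h7⟩
      simp only at h6 h7
      rw [Function.update_of_ne h7] at h6
      simp [toGrid, h4] at h6
  have hq : q.2 = (0, 0) := by
    refine hQ.eq_zero_of_nextIn ?_ h2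
    by_cases h4 : q.2 = (0, 0)
    · exact .inl h4
    · exact .inr ((hfull (0, 0)).2 ⟨⟨by simp; omega, by simp; omega⟩, Ne.symm h4⟩)
  obtain ⟨g, c⟩ := q
  simp only at hq
  subst hq
  exact ⟨k, g, h1, hQ, hfull, hd, facPr_eq_of_path hd h1 h2⟩

theorem toGrid_facPr {n r s : ℕ} {t : Fac r s} {g : Grid} (hr : 0 < r) (hs : 0 < s)
    (hg : ∀ c, g c ≠ none ↔ (c.1 < r ∧ c.2 < s) ∧ c ≠ (0, 0))
    (h : ∀ i j, facPr n t i j = (g (i, j)).getD 0 + 1) :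
    toGrid (facPr n t) = fun c => (Function.update g (0, 0) (some 0) c).map (· + 1) := by
  funext c
  by_cases hc : c.1 < r ∧ c.2 < s
  · by_cases h0 : c = (0, 0)
    · subst h0
      have h1 : g (0, 0) = none := by
        by_contra hcon
        exact ((hg _).1 hcon).2 rfl
      have := h ⟨0, hr⟩ ⟨0, hs⟩
      simp [toGrid, hr, hs, this, h1]
    · obtain ⟨x, hx⟩ := Option.ne_none_iff_exists'.1 ((hg c).2 ⟨hc, h0⟩)
      have h2 : g (c.1, c.2) = some x := hx
      have := h ⟨c.1, hc.1⟩ ⟨c.2, hc.2⟩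
      simp [toGrid, hc, this, Function.update_of_ne h0, hx]
  · have h0 : c ≠ (0, 0) := by rintro rfl; exact hc ⟨hr, hs⟩
    have h1 : g c = none := by
      by_contra hcon
      exact hc ((hg _).1 hcon).1
    simp [toGrid, hc, Function.update_of_ne h0, h1]

/-! ### Two promotions of a standard tableau -/

/-- The first slide begins with a horizontal move, so it leaves the row of its first hole at or
before column `b`. The second slide starts strictly to the right of it in the same row and stays
there. -/
theorem Punctured.second_slide_right {r s a b k k' : ℕ} {g g₁ : Grid} {q : Grid × (ℕ × ℕ)}
    (h : Punctured r s g (a, b + 1)) (hs : s = b + 2)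
    (hd : nextIn g (a, b + 1) = some (a, b)) (hp : Path nextIn k (g, (a, b + 1)) (g₁, (0, 0)))
    (hq : Punctured r s (Function.update g₁ (a, b + 1) none) (a, b + 1))
    (hp' : Path nextIn k' (Function.update g₁ (a, b + 1) none, (a, b + 1)) q) : 0 < q.2.2 := by
  have hg₁ := (h.path hp).hole
  cases hp with
  | @head k _ _ d h1 h2 =>
  simp only at h1
  rw [hd] at h1
  simp only [Option.some.injEq] at h1
  subst h1
  obtain ⟨m, hm0, hm1, hm2, hm3⟩ := (h.step hd).exists_leaving_columns h2 rfl
  simp only [moveHole_snd] at hm1 hm2 hm3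
  refine lt_of_le_of_lt (Nat.zero_le (m q.2.1)) (hq.path_stays_right hp' ?_ hm0 hm2 ?_ ?_)
  · simp only at hg₁
    simp [hg₁]
  · intro a' ha' hms
    obtain ⟨x, y, hx, hy, hxy⟩ := hm3 a' ha' hms
    refine ⟨x, y, ?_, ?_, hxy⟩
    · simp only
      rw [Function.update_of_ne, hx]
      simp only [ne_eq, Prod.mk.injEq, not_and]
      omega
    · simp only at ha' ⊢
      rw [Function.update_of_ne, hy]
      simp only [ne_eq, Prod.mk.injEq, not_and]
      omega
  · simp only
    omega

theorem Path.exists_tail {next : Grid → ℕ × ℕ → Option (ℕ × ℕ)} {k : ℕ} {p q : Grid × (ℕ × ℕ)}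
    {d : ℕ × ℕ} (h : Path next k p q) (hpq : p.2 ≠ q.2) (hd : next p.1 p.2 = some d) :
    ∃ k', Path next k' (moveHole p d) q := by
  cases h with
  | refl => exact absurd rfl hpq
  | head h1 h2 =>
    rw [hd] at h1
    simp only [Option.some.injEq] at h1
    subst h1
    exact ⟨_, h2⟩

theorem transpose_update (g : Grid) (c : ℕ × ℕ) (v : Option ℕ) :
    transpose (Function.update g c v) = Function.update (transpose g) c.swap v := by
  funext x
  simp only [transpose, Function.update_apply]
  have : x = c.swap ↔ x.swap = c := by rw [← Prod.swap_inj, Prod.swap_swap]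
  simp only [this]

/-- The transpose of `Punctured.second_slide_right`. -/
theorem Punctured.second_slide_below {r s a b k k' : ℕ} {g g₁ : Grid} {q : Grid × (ℕ × ℕ)}
    (h : Punctured r s g (a + 1, b)) (hr : r = a + 2)
    (hd : nextIn g (a + 1, b) = some (a, b)) (hp : Path nextIn k (g, (a + 1, b)) (g₁, (0, 0)))
    (hq : Punctured r s (Function.update g₁ (a + 1, b) none) (a + 1, b))
    (hp' : Path nextIn k' (Function.update g₁ (a + 1, b) none, (a + 1, b)) q) : 0 < q.2.1 := by
  have h1 := h.path_transpose hp
  have h2 := hq.path_transpose hp'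
  have h3 := hq.transpose
  simp only [transpose_update, Prod.swap_prod_mk] at h1 h2 h3
  exact Punctured.second_slide_right h.transpose hr (nextIn_transpose h hd) h1 h3 h2

/-- The two slides in the double promotion of a standard tableau containing `n - 1` and `n`. -/
structure TwoSlides (n r s : ℕ) (t : Fac r s) (g₁ g₂ : Grid) (d : ℕ × ℕ) (k k' : ℕ) : Prop where
  corner : ∀ c, toGrid t c = some n ↔ c = (r - 1, s - 1)
  start : Punctured r s (Function.update (toGrid t) (r - 1, s - 1) none) (r - 1, s - 1)
  path₁ : Path nextIn k (Function.update (toGrid t) (r - 1, s - 1) none, (r - 1, s - 1))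
    (g₁, (0, 0))
  punctured₁ : Punctured r s g₁ (0, 0)
  corner₁ : ∀ c, g₁ c = some (n - 1) ↔ c = (r - 1, s - 1)
  start₂ : Punctured r s (Function.update g₁ (r - 1, s - 1) none) (r - 1, s - 1)
  path₂ : Path nextIn k' (Function.update g₁ (r - 1, s - 1) none, (r - 1, s - 1)) (g₂, d)
  punctured₂ : Punctured r s g₂ d
  terminal₂ : nextIn g₂ d = none
  full₂ : ∀ c, g₂ c ≠ none ↔ (c.1 < r ∧ c.2 < s) ∧ c ≠ (0, 0) ∧ c ≠ d
  pred : ∃ e, toGrid t e = some (n - 1) ∧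
    (e.1 = r - 1 ∧ e.2 + 1 = s - 1 ∨ e.1 + 1 = r - 1 ∧ e.2 = s - 1) ∧
    nextIn (Function.update (toGrid t) (r - 1, s - 1) none) (r - 1, s - 1) = some e
  right : (∃ c, toGrid t c = some (n - 1) ∧ c.1 = r - 1) → d = (0, 1)
  below : (∃ c, toGrid t c = some (n - 1) ∧ c.1 ≠ r - 1) → d = (1, 0)
  facPr_facPr : ∀ (i : Fin r) (j : Fin s), facPr n (facPr n t) i j =
    if ((i : ℕ), (j : ℕ)) = (0, 0) then 1 else if ((i : ℕ), (j : ℕ)) = d then 2 else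
      (g₂ (i, j)).getD 0 + 2

/-- The letter `n - 1` sits next to the corner occupied by `n`, and the first slide begins by moving
it into that corner. Hence both promotions slide from the same corner. The second slide is studied
with the origin left empty: it then stops in a neighbour `d` of the origin, and non-crossing decides
which one. -/
theorem FacStd.exists_twoSlides {n r s : ℕ} {t : Fac r s} (h : FacStd n t)
    (hn : ∃ c, toGrid t c = some n) (hn' : ∃ c, toGrid t c = some (n - 1)) (h2 : 2 ≤ n) :
    ∃ g₁ g₂ d k k', TwoSlides n r s t g₁ g₂ d k k' := by
  obtain ⟨e, he⟩ := hn'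
  obtain ⟨k, g₁, hp, hP, hfull, hcorner, hpr⟩ := h.exists_path hn
  have hm := (toGrid_eq_some.1 ((hcorner _).2 rfl)).1
  have hstart := h.punctured hm
  have hne : e ≠ (r - 1, s - 1) := by
    rintro rfl
    rw [(hcorner _).2 rfl] at he
    simp at he; omega
  obtain ⟨he1, he2⟩ := toGrid_eq_some.1 he
  -- the position of `n - 1`
  have hadj : ∀ c : ℕ × ℕ, c.1 < r → c.2 < s → e ≤ c → c = e ∨ c = (r - 1, s - 1) := by
    intro c hc1 hc2 hec
    by_contra hcon
    rw [not_or] at hcon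
    have h3 := h.lt (i := ⟨e.1, he1.1⟩) (j := ⟨e.2, he1.2⟩) (i' := ⟨c.1, hc1⟩) (j' := ⟨c.2, hc2⟩)
      hec.1 hec.2 (by
        simp only [Fin.mk.injEq]
        rintro ⟨h4, h5⟩
        exact hcon.1 (Prod.ext h4 h5).symm)
    have h4 := h.ssyt.le ⟨c.1, hc1⟩ ⟨c.2, hc2⟩
    have h5 : t ⟨c.1, hc1⟩ ⟨c.2, hc2⟩ = n := by omega
    exact hcon.2 ((hcorner c).1 (toGrid_eq_some.2 ⟨⟨hc1, hc2⟩, h5⟩))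
  have hmax : ∀ c x, toGrid t c = some x → c ≠ e → c ≠ (r - 1, s - 1) → x < n - 1 := by
    intro c x hx hce hcc
    obtain ⟨h3, rfl⟩ := toGrid_eq_some.1 hx
    have h4 := h.ssyt.le ⟨c.1, h3.1⟩ ⟨c.2, h3.2⟩
    have h5 : t ⟨c.1, h3.1⟩ ⟨c.2, h3.2⟩ ≠ n := fun h6 => hcc ((hcorner c).1 (h6 ▸ hx))
    have h6 : t ⟨c.1, h3.1⟩ ⟨c.2, h3.2⟩ ≠ n - 1 := by
      intro h6
      rw [← he2] at h6
      have := h.inj _ _ _ _ h6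
      simp only [Fin.mk.injEq] at this
      exact hce (Prod.ext this.1 this.2)
    omega
  have hpos : e.1 = r - 1 ∧ e.2 + 1 = s - 1 ∨ e.1 + 1 = r - 1 ∧ e.2 = s - 1 := by
    by_cases h3 : e.1 = r - 1
    · refine .inl ⟨h3, ?_⟩
      have h4 : e.2 ≠ s - 1 := fun h4 => hne (Prod.ext h3 h4)
      have := hadj (e.1, e.2 + 1) he1.1 (by simp only; omega) ⟨le_rfl, by simp⟩
      simp only [Prod.ext_iff] at this
      omega
    · have := hadj (e.1 + 1, e.2) (by simp only; omega) he1.2 ⟨by simp, le_rfl⟩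
      simp only [Prod.ext_iff] at this
      omega
  have hge : Function.update (toGrid t) (r - 1, s - 1) none e = some (n - 1) := by
    rw [Function.update_of_ne hne, he]
  have hnext : nextIn (Function.update (toGrid t) (r - 1, s - 1) none) (r - 1, s - 1) =
      some e := by
    rcases hpos with ⟨h3, h4⟩ | ⟨h3, h4⟩
    · refine nextIn_eq_some.2 (.inr ⟨r - 1, e.2, n - 1, by rw [h4], Prod.ext h3 rfl, ?_, ?_⟩)
      · rw [← hge, ← h3]
      · intro a' u ha hu
        rw [Function.update_of_ne (by simp only [ne_eq, Prod.mk.injEq]; omega)] at hu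
        refine hmax _ _ hu ?_ ?_
        · intro h5; have := congrArg Prod.fst h5; simp only at this; omega
        · simp only [ne_eq, Prod.mk.injEq]; omega
    · refine nextIn_eq_some.2 (.inl ⟨e.1, s - 1, n - 1, by rw [h3], Prod.ext rfl h4, ?_, ?_⟩)
      · rw [← hge, ← h4]
      · intro b' l hb hl
        rw [Function.update_of_ne (by simp only [ne_eq, Prod.mk.injEq]; omega)] at hl
        refine (hmax _ _ hl ?_ ?_).le
        · intro h5; have := congrArg Prod.fst h5; simp only at this; omega
        · simp only [ne_eq, Prod.mk.injEq]; omega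
  -- After the first step the slide stays weakly above and to the left of `e`, so `n - 1` remains in
  -- the corner.
  have hg₁c : g₁ (r - 1, s - 1) = some (n - 1) := by
    have hc0 : ((r - 1, s - 1) : ℕ × ℕ) ≠ (0, 0) := by
      simp only [ne_eq, Prod.mk.injEq]
      omega
    obtain ⟨k', h2⟩ := hp.exists_tail hc0 hnext
    have h3 := path_apply_of_not_le h2 (x := (r - 1, s - 1)) ?_
    · simp only at h3
      rw [h3]
      rw [moveHole_apply, if_neg (Ne.symm hne), if_pos rfl]
      exact hge
    · simp only [moveHole_snd, Prod.le_def]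
      omega
  have hcorner₁ : ∀ c, g₁ c = some (n - 1) ↔ c = (r - 1, s - 1) :=
    fun c => ⟨fun hc => hP.inj _ _ _ hc hg₁c, by rintro rfl; exact hg₁c⟩
  have hc0 : ((r - 1, s - 1) : ℕ × ℕ) ≠ (0, 0) := ((hfull _).1 (by simp [hg₁c])).2
  have hstart₂ : Punctured r s (Function.update g₁ (r - 1, s - 1) none) (r - 1, s - 1) := by
    have hup : ∀ x y, Function.update g₁ (r - 1, s - 1) none x = some y → g₁ x = some y := by
      intro x y hx
      rw [Function.update_apply] at hx
      split_ifs at hx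
      exact hx
    refine ⟨by simp, fun p hp => ?_, hm, fun p q hpq h3 h4 h5 h6 => ?_, ?_, ?_⟩
    · obtain ⟨x, hx⟩ := Option.ne_none_iff_exists'.1 hp
      exact hP.out p (by simp [hup _ _ hx])
    · rw [Function.update_of_ne h5]
      obtain ⟨x, hx⟩ := Option.ne_none_iff_exists'.1 h6
      have hx' : g₁ p ≠ none := by simp [hup _ _ hx]
      refine hP.up p q hpq h3 h4 ?_ hx'
      rintro rfl
      have : p = (0, 0) := Prod.ext (by have := hpq.1; simp at this ⊢; omega)
        (by have := hpq.2; simp at this ⊢; omega)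
      exact hx' (this ▸ hP.hole)
    · exact fun p q x y hx hy => hP.inc p q x y (hup _ _ hx) (hup _ _ hy)
    · exact fun p q x hx hy => hP.inj p q x (hup _ _ hx) (hup _ _ hy)
  obtain ⟨k', ⟨g₂, d⟩, hp₂, hterm, -⟩ := exists_path_nextIn
    (Function.update g₁ (r - 1, s - 1) none, (r - 1, s - 1))
  simp only at hterm
  have hP₂ : Punctured r s g₂ d := hstart₂.path hp₂
  have hsum := path_sum hp₂
  simp only at hsum
  have hnone := path_eq_none_iff hp₂ hstart₂.hole
  simp only at hnone
  have hfull₂ : ∀ c, g₂ c ≠ none ↔ (c.1 < r ∧ c.2 < s) ∧ c ≠ (0, 0) ∧ c ≠ d := by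
    intro c
    rw [Ne, hnone, not_or]
    constructor
    · rintro ⟨h3, h4⟩
      have h5 : c ≠ (0, 0) ∧ c.1 < r ∧ c.2 < s := by
        by_cases h6 : c = (r - 1, s - 1)
        · subst h6; exact ⟨hc0, hm⟩
        · have h7 : g₁ c ≠ none := fun h7 => h4 ⟨by rw [Function.update_of_ne h6, h7], h6⟩
          exact ⟨((hfull c).1 h7).2, ((hfull c).1 h7).1⟩
      exact ⟨h5.2, h5.1, h3⟩
    · rintro ⟨h3, h4, h5⟩
      refine ⟨h5, fun h6 => ?_⟩
      have := h6.1
      rw [Function.update_of_ne h6.2] at this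
      exact (hfull c).2 ⟨h3, h4⟩ this
  have hd0 : d ≠ (0, 0) := by
    rintro rfl
    rcases (hnone (0, 0)).2 (.inl rfl) with h3
    have h4 := hp₂
    -- the hole cannot enter an empty box
    have : ∀ {k p q}, Path nextIn k p q → p.1 (0, 0) = none → p.2 ≠ (0, 0) → q.2 ≠ (0, 0) := by
      intro k p q h
      induction h with
      | refl p => exact fun _ h => h
      | @head k p q d h5 _ ih =>
        intro h6 h7
        have h8 : d ≠ (0, 0) := by rintro rfl; exact nextIn_filled h5 h6
        refine ih ?_ h8
        rw [moveHole_apply, if_neg (Ne.symm h8), if_neg (Ne.symm h7), h6]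
    refine this h4 ?_ hc0 rfl
    simp only
    rw [Function.update_of_ne (Ne.symm hc0)]
    exact hP.hole
  have hd : d = (0, 1) ∨ d = (1, 0) := by
    obtain ⟨a, b⟩ := d
    have hmem := hP₂.mem
    simp only at hmem
    rw [nextIn_eq_none] at hterm
    by_contra hcon
    rw [not_or] at hcon
    simp only [Prod.mk.injEq, ne_eq] at hcon hd0
    rcases a with _ | a
    · obtain ⟨b, rfl⟩ : ∃ b', b = b' + 1 := ⟨b - 1, by omega⟩
      have h3 := hterm.2 b rfl
      by_contra
      refine (hfull₂ (0, b)).2 ⟨⟨by simp; omega, by simp; omega⟩, ?_, ?_⟩ h3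
      · simp; omega
      · simp
    · have h3 := hterm.1 a rfl
      refine (hfull₂ (a, b)).2 ⟨⟨by simp; omega, by simp; omega⟩, ?_, ?_⟩ h3
      · simp; omega
      · simp
  refine ⟨g₁, g₂, d, k, k', hcorner, hstart, hp, hP, hcorner₁, hstart₂, hp₂, hP₂, hterm,
    hfull₂, ⟨e, he, hpos, hnext⟩, ?_, ?_, ?_⟩
  · rintro ⟨c, hc, hcr⟩
    obtain rfl : c = e := hstart.inj _ _ (n - 1) (by
      rw [Function.update_of_ne, hc]
      rintro rfl
      rw [(hcorner _).2 rfl] at hc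
      simp at hc; omega) hge
    rcases hpos with ⟨h3, h4⟩ | ⟨h3, h4⟩
    · have h6 : c = (r - 1, c.2) := Prod.ext h3 rfl
      rw [h6] at hnext
      rw [← h4] at hnext hstart hp hstart₂ hp₂
      have := hstart.second_slide_right (b := c.2) (by omega) hnext hp hstart₂ hp₂
      rcases hd with rfl | rfl
      · rfl
      · simp at this
    · omega
  · rintro ⟨c, hc, hcr⟩
    obtain rfl : c = e := hstart.inj _ _ (n - 1) (by
      rw [Function.update_of_ne, hc]
      rintro rfl
      rw [(hcorner _).2 rfl] at hc
      simp at hc; omega) hge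
    rcases hpos with ⟨h3, h4⟩ | ⟨h3, h4⟩
    · omega
    · have h6 : c = (c.1, s - 1) := Prod.ext rfl h4
      rw [h6] at hnext
      rw [← h3] at hnext hstart hp hstart₂ hp₂
      have := hstart.second_slide_below (a := c.1) (by omega) hnext hp hstart₂ hp₂
      rcases hd with rfl | rfl
      · simp at this
      · rfl
  · have hr : 0 < r := by omega
    have hs : 0 < s := by omega
    have htg := toGrid_facPr hr hs hfull hpr
    -- In the actual second promotion the origin holds the new letter. Viewed before the shift by
    -- one, this is a `0`, which makes one more step and ends up in `d`; two shifts turn it into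
    -- `2`.
    have h3 := path_update_corner hp₂ (by
      simp only; rw [Function.update_of_ne (Ne.symm hc0)]; exact hP.hole) hd 0
    have h4 := path_map (φ := (· + 1)) h3 (by intros; simp)
    simp only at h4
    have hstart' : Function.update (toGrid (facPr n t)) (r - 1, s - 1) none =
        fun c => (Function.update (Function.update g₁ (r - 1, s - 1) none) (0, 0) (some 0) c).map
          (· + 1) := by
      rw [htg]
      funext c
      simp only [Function.update_apply]
      by_cases hc : c = (r - 1, s - 1)
      · rw [if_pos hc, if_pos hc, if_neg (by rw [hc]; exact hc0)]
        rfl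
      · rw [if_neg hc, if_neg hc]
    rw [← hstart'] at h4
    intro i j
    rw [facPr_eq_of_path (c := (r - 1, s - 1)) ?_ h4 ?_ i j]
    · simp only
      by_cases h5 : ((i : ℕ), (j : ℕ)) = (0, 0)
      · simp [h5]
      · by_cases h6 : ((i : ℕ), (j : ℕ)) = d
        · simp [h6, hd0]
        · obtain ⟨x, hx⟩ := Option.ne_none_iff_exists'.1
            ((hfull₂ (i, j)).2 ⟨⟨i.2, j.2⟩, h5, h6⟩)
          rw [Function.update_of_ne h5, Function.update_of_ne h6, if_neg h5, if_neg h6, hx]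
          simp
    · intro c
      rw [htg]
      simp only [Option.map_eq_some_iff]
      constructor
      · rintro ⟨x, hx, hxn⟩
        by_cases hc : c = (0, 0)
        · subst hc; simp at hx; omega
        · rw [Function.update_of_ne hc] at hx
          rw [show x = n - 1 by omega] at hx
          exact (hcorner₁ c).1 hx
      · rintro rfl
        refine ⟨n - 1, ?_, by omega⟩
        rw [Function.update_of_ne hc0, hg₁c]
    · exact nextIn_eq_none.2 ⟨by simp, by simp⟩

/-! ### Promotion of a factor -/

theorem facPr_eq_one_iff {n r s : ℕ} {t : Fac r s} (h : FacStd n t) :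
    (∃ c, toGrid (facPr n t) c = some 1) ↔ ∃ c, toGrid t c = some n := by
  obtain ⟨σ, hσ⟩ := facPr_perm n t
  constructor
  · rintro ⟨c, hc⟩
    obtain ⟨h1, h2⟩ := toGrid_eq_some.1 hc
    rw [hσ, cyc] at h2
    split_ifs at h2 with h3
    · exact ⟨_, (toGrid_coe t _ _).trans (congrArg some h3)⟩
    · have := h.ssyt.pos (σ (⟨c.1, h1.1⟩, ⟨c.2, h1.2⟩)).1 (σ (⟨c.1, h1.1⟩, ⟨c.2, h1.2⟩)).2
      omega
  · rintro ⟨c, hc⟩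
    obtain ⟨h1, h2⟩ := toGrid_eq_some.1 hc
    refine ⟨(((σ.symm (⟨c.1, h1.1⟩, ⟨c.2, h1.2⟩)).1 : ℕ), ((σ.symm (⟨c.1, h1.1⟩, ⟨c.2, h1.2⟩)).2 : ℕ)),
      ?_⟩
    rw [toGrid_coe, hσ]
    simp [cyc, h2]

/-- The slide keeps the grid standard away from the origin, and the new letter `1` at the origin is
smaller than everything else. -/
theorem FacStd.facPr {n r s : ℕ} {t : Fac r s} (h : FacStd n t) : FacStd n (facPr n t) := by
  obtain ⟨σ, hσ⟩ := facPr_perm n t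
  have hpos := h.ssyt.pos
  have hle := h.ssyt.le
  have hinj : ∀ i j i' j', KR.facPr n t i j = KR.facPr n t i' j' → i = i' ∧ j = j' := by
    intro i j i' j' he
    rw [hσ, hσ, cyc, cyc] at he
    have h1 := hpos (σ (i, j)).1 (σ (i, j)).2
    have h2 := hpos (σ (i', j')).1 (σ (i', j')).2
    have h3 : t (σ (i, j)).1 (σ (i, j)).2 = t (σ (i', j')).1 (σ (i', j')).2 := by
      split_ifs at he <;> omega
    have h4 := h.inj _ _ _ _ h3
    have h5 := σ.injective (Prod.ext h4.1 h4.2)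
    simpa using h5
  refine ⟨⟨fun i j => ?_, fun i j => ?_, ?_, ?_⟩, hinj⟩
  · rw [hσ, cyc]; split_ifs <;> omega
  · rw [hσ, cyc]
    have h1 := hpos (σ (i, j)).1 (σ (i, j)).2
    have h2 := hle (σ (i, j)).1 (σ (i, j)).2
    split_ifs <;> omega
  all_goals
    by_cases hn : ∃ c, toGrid t c = some n
    · obtain ⟨k, g, -, hP, hfull, -, hpr⟩ := h.exists_path hn
      have key : ∀ (i : Fin r) (j : Fin s), ((i : ℕ), (j : ℕ)) ≠ (0, 0) →
          ∃ x, g (i, j) = some x ∧ KR.facPr n t i j = x + 1 := by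
        intro i j hij
        obtain ⟨x, hx⟩ := Option.ne_none_iff_exists'.1 ((hfull (i, j)).2 ⟨⟨i.2, j.2⟩, hij⟩)
        exact ⟨x, hx, by rw [hpr, hx]; rfl⟩
      have h0 : ∀ (i : Fin r) (j : Fin s), ((i : ℕ), (j : ℕ)) = (0, 0) → KR.facPr n t i j = 1 := by
        intro i j hij
        rw [hpr, hij, hP.hole]; rfl
      have hone : ∀ i j, 1 ≤ KR.facPr n t i j := fun i j => by rw [hpr]; omega
      have mono : ∀ i j i' j', i ≤ i' → j ≤ j' → ¬ (i = i' ∧ j = j') →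
          KR.facPr n t i j < KR.facPr n t i' j' := by
        intro i j i' j' hi hj hne
        have hi' : (i : ℕ) ≤ i' := hi
        have hj' : (j : ℕ) ≤ j' := hj
        have hne' : ((i : ℕ), (j : ℕ)) ≠ ((i' : ℕ), (j' : ℕ)) := by
          simp only [ne_eq, Prod.mk.injEq, Fin.val_inj]
          exact hne
        obtain ⟨y, hy, hy'⟩ := key i' j' (by
          rintro h1
          simp only [Prod.mk.injEq] at h1 hne'
          omega)
        by_cases hij : ((i : ℕ), (j : ℕ)) = (0, 0)
        · refine lt_of_le_of_ne ?_ fun h => hne (hinj _ _ _ _ h)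
          rw [h0 i j hij]
          exact hone _ _
        · obtain ⟨x, hx, hx'⟩ := key i j hij
          have := hP.inc _ _ _ _ hx hy ⟨hi', hj'⟩ hne'
          omega
      first
      | exact fun i j j' hj => (mono i j i j' le_rfl hj.le (fun h => hj.ne h.2)).le
      | exact fun i i' j hi => mono i j i' j hi.le le_rfl (fun h => hi.ne h.1)
    · have h1 : ∀ i j, t i j ≠ n := fun i j hij => hn ⟨(i, j), by simp [hij]⟩
      rw [facPr_of_forall_ne h1]
      first
      | exact fun i j j' hj => Nat.succ_le_succ (h.ssyt.row_weak i j j' hj)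
      | exact fun i i' j hi => Nat.succ_lt_succ (h.ssyt.col_strict i i' j hi)

theorem nextOut_corner {r s : ℕ} (t : Fac r s) (v : Option ℕ) (hr : 0 < r) (hs : 0 < s) :
    nextOut (Function.update (toGrid t) (r - 1, s - 1) v) (r - 1, s - 1) = none := by
  refine nextOut_eq_none ?_ ?_
  · rw [Function.update_of_ne (by simp)]
    simp only [toGrid]
    rw [dif_neg]
    omega
  · rw [Function.update_of_ne (by simp)]
    simp only [toGrid]
    rw [dif_neg]
    omega

theorem Punctured.jdtOut_eq {n r s k : ℕ} {t : Fac r s} {g : Grid} {c : ℕ × ℕ}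
    (hP : Punctured r s (Function.update (toGrid t) (r - 1, s - 1) none) (r - 1, s - 1))
    (hc : ∀ d, toGrid t d = some n ↔ d = (r - 1, s - 1))
    (hp : Path nextIn k (Function.update (toGrid t) (r - 1, s - 1) none, (r - 1, s - 1)) (g, c)) :
    jdtOut r s g c = (Function.update (toGrid t) (r - 1, s - 1) none, (r - 1, s - 1)) ∧
      Function.update (Function.update (toGrid t) (r - 1, s - 1) none) (r - 1, s - 1) (some n) =
        toGrid t := by
  have hm := hP.mem
  have hk := path_sum hp
  simp only at hm hk
  constructor
  · have := hP.path_reverse hp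
    rw [jdtOut, Function.update_eq_self_iff.2 ((hP.path hp).hole).symm]
    exact slide_eq_of_path this (nextOut_corner t none (by omega) (by omega)) (by omega)
  · rw [Function.update_idem, Function.update_eq_self_iff.2]
    exact ((hc _).2 rfl).symm

/-- The letter `1` in the image reveals whether `n` was present. If so, the slid grid can be read
off, and the outward slide from the origin recovers the tableau. -/
theorem facPr_injective {n r s : ℕ} {t t' : Fac r s} (h : FacStd n t) (h' : FacStd n t')
    (he : facPr n t = facPr n t') : t = t' := by
  by_cases hn : ∃ c, toGrid t c = some n
  · have hn' : ∃ c, toGrid t' c = some n := by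
      rwa [← facPr_eq_one_iff h', ← he, facPr_eq_one_iff h]
    obtain ⟨k, g, hp, hP, hfull, hc, hpr⟩ := h.exists_path hn
    obtain ⟨k', g', hp', hP', hfull', hc', hpr'⟩ := h'.exists_path hn'
    have hm := (toGrid_eq_some.1 ((hc _).2 rfl)).1
    have hg : g = g' := by
      funext c
      by_cases hcr : (c.1 < r ∧ c.2 < s) ∧ c ≠ (0, 0)
      · obtain ⟨x, hx⟩ := Option.ne_none_iff_exists'.1 ((hfull c).2 hcr)
        obtain ⟨y, hy⟩ := Option.ne_none_iff_exists'.1 ((hfull' c).2 hcr)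
        have h1 := hpr ⟨c.1, hcr.1.1⟩ ⟨c.2, hcr.1.2⟩
        have h2 := hpr' ⟨c.1, hcr.1.1⟩ ⟨c.2, hcr.1.2⟩
        rw [he, h2] at h1
        change (g' c).getD 0 + 1 = (g c).getD 0 + 1 at h1
        rw [hx, hy] at h1 ⊢
        simpa using h1.symm
      · have h1 := mt (hfull c).1 hcr
        have h2 := mt (hfull' c).1 hcr
        rw [not_not.1 h1, not_not.1 h2]
    subst hg
    obtain ⟨h1, h2⟩ := (h.punctured hm).jdtOut_eq hc hp
    obtain ⟨h3, h4⟩ := (h'.punctured hm).jdtOut_eq hc' hp'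
    rw [h3, Prod.mk.injEq] at h1
    rw [h1.1, h2] at h4
    exact toGrid_injective h4
  · have hn' : ¬ ∃ c, toGrid t' c = some n := by
      rwa [← facPr_eq_one_iff h', ← he, facPr_eq_one_iff h]
    have h1 : ∀ i j, t i j ≠ n := fun i j hij => hn ⟨(i, j), by simp [hij]⟩
    have h2 : ∀ i j, t' i j ≠ n := fun i j hij => hn' ⟨(i, j), by simp [hij]⟩
    rw [facPr_of_forall_ne h1, facPr_of_forall_ne h2] at he
    ext i j
    have := congrFun (congrFun he i) j
    simpa using this

theorem FacStd.facPr_row_lt {n r s x : ℕ} {t : Fac r s} (h : FacStd n t) (hx : x + 1 < n)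
    {p q p' q' : ℕ × ℕ} (hp : toGrid t p = some x) (hq : toGrid t q = some (x + 1))
    (hp' : toGrid (KR.facPr n t) p' = some (x + 1))
    (hq' : toGrid (KR.facPr n t) q' = some (x + 2)) : p.1 < q.1 ↔ p'.1 < q'.1 := by
  obtain ⟨hpr, hpx⟩ := toGrid_eq_some.1 hp
  have hx1 : 1 ≤ x := hpx ▸ h.ssyt.pos _ _
  by_cases hn : ∃ c, toGrid t c = some n
  · obtain ⟨k, g, hp1, hP, hfull, hc, hfp⟩ := h.exists_path hn
    have hm := (toGrid_eq_some.1 ((hc _).2 rfl)).1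
    have htg := toGrid_facPr (by omega) (by omega) hfull hfp
    have key : ∀ c y, 1 ≤ y → toGrid (KR.facPr n t) c = some (y + 1) → g c = some y := by
      intro c y hy h1
      rw [htg] at h1
      obtain ⟨z, hz, hzy⟩ := Option.map_eq_some_iff.1 h1
      rw [Function.update_apply] at hz
      split_ifs at hz
      · simp at hz; omega
      · rw [hz]; congr 1; omega
    have hne : ∀ c y, y < n → toGrid t c = some y →
        Function.update (toGrid t) (r - 1, s - 1) none c = some y := by
      intro c y hy h1
      rw [Function.update_of_ne, h1]
      rintro rfl
      rw [(hc _).2 rfl] at h1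
      simp at h1; omega
    exact (h.punctured hm).path_row_lt hp1 (hne _ _ (by omega) hp) (hne _ _ hx hq)
      (key _ _ hx1 hp') (key _ _ (by omega) hq')
  · have h1 : ∀ i j, t i j ≠ n := fun i j hij => hn ⟨(i, j), by simp [hij]⟩
    rw [facPr_of_forall_ne h1] at hp' hq'
    have key : ∀ c c' y, toGrid t c = some y → toGrid (fun i j => t i j + 1) c' = some (y + 1) →
        c = c' := by
      intro c c' y hc hc'
      obtain ⟨h2, h3⟩ := toGrid_eq_some.1 hc
      obtain ⟨h4, h5⟩ := toGrid_eq_some.1 hc'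
      have := h.inj _ _ _ _ (h3.trans (Nat.succ_injective h5).symm)
      simp only [Fin.mk.injEq] at this
      exact Prod.ext this.1 this.2
    rw [key _ _ _ hp hp', key _ _ _ hq hq']

/-- All letters other than the one at the origin and the `n` in the corner lie in `[2, n - 1]`, so
only there must `φ` be monotone. In particular `φ` may exchange or merge 1 and 2, and the relabelled
tableau need not be standard. -/
theorem FacStd.facPr_comp {n r s : ℕ} {t : Fac r s} (h : FacStd n t) {φ : ℕ → ℕ}
    (hφ : StrictMonoOn φ (Set.Icc 2 (n - 1))) (hn : ∀ x, 1 ≤ x → x ≤ n → (φ x = n ↔ x = n)) :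
    KR.facPr n (fun i j => φ (t i j)) =
      fun i j => if KR.facPr n t i j = 1 then 1 else φ (KR.facPr n t i j - 1) + 1 := by
  have hnt : ∀ i j, φ (t i j) = n ↔ t i j = n :=
    fun i j => hn _ (h.ssyt.pos i j) (h.ssyt.le i j)
  by_cases hnm : ∃ c, toGrid t c = some n
  · obtain ⟨k, g, hp, hP, hfull, hc, hfp⟩ := h.exists_path hnm
    have hm := (toGrid_eq_some.1 ((hc _).2 rfl)).1
    have hmap : ∀ c, toGrid (fun i j => φ (t i j)) c = (toGrid t c).map φ := by
      intro c
      simp only [toGrid]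
      split_ifs <;> rfl
    have hstart : (fun c => (Function.update (toGrid t) (r - 1, s - 1) none c).map φ) =
        Function.update (toGrid fun i j => φ (t i j)) (r - 1, s - 1) none := by
      funext c
      by_cases hcc : c = (r - 1, s - 1)
      · simp [hcc]
      · simp [Function.update_of_ne hcc, hmap]
    have hmem : ∀ c x, c ≠ (0, 0) → Function.update (toGrid t) (r - 1, s - 1) none c = some x →
        x ∈ Set.Icc 2 (n - 1) := by
      intro c x hc0 hx
      have hcc : c ≠ (r - 1, s - 1) := by rintro rfl; simp at hx
      rw [Function.update_of_ne hcc] at hx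
      have hxn : x ≠ n := by rintro rfl; exact hcc ((hc c).1 hx)
      obtain ⟨h1, rfl⟩ := toGrid_eq_some.1 hx
      have h2 := h.ssyt.le ⟨c.1, h1.1⟩ ⟨c.2, h1.2⟩
      have h3 := h.lt (i := ⟨0, by omega⟩) (j := ⟨0, by omega⟩) (i' := ⟨c.1, h1.1⟩)
        (j' := ⟨c.2, h1.2⟩) (Nat.zero_le _) (Nat.zero_le _) (by
          simp only [Fin.mk.injEq]
          rintro ⟨h4, h5⟩
          exact hc0 (Prod.ext h4.symm h5.symm))
      have h4 := h.ssyt.pos ⟨0, by omega⟩ ⟨0, by omega⟩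
      exact ⟨by omega, by omega⟩
    have hp' := path_map (φ := φ) hp fun c d x y hc0 hd0 hx hy =>
      (hφ.le_iff_le (hmem _ _ hc0 hx) (hmem _ _ hd0 hy)).symm
    simp only at hp'
    rw [hstart] at hp'
    ext i j
    rw [facPr_eq_of_path (c := (r - 1, s - 1)) ?_ hp' (nextIn_eq_none.2 ⟨by simp, by simp⟩)]
    · simp only
      rw [hfp]
      by_cases h0 : ((i : ℕ), (j : ℕ)) = (0, 0)
      · have h00 := hP.hole
        rw [h0, h00]; rfl
      · obtain ⟨x, hx⟩ := Option.ne_none_iff_exists'.1 ((hfull (i, j)).2 ⟨⟨i.2, j.2⟩, h0⟩)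
        have hx1 : x ≠ 0 := by
          obtain ⟨σ, hσ⟩ := facPr_perm n t
          rintro rfl
          have h1 := hfp i j
          rw [hx, hσ, cyc] at h1
          have h2 := h.facPr.inj i j ⟨0, by omega⟩ ⟨0, by omega⟩ (by
            rw [hfp, hfp, hx]
            have h00 := hP.hole
            simp only
            rw [h00]; rfl)
          apply h0
          rw [h2.1, h2.2]
        rw [hx]
        simp [hx1]
    · intro d
      rw [hmap, ← hc d, Option.map_eq_some_iff]
      constructor
      · rintro ⟨x, hx, hxn⟩
        obtain ⟨h1, rfl⟩ := toGrid_eq_some.1 hx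
        rw [hx, (hnt _ _).1 hxn]
      · intro hx
        obtain ⟨h1, h2⟩ := toGrid_eq_some.1 hx
        exact ⟨n, hx, by have := (hnt _ _).2 h2; rwa [h2] at this⟩
  · have h1 : ∀ i j, t i j ≠ n := fun i j hij => hnm ⟨(i, j), by simp [hij]⟩
    rw [facPr_of_forall_ne h1, facPr_of_forall_ne fun i j => mt (hnt i j).1 (h1 i j)]
    ext i j
    have := h.ssyt.pos i j
    beta_reduce
    rw [if_neg (by omega)]
    rfl

/-- Exchanging `n` for `n - 1` in a tableau without `n - 1`. -/
theorem FacStd.facPr_facPr_pred {n r s : ℕ} {t : Fac r s} (h : FacStd n t) (h2 : 2 ≤ n)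
    (hn : ∃ c, toGrid t c = some n) (hn' : ∀ i j, t i j ≠ n - 1) :
    KR.facPr n (KR.facPr n fun i j => if t i j = n then n - 1 else t i j) =
      fun i j => Equiv.swap 1 2 (KR.facPr n (KR.facPr n t) i j) := by
  obtain ⟨k, g, hp, hP, hfull, hc, hfp⟩ := h.exists_path hn
  have hm := (toGrid_eq_some.1 ((hc _).2 rfl)).1
  have h1 : KR.facPr n (fun i j => if t i j = n then n - 1 else t i j) =
      fun i j => if t i j = n then n else t i j + 1 := by
    rw [facPr_of_forall_ne]
    · ext i j; split_ifs <;> omega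
    · intro i j
      split_ifs with h3
      · omega
      · exact h3
  have h3 : ∀ i j, KR.facPr n t i j ≠ n := by
    obtain ⟨σ, hσ⟩ := facPr_perm n t
    intro i j
    rw [hσ, cyc]
    have := hn' (σ (i, j)).1 (σ (i, j)).2
    split_ifs <;> omega
  -- The same slide occurs once on each side: in the first promotion of `t`, and in the second
  -- promotion of the relabelled tableau, whose first promotion is a mere shift. The only difference
  -- is whether the new letter is shifted once more.
  have h4 := path_map (φ := (· + 1)) hp (by intros; simp)
  simp only at h4
  rw [h1, facPr_of_forall_ne h3]
  have hstart : (fun c => (Function.update (toGrid t) (r - 1, s - 1) none c).map (· + 1)) =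
      Function.update (toGrid fun i j => if t i j = n then n else t i j + 1) (r - 1, s - 1)
        none := by
    funext c
    by_cases hcc : c = (r - 1, s - 1)
    · simp [hcc]
    · rw [Function.update_of_ne hcc, Function.update_of_ne hcc]
      simp only [toGrid]
      split_ifs with h5 h6
      · exact absurd ((hc c).1 (toGrid_eq_some.2 ⟨h5, h6⟩)) hcc
      · rfl
      · rfl
  rw [hstart] at h4
  ext i j
  rw [facPr_eq_of_path (c := (r - 1, s - 1)) ?_ h4 (nextIn_eq_none.2 ⟨by simp, by simp⟩)]
  · simp only
    rw [hfp]
    by_cases h0 : ((i : ℕ), (j : ℕ)) = (0, 0)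
    · have h00 := hP.hole
      rw [h0, h00]; simp
    · obtain ⟨x, hx⟩ := Option.ne_none_iff_exists'.1 ((hfull (i, j)).2 ⟨⟨i.2, j.2⟩, h0⟩)
      have hx1 : x ≠ 0 := by
        rintro rfl
        have h2 := h.facPr.inj i j ⟨0, by omega⟩ ⟨0, by omega⟩ (by
          rw [hfp, hfp, hx]
          have h00 := hP.hole
          simp only
          rw [h00]; rfl)
        apply h0
        rw [h2.1, h2.2]
      rw [hx, Equiv.swap_apply_of_ne_of_ne]
      · simp
      · simp
      · simp [hx1]
  · intro d
    rw [← hc d, toGrid_eq_some, toGrid_eq_some]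
    refine exists_congr fun h5 => ?_
    have := hn' ⟨d.1, h5.1⟩ ⟨d.2, h5.2⟩
    split_ifs with h6
    · simp [h6]
    · constructor
      · intro; omega
      · intro h7; exact absurd h7 h6

/-- When `n - 1` stands in the last row, raising it to `n` gives two holes side by side. The left
hole follows the first slide of the double promotion without its first step, and the corner hole
follows the second slide. Only the number of shifts of the new letters differs, which accounts for
the `1` turned into `2`. -/
theorem FacStd.facPr_pred_succ {n r s : ℕ} {t : Fac r s} (h : FacStd n t) (h2 : 2 ≤ n)
    (hn : ∃ c, toGrid t c = some n) (hn' : ∃ c, toGrid t c = some (n - 1) ∧ c.1 = r - 1)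
    (i : Fin r) (j : Fin s) :
    KR.facPr n (fun i j => if t i j = n - 1 then n else t i j) i j + 1 =
      if KR.facPr n (KR.facPr n t) i j = 1 then 2 else KR.facPr n (KR.facPr n t) i j := by
  obtain ⟨g₁, g₂, d, k, k', H⟩ := h.exists_twoSlides hn ⟨_, hn'.choose_spec.1⟩ h2
  obtain ⟨e, he, hpos, hnext⟩ := H.pred
  obtain ⟨c, hc, hcr⟩ := hn'
  have hm := H.start.mem
  simp only at hm
  have hec : e = c := by
    obtain ⟨h3, h4⟩ := toGrid_eq_some.1 he
    obtain ⟨h5, h6⟩ := toGrid_eq_some.1 hc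
    have := h.inj _ _ _ _ (h4.trans h6.symm)
    simp only [Fin.mk.injEq] at this
    exact Prod.ext this.1 this.2
  subst hec
  have hpos' : e.2 + 1 = s - 1 := by omega
  have hne : e ≠ (r - 1, s - 1) := by
    intro h3
    have := congrArg Prod.snd h3
    simp only at this
    omega
  have hle : ¬ ((r - 1, s - 1) : ℕ × ℕ) ≤ e := by
    simp only [Prod.le_def]
    omega
  obtain ⟨k₁, h3⟩ := H.path₁.exists_tail (by simp only [ne_eq, Prod.mk.injEq]; omega) hnext
  -- Emptying the corner in advance does not affect a slide that starts at `e`.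
  have h4 := path_update_of_not_le h3 (z := (r - 1, s - 1)) hle none
  set x : Fac r s := fun i j => if t i j = n - 1 then n else t i j with hx
  have hxg : ∀ f, toGrid x f = some n ↔ f = e ∨ f = (r - 1, s - 1) := by
    intro f
    rw [← H.corner, toGrid_eq_some]
    constructor
    · rintro ⟨h5, h6⟩
      simp only [hx] at h6
      split_ifs at h6 with h7
      · left
        obtain ⟨h8, h9⟩ := toGrid_eq_some.1 he
        have := h.inj _ _ _ _ (h7.trans h9.symm)
        simp only [Fin.mk.injEq] at this
        exact Prod.ext this.1 this.2
      · exact .inr (toGrid_eq_some.2 ⟨h5, h6⟩)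
    · rintro (rfl | h5)
      · obtain ⟨h8, h9⟩ := toGrid_eq_some.1 he
        exact ⟨h8, by simp [hx, h9]⟩
      · obtain ⟨h8, h9⟩ := toGrid_eq_some.1 h5
        refine ⟨h8, ?_⟩
        simp only [hx, h9]
        rw [if_neg (by omega)]
  have hstart : Function.update (moveHole (Function.update (toGrid t) (r - 1, s - 1) none,
      (r - 1, s - 1)) e).1 (r - 1, s - 1) none =
      Function.update (Function.update (toGrid x) e none) (r - 1, s - 1) none := by
    funext f
    by_cases hf : f = (r - 1, s - 1)
    · simp [hf]
    · rw [Function.update_of_ne hf, Function.update_of_ne hf, moveHole_apply]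
      by_cases hf' : f = e
      · simp [hf']
      · rw [if_neg hf', if_neg hf, Function.update_of_ne hf']
        simp only
        rw [Function.update_of_ne hf]
        simp only [toGrid, hx]
        split_ifs with h5 h6
        · obtain ⟨h8, h9⟩ := toGrid_eq_some.1 he
          have := h.inj _ _ _ _ (h6.trans h9.symm)
          simp only [Fin.mk.injEq] at this
          exact absurd (Prod.ext this.1 this.2) hf'
        · rfl
        · rfl
  rw [hstart] at h4
  have h5 : Path nextIn k' (Function.update (Function.update g₁ (r - 1, s - 1) none)
      (r - 1, s - 1) none, (r - 1, s - 1)) (g₂, d) := by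
    rw [Function.update_idem]; exact H.path₂
  rw [facPr_eq_of_path₂ hxg (.inr ⟨hcr, by simp only; omega⟩) h4
    (nextIn_eq_none.2 ⟨by simp, by simp⟩) h5 H.terminal₂ i j, H.facPr_facPr]
  simp only
  by_cases h0 : ((i : ℕ), (j : ℕ)) = (0, 0)
  · rw [if_pos h0]
    have : g₂ (i, j) = none := by
      by_contra hcon
      exact ((H.full₂ _).1 hcon).2.1 h0
    rw [this]; rfl
  · rw [if_neg h0]
    by_cases hd : ((i : ℕ), (j : ℕ)) = d
    · rw [if_pos hd, hd, H.punctured₂.hole]; rfl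
    · rw [if_neg hd, if_neg (by omega)]

/-- The letter `2` of the promoted tableau is the former `1`, and it is in `(1, 0)` exactly if the
slide enters the origin from below. Since `i + 1` is not in a lower row than `i`, swapping them can
only turn upward steps into leftward ones, so the path moves down. -/
theorem FacStd.facPr_swap_mono {n r s i : ℕ} {t t' : Fac r s} (h : FacStd n t) (h' : FacStd n t')
    (hi : 2 ≤ i) (hin : i + 1 < n) (ht : ∀ a b, t' a b = Equiv.swap i (i + 1) (t a b))
    (hn : ∃ c, toGrid t c = some n) (h1 : ∃ c, toGrid t c = some 1)
    (hD : ∀ p q, toGrid t p = some i → toGrid t q = some (i + 1) → q.1 ≤ p.1)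
    (h2 : toGrid (KR.facPr n t) (1, 0) = some 2) : toGrid (KR.facPr n t') (1, 0) = some 2 := by
  have hmap : ∀ c, toGrid t' c = (toGrid t c).map (Equiv.swap i (i + 1)) := by
    intro c
    simp only [toGrid, ht]
    split_ifs <;> rfl
  have hn' : ∃ c, toGrid t' c = some n := by
    obtain ⟨c, hc⟩ := hn
    refine ⟨c, ?_⟩
    rw [hmap, hc, Option.map_some, Equiv.swap_apply_of_ne_of_ne (by omega) (by omega)]
  obtain ⟨k, g, hp, hP, hfull, hc, hfp⟩ := h.exists_path hn
  obtain ⟨k', g', hp', hP', hfull', hc', hfp'⟩ := h'.exists_path hn'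
  have hm := (toGrid_eq_some.1 ((hc _).2 rfl)).1
  have hr : 0 < r := by omega
  have hs : 0 < s := by omega
  have htg := toGrid_facPr hr hs hfull hfp
  have htg' := toGrid_facPr hr hs hfull' hfp'
  have h00 : toGrid t (0, 0) = some 1 := by
    obtain ⟨c, hc1⟩ := h1
    obtain ⟨h3, h4⟩ := toGrid_eq_some.1 hc1
    by_cases hc0 : c = (0, 0)
    · rw [← hc0, hc1]
    · have := h.lt (i := ⟨0, hr⟩) (j := ⟨0, hs⟩) (i' := ⟨c.1, h3.1⟩) (j' := ⟨c.2, h3.2⟩)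
        (Nat.zero_le _) (Nat.zero_le _) (by
          simp only [Fin.mk.injEq]
          rintro ⟨h5, h6⟩
          exact hc0 (Prod.ext h5.symm h6.symm))
      have := h.ssyt.pos ⟨0, hr⟩ ⟨0, hs⟩
      omega
  have h00' : toGrid t' (0, 0) = some 1 := by
    rw [hmap, h00, Option.map_some, Equiv.swap_apply_of_ne_of_ne (by omega) (by omega)]
  have hg10 : g (1, 0) = some 1 := by
    rw [htg] at h2
    obtain ⟨x, hx, hx'⟩ := Option.map_eq_some_iff.1 h2
    rw [Function.update_of_ne (by simp)] at hx
    rw [hx]; congr 1; omega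
  have hr1 := (hP.out (1, 0) (by simp [hg10])).1
  have hcne : ((r - 1, s - 1) : ℕ × ℕ) ≠ (0, 0) := by
    simp only [ne_eq, Prod.mk.injEq]
    simp only at hr1
    omega
  have hcorner : ∀ c, c ≤ ((r - 1, s - 1) : ℕ × ℕ) → c ≠ (r - 1, s - 1) →
      ∀ f : Grid, Function.update f (r - 1, s - 1) none c = f c :=
    fun c _ hc f => Function.update_of_ne hc _ _
  have hnoneiff : ∀ c, toGrid t c = none ↔ toGrid t' c = none := fun c => by
    rw [hmap, Option.map_eq_none_iff]
  have key := path_last_step_mono (g₀ := toGrid t) (g₀' := toGrid t') (v := 1)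
    (h.punctured hm) hp hp' rfl rfl hcne (fun c h3 h4 => hcorner c h3 h4 _)
    (fun c h3 h4 => hcorner c h3 h4 _) (fun c => (hnoneiff c).1) (fun c => (hnoneiff c).2)
    (by
      intro a b u l u' l' hu hl hu' hl' hlu
      rw [hmap, hu] at hu'
      rw [hmap, hl] at hl'
      simp only [Option.map_some, Option.some.injEq] at hu' hl'
      by_contra hcon
      -- The swap alters a comparison only if the two neighbours are `i` and `i + 1`. The left
      -- neighbour is in the lower row, so `hD` leaves only `i + 1` above and `i` to the left.
      have hbad : ¬ (u = i ∧ l = i + 1) := by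
        rintro ⟨rfl, rfl⟩
        have := hD _ _ hu hl
        simp only at this
        omega
      rw [Equiv.swap_apply_def] at hu' hl'
      split_ifs at hu' hl' <;> omega)
    rfl le_rfl h00 h00' hg10
  simp only at key
  rw [htg']
  beta_reduce
  rw [Function.update_of_ne (by simp)]
  rw [key]
  rfl

/-! ### The moves on a factor -/

theorem boxOf_eq {r s x : ℕ} {g : Grid} {c : ℕ × ℕ} (hc : c.1 < r ∧ c.2 < s)
    (h : ∀ d, g d = some x ↔ d = c) : boxOf r s g x = c := by
  have : boxesWith r s g x = [c] := boxesWith_eq (by simp) fun d => by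
    rw [List.mem_singleton, h]
    constructor
    · rintro rfl; exact ⟨hc, rfl⟩
    · exact fun h => h.2
  rw [boxOf, this]
  rfl

theorem jdtIn_eq {r s k x : ℕ} {g : Grid} {c : ℕ × ℕ} {q : Grid × (ℕ × ℕ)}
    (hc : c.1 < r ∧ c.2 < s) (h : ∀ d, g d = some x ↔ d = c)
    (hp : Path nextIn k (Function.update g c none, c) q) (hq : q.2 = (0, 0)) :
    jdtIn r s g (boxOf r s g x) = q := by
  have hk := path_sum hp
  simp only at hk
  rw [boxOf_eq hc h, jdtIn]
  refine slide_eq_of_path hp ?_ (by omega)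
  rw [hq]
  exact nextIn_eq_none.2 ⟨by simp, by simp⟩

/-- This lemma and the next three identify the result of a move by its promotion, which turns every
move into a transposition of letters. Here `t'` has no `n`, so promoting it is a shift and the
entries can be compared directly. -/
theorem replaceMax_eq {n r s : ℕ} {t t' : Fac r s} (h : FacStd n t) (h' : FacStd n t')
    (hn : ∃ c, toGrid t c = some n) (h1 : ∀ c, toGrid t c ≠ some 1)
    (he : ∀ i j, facPr n t' i j = Equiv.swap 1 2 (facPr n t i j)) : t' = replaceMax n t := by
  obtain ⟨k, g, hp, hP, hfull, hc, hfp⟩ := h.exists_path hn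
  have hm := (toGrid_eq_some.1 ((hc _).2 rfl)).1
  have hno : ∀ i j, facPr n t i j ≠ 2 := by
    obtain ⟨σ, hσ⟩ := facPr_perm n t
    intro i j h2
    rw [hσ, cyc] at h2
    split_ifs at h2
    · omega
    · exact h1 _ ((toGrid_coe t (σ (i, j)).1 (σ (i, j)).2).trans (by congr 1; omega))
  have hn' : ∀ i j, t' i j ≠ n := by
    intro i j hij
    obtain ⟨c, hc1⟩ := (facPr_eq_one_iff h').2 ⟨(i, j), by simp [hij]⟩
    obtain ⟨h3, h4⟩ := toGrid_eq_some.1 hc1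
    rw [he, Equiv.swap_apply_def] at h4
    split_ifs at h4 with h5 h6
    · omega
    · exact hno _ _ h6
    · exact h5 h4
  rw [facPr_of_forall_ne hn'] at he
  ext i j
  have h2 := he i j
  simp only [replaceMax]
  rw [jdtIn_eq hm hc hp rfl]
  simp only [ofGrid]
  by_cases h0 : ((i : ℕ), (j : ℕ)) = (0, 0)
  · have h00 := hP.hole
    rw [hfp, h0, h00] at h2
    rw [h0]
    simpa using h2
  · rw [Function.update_of_ne h0]
    have h3 := hno i j
    obtain ⟨x, hx⟩ := Option.ne_none_iff_exists'.1 ((hfull (i, j)).2 ⟨⟨i.2, j.2⟩, h0⟩)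
    have hx1 : x ≠ 0 := by
      rintro rfl
      have h2 := h.facPr.inj i j ⟨0, by omega⟩ ⟨0, by omega⟩ (by
        rw [hfp, hfp, hx]
        have h00 := hP.hole
        simp only
        rw [h00]; rfl)
      apply h0
      rw [h2.1, h2.2]
    rw [hfp, hx] at h2 h3
    rw [hx]
    simp only [Option.getD_some] at h2 h3 ⊢
    rw [Equiv.swap_apply_of_ne_of_ne (by omega) h3] at h2
    omega

theorem grid_eq_of_facPr {n r s : ℕ} {t : Fac r s} {g g' : Grid}
    (hfull : ∀ c, g c ≠ none ↔ (c.1 < r ∧ c.2 < s) ∧ c ≠ (0, 0))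
    (hfp : ∀ i j, facPr n t i j = (g (i, j)).getD 0 + 1)
    (hfull' : ∀ c, g' c ≠ none ↔ (c.1 < r ∧ c.2 < s) ∧ c ≠ (0, 0))
    (h : ∀ (i : Fin r) (j : Fin s), ((i : ℕ), (j : ℕ)) ≠ (0, 0) →
      (g' (i, j)).getD 0 + 1 = facPr n t i j) : g' = g := by
  funext c
  by_cases hcr : (c.1 < r ∧ c.2 < s) ∧ c ≠ (0, 0)
  · obtain ⟨x, hx⟩ := Option.ne_none_iff_exists'.1 ((hfull c).2 hcr)
    obtain ⟨y, hy⟩ := Option.ne_none_iff_exists'.1 ((hfull' c).2 hcr)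
    have h1 := h ⟨c.1, hcr.1.1⟩ ⟨c.2, hcr.1.2⟩ hcr.2
    rw [hfp] at h1
    change (g' c).getD 0 + 1 = (g c).getD 0 + 1 at h1
    rw [hx, hy] at h1 ⊢
    simpa using h1
  · have h1 := mt (hfull c).1 hcr
    have h2 := mt (hfull' c).1 hcr
    rw [not_not.1 h1, not_not.1 h2]

/-- Now `t` has no `n` and its promotion is a shift. Emptying the origin of `t` gives the slid grid
of `t'`, and the outward slide in `t` is the reverse of the inward slide in `t'`. -/
theorem replaceMin_eq {n r s : ℕ} {t t' : Fac r s} (h : FacStd n t) (h' : FacStd n t')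
    (hn : ∀ c, toGrid t c ≠ some n) (h1 : ∃ c, toGrid t c = some 1)
    (he : ∀ i j, facPr n t' i j = Equiv.swap 1 2 (facPr n t i j)) : t' = replaceMin n t := by
  have hnt : ∀ i j, t i j ≠ n := fun i j hij => hn (i, j) (by simp [hij])
  rw [facPr_of_forall_ne hnt] at he
  beta_reduce at he
  obtain ⟨c, hc1⟩ := h1
  obtain ⟨h3, h4⟩ := toGrid_eq_some.1 hc1
  have hn' : ∃ c, toGrid t' c = some n := by
    rw [← facPr_eq_one_iff h']
    exact ⟨c, toGrid_eq_some.2 ⟨h3, by rw [he]; simp [h4]⟩⟩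
  obtain ⟨k, g, hp, hP, hfull, hc, hfp⟩ := h'.exists_path hn'
  have hm := (toGrid_eq_some.1 ((hc _).2 rfl)).1
  have hr : 0 < r := by omega
  have hs : 0 < s := by omega
  have hc0 : c = (0, 0) := by
    by_contra hc0
    have := h.lt (i := ⟨0, hr⟩) (j := ⟨0, hs⟩) (i' := ⟨c.1, h3.1⟩) (j' := ⟨c.2, h3.2⟩)
        (Nat.zero_le _) (Nat.zero_le _) (by
          simp only [Fin.mk.injEq]
          rintro ⟨h5, h6⟩
          exact hc0 (Prod.ext h5.symm h6.symm))
    have := h.ssyt.pos ⟨0, hr⟩ ⟨0, hs⟩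
    omega
  subst hc0
  have huniq : ∀ d, toGrid t d = some 1 ↔ d = (0, 0) := by
    refine fun d => ⟨fun hd => ?_, by rintro rfl; exact hc1⟩
    obtain ⟨h5, h6⟩ := toGrid_eq_some.1 hd
    have := h.inj _ _ _ _ (h6.trans h4.symm)
    simp only [Fin.mk.injEq] at this
    exact Prod.ext this.1 this.2
  have hg : Function.update (toGrid t) (0, 0) none = g := by
    refine grid_eq_of_facPr hfull hfp (fun c => ?_) fun i j hij => ?_
    · by_cases hc0 : c = (0, 0)
      · simp [hc0]
      · simp [toGrid, hc0]
    · rw [Function.update_of_ne hij, he, toGrid_coe]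
      have h5 : t i j ≠ 1 := fun h5 => hij ((huniq _).1 (by rw [toGrid_coe, h5]))
      have h6 := h.ssyt.pos i j
      rw [Equiv.swap_apply_of_ne_of_ne (by omega) (by omega)]
      rfl
  obtain ⟨h5, h6⟩ := (h'.punctured hm).jdtOut_eq hc hp
  simp only [replaceMin]
  rw [boxOf_eq ⟨hr, hs⟩ huniq]
  have h7 : jdtOut r s (toGrid t) (0, 0) = jdtOut r s g (0, 0) := by
    rw [jdtOut, jdtOut, ← hg, Function.update_idem]
  rw [h7, h5]
  simp only
  rw [h6, ofGrid_toGrid]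

/-- The letters 2 and 3 after promotion are 1 and 2 in the slid grid; after exchanging them the grid
is the slid grid of `t'`. -/
theorem facTbarOne_eq {n r s : ℕ} {t t' : Fac r s} (h : FacStd n t) (h' : FacStd n t')
    (hn : ∃ c, toGrid t c = some n)
    (he : ∀ i j, facPr n t' i j = Equiv.swap 2 3 (facPr n t i j)) : t' = facTbarOne n t := by
  obtain ⟨k, g, hp, hP, hfull, hc, hfp⟩ := h.exists_path hn
  have hm := (toGrid_eq_some.1 ((hc _).2 rfl)).1
  have hn' : ∃ c, toGrid t' c = some n := by
    rw [← facPr_eq_one_iff h']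
    obtain ⟨c, hc1⟩ := (facPr_eq_one_iff h).2 hn
    obtain ⟨h3, h4⟩ := toGrid_eq_some.1 hc1
    exact ⟨c, toGrid_eq_some.2 ⟨h3, by rw [he, h4]; decide⟩⟩
  obtain ⟨k', g', hp', hP', hfull', hc', hfp'⟩ := h'.exists_path hn'
  have hg : (fun c => (g c).map (Equiv.swap 1 2)) = g' := by
    refine grid_eq_of_facPr hfull' hfp' (fun c => ?_) fun i j hij => ?_
    · rw [← hfull c, Ne, Ne, Option.map_eq_none_iff]
    · obtain ⟨x, hx⟩ := Option.ne_none_iff_exists'.1 ((hfull (i, j)).2 ⟨⟨i.2, j.2⟩, hij⟩)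
      rw [he, hfp, hx]
      simp only [Option.map_some, Option.getD_some, Equiv.swap_apply_def]
      split_ifs <;> omega
  obtain ⟨h5, h6⟩ := (h'.punctured hm).jdtOut_eq hc' hp'
  simp only [facTbarOne]
  rw [jdtIn_eq hm hc hp rfl]
  simp only
  rw [hg, h5]
  simp only
  rw [h6, ofGrid_toGrid]

theorem Punctured.nextOut_corner {r s : ℕ} {g : Grid}
    (h : Punctured r s g (r - 1, s - 1)) : nextOut g (r - 1, s - 1) = none := by
  have hm := h.mem
  simp only at hm
  refine nextOut_eq_none ?_ ?_
  · by_contra hcon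
    have := (h.out _ hcon).1
    simp only at this
    omega
  · by_contra hcon
    have := (h.out _ hcon).2
    simp only at this
    omega

/-- The hook in pr² t shows that the second slide ends at `(1, 0)` for `t` and, with 2 and 3
exchanged, at `(0, 1)` for `t'`. The recipe runs the two slides of `t` inwards, changes the inner
corner accordingly, and runs the two slides of `t'` outwards in reverse order. -/
theorem facTbarLast_eq {n r s k₁ k₂ k₁' k₂' : ℕ} {t t' : Fac r s} {g₁ g₂ g₁' g₂' : Grid}
    {d d' : ℕ × ℕ} (h : FacStd n t) (H : TwoSlides n r s t g₁ g₂ d k₁ k₂)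
    (H' : TwoSlides n r s t' g₁' g₂' d' k₁' k₂') (hn : 3 ≤ n)
    (h2 : toGrid (facPr n (facPr n t)) (1, 0) = some 2)
    (h3 : toGrid (facPr n (facPr n t)) (0, 1) = some 3)
    (he : ∀ i j, facPr n (facPr n t') i j = Equiv.swap 2 3 (facPr n (facPr n t) i j)) :
    t' = facTbarLast n t := by
  have hinj := h.facPr.facPr.inj
  have hinj' : ∀ c c' x, toGrid (facPr n (facPr n t)) c = some x →
      toGrid (facPr n (facPr n t)) c' = some x → c = c' := by
    intro c c' x hc hc'
    obtain ⟨h4, h5⟩ := toGrid_eq_some.1 hc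
    obtain ⟨h6, h7⟩ := toGrid_eq_some.1 hc'
    have := hinj _ _ _ _ (h5.trans h7.symm)
    simp only [Fin.mk.injEq] at this
    exact Prod.ext this.1 this.2
  obtain ⟨hr, h2'⟩ := toGrid_eq_some.1 h2
  obtain ⟨hs, h3'⟩ := toGrid_eq_some.1 h3
  simp only at hr hs h2' h3'
  have hQ : ∀ c, (hc : c.1 < r ∧ c.2 < s) → facPr n (facPr n t) ⟨c.1, hc.1⟩ ⟨c.2, hc.2⟩ =
      if c = (0, 0) then 1 else if c = d then 2 else (g₂ c).getD 0 + 2 :=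
    fun c hc => H.facPr_facPr ⟨c.1, hc.1⟩ ⟨c.2, hc.2⟩
  have hQ' : ∀ c, (hc : c.1 < r ∧ c.2 < s) → facPr n (facPr n t') ⟨c.1, hc.1⟩ ⟨c.2, hc.2⟩ =
      if c = (0, 0) then 1 else if c = d' then 2 else (g₂' c).getD 0 + 2 :=
    fun c hc => H'.facPr_facPr ⟨c.1, hc.1⟩ ⟨c.2, hc.2⟩
  have hd : d = (1, 0) := by
    have hm := H.punctured₂.mem
    have h4 := hQ d hm
    rw [if_neg, if_pos rfl] at h4
    · exact hinj' _ _ 2 (toGrid_eq_some.2 ⟨hm, h4⟩) h2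
    · rintro rfl
      rcases H.pred with ⟨e, he1, -, -⟩
      by_cases hrow : e.1 = r - 1
      · have := H.right ⟨e, he1, hrow⟩
        simp at this
      · have := H.below ⟨e, he1, hrow⟩
        simp at this
  have hd' : d' = (0, 1) := by
    have hm := H'.punctured₂.mem
    have hd0 : d' ≠ (0, 0) := by
      rintro rfl
      rcases H'.pred with ⟨e, he1, -, -⟩
      by_cases hrow : e.1 = r - 1
      · have := H'.right ⟨e, he1, hrow⟩
        simp at this
      · have := H'.below ⟨e, he1, hrow⟩
        simp at this
    have h4 := hQ' d' hm
    rw [if_neg hd0, if_pos rfl, he] at h4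
    refine hinj' _ _ 3 (toGrid_eq_some.2 ⟨hm, ?_⟩) h3
    rw [Equiv.swap_apply_eq_iff] at h4
    rw [h4]; decide
  subst hd hd'
  have hg01 : g₂ (0, 1) = some 1 := by
    have h4 := hQ (0, 1) hs
    rw [h3', if_neg (by simp), if_neg (by simp)] at h4
    obtain ⟨x, hx⟩ := Option.ne_none_iff_exists'.1 ((H.full₂ (0, 1)).2 ⟨hs, by simp, by simp⟩)
    rw [hx] at h4 ⊢
    simp at h4
    rw [← h4]
  -- The two grids after both slides differ only in the position of the letter `1`, on one side or
  -- the other of the empty origin.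
  have hg₂' : g₂' = Function.update (Function.update g₂ (0, 1) none) (1, 0) (some 1) := by
    funext c
    by_cases h4 : c = (1, 0)
    · subst h4
      have h5 := hQ' (1, 0) hr
      rw [he, h2', if_neg (by simp), if_neg (by simp)] at h5
      obtain ⟨x, hx⟩ := Option.ne_none_iff_exists'.1
        ((H'.full₂ (1, 0)).2 ⟨hr, by simp, by simp⟩)
      rw [hx] at h5 ⊢
      simp at h5
      simp [← h5]
    · rw [Function.update_of_ne h4]
      by_cases h5 : c = (0, 1)
      · rw [h5, H'.punctured₂.hole]; simp
      · rw [Function.update_of_ne h5]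
        by_cases h6 : (c.1 < r ∧ c.2 < s) ∧ c ≠ (0, 0)
        · obtain ⟨x, hx⟩ := Option.ne_none_iff_exists'.1 ((H'.full₂ c).2 ⟨h6.1, h6.2, h5⟩)
          obtain ⟨y, hy⟩ := Option.ne_none_iff_exists'.1 ((H.full₂ c).2 ⟨h6.1, h6.2, h4⟩)
          have h7 := hQ c h6.1
          have h8 := hQ' c h6.1
          rw [he] at h8
          rw [if_neg h6.2, if_neg h5, hx] at h8
          rw [if_neg h6.2, if_neg h4, hy] at h7
          have h9 : facPr n (facPr n t) ⟨c.1, h6.1.1⟩ ⟨c.2, h6.1.2⟩ ≠ 2 := fun h9 =>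
            h4 (hinj' _ _ _ (toGrid_eq_some.2 ⟨h6.1, h9⟩) h2)
          have h10 : facPr n (facPr n t) ⟨c.1, h6.1.1⟩ ⟨c.2, h6.1.2⟩ ≠ 3 := fun h9 =>
            h5 (hinj' _ _ _ (toGrid_eq_some.2 ⟨h6.1, h9⟩) h3)
          rw [Equiv.swap_apply_of_ne_of_ne h9 h10, h7] at h8
          rw [hx, hy]
          simpa using h8.symm
        · have h7 := mt (H'.full₂ c).1 (fun h => h6 ⟨h.1, h.2.1⟩)
          have h8 := mt (H.full₂ c).1 (fun h => h6 ⟨h.1, h.2.1⟩)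
          rw [not_not.1 h7, not_not.1 h8]
  have hm := H.start.mem
  simp only at hm
  have hc0 : ((r - 1, s - 1) : ℕ × ℕ) ≠ (0, 0) := by
    simp only [ne_eq, Prod.mk.injEq]
    omega
  -- The inserted `1` takes the place of the second hole at `(1, 0)`, and the hole moves on to the
  -- origin.
  have hq : jdtIn r s (Function.update g₁ (0, 0) (some 1))
      (boxOf r s (Function.update g₁ (0, 0) (some 1)) (n - 1)) =
      (Function.update (Function.update g₂ (1, 0) (some 1)) (0, 0) none, (0, 0)) := by
    refine jdtIn_eq (k := k₂ + 1) (c := (r - 1, s - 1)) hm (fun c => ?_) ?_ rfl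
    · by_cases hc : c = (0, 0)
      · subst hc
        simp only [Function.update_self, Option.some.injEq]
        constructor
        · intro; omega
        · intro h; exact absurd h.symm hc0
      · rw [Function.update_of_ne hc, H.corner₁]
    · have := path_update_corner H.path₂ (by
        simp only; rw [Function.update_of_ne (Ne.symm hc0)]; exact H.punctured₁.hole) (.inr rfl) 1
      simp only at this
      rwa [Function.update_comm hc0] at this
  -- At this stage the letter `1` occurs twice, which is why the recipe asks for the one in the
  -- first row, at `(0, 1)`.
  have hbw : boxesWith r s (Function.update (Function.update g₂ (1, 0) (some 1)) (0, 0) none) 1 =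
      [(1, 0), (0, 1)] := by
    refine boxesWith_eq (by simp [ReadBefore]) fun c => ?_
    simp only [List.mem_cons, List.not_mem_nil, or_false]
    constructor
    · rintro (rfl | rfl)
      · exact ⟨hr, by simp⟩
      · exact ⟨hs, by simp [hg01]⟩
    · rintro ⟨-, h4⟩
      simp only [Function.update_apply] at h4
      split_ifs at h4 with h5 h6
      · exact .inl h6
      · exact .inr (H.punctured₂.inj _ _ _ h4 hg01)
  -- Removing the `1` at `(0, 1)` leaves the grid reached by the second slide of `t'`, which is now
  -- run backwards.
  have hu : jdtOut r s (Function.update (Function.update g₂ (1, 0) (some 1)) (0, 0) none) (0, 1) =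
      (Function.update g₁' (r - 1, s - 1) none, (r - 1, s - 1)) := by
    have h4 : Function.update (Function.update (Function.update g₂ (1, 0) (some 1)) (0, 0) none)
        (0, 1) none = g₂' := by
      rw [hg₂']
      funext c
      have h5 : g₂ (0, 0) = none := by
        by_contra hcon
        exact ((H.full₂ _).1 hcon).2.1 rfl
      simp only [Function.update_apply]
      by_cases h6 : c = (0, 0)
      · simp [h6, h5]
      · by_cases h7 : c = (0, 1)
        · simp [h7]
        · simp [h6, h7]
    have hk := path_sum H'.path₂
    simp only at hk
    rw [jdtOut, h4]
    exact slide_eq_of_path (H'.start₂.path_reverse H'.path₂) H'.start₂.nextOut_corner (by omega)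
  obtain ⟨h5, h6⟩ := H'.start.jdtOut_eq H'.corner H'.path₁
  have hg₁' : Function.update (Function.update g₁' (r - 1, s - 1) none) (r - 1, s - 1)
      (some (n - 1)) = g₁' := by
    rw [Function.update_idem, Function.update_eq_self_iff.2]
    exact ((H'.corner₁ _).2 rfl).symm
  simp only [facTbarLast]
  rw [jdtIn_eq hm H.corner H.path₁ rfl]
  simp only
  rw [hq]
  simp only
  rw [hbw]
  have hhead : (([(1, 0), (0, 1)] : List (ℕ × ℕ)).filter fun b => b.1 = 0).headD (0, 0) =
      (0, 1) := by decide
  rw [hhead, hu]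
  simp only
  rw [hg₁', h5]
  simp only
  rw [h6, ofGrid_toGrid]

/-! ### Tensor products: reading words, promotion and descents of standard fillings, and the moves
as dual equivalences. -/

variable {k : ℕ} {R : Fin k → ℕ × ℕ}

/-! ### Reading words of fillings -/

/-- Reading order of boxes, given by the index of a factor and a position in it. -/
def BoxBefore (m : Fin k) (c : ℕ × ℕ) (m' : Fin k) (c' : ℕ × ℕ) : Prop :=
  m < m' ∨ m = m' ∧ ReadBefore c c'

/-- The position of a box in its factor. -/
def Box.pos (c : Box R) : ℕ × ℕ := (c.2.1, c.2.2)

theorem Box.ext_pos {c d : Box R} (h1 : c.1 = d.1) (h2 : c.pos = d.pos) : c = d := by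
  obtain ⟨m, i, j⟩ := c
  obtain ⟨m', i', j'⟩ := d
  simp only at h1
  subst h1
  simp only [Box.pos, Prod.mk.injEq, Fin.val_inj] at h2
  rw [h2.1, h2.2]

theorem mem_boxes (c : Box R) : c ∈ boxes R := by
  simp only [boxes, List.mem_flatMap, List.mem_map]
  exact ⟨c.1, List.mem_finRange _, c.2, mem_facBoxes _, rfl⟩

theorem pairwise_boxes (R : Fin k → ℕ × ℕ) :
    (boxes R).Pairwise fun c d => BoxBefore c.1 c.pos d.1 d.pos := by
  rw [boxes, List.pairwise_flatMap]
  refine ⟨fun m _ => ?_, ?_⟩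
  · rw [List.pairwise_map]
    exact (pairwise_facBoxes _ _).imp fun h => .inr ⟨rfl, h⟩
  · refine (List.pairwise_lt_finRange k).imp fun h x hx y hy => ?_
    simp only [List.mem_map] at hx hy
    obtain ⟨_, _, rfl⟩ := hx
    obtain ⟨_, _, rfl⟩ := hy
    exact .inl h

theorem BoxBefore.asymm {m m' : Fin k} {c c' : ℕ × ℕ} (h : BoxBefore m c m' c') :
    ¬ BoxBefore m' c' m c := by
  rintro (h1 | ⟨rfl, h1⟩) <;> rcases h with h2 | ⟨h3, h2⟩
  · exact lt_asymm h1 h2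
  · exact h1.ne h3.symm
  · exact lt_irrefl _ h2
  · rcases h1 with h1 | h1 <;> rcases h2 with h2 | h2 <;> omega

theorem idxOf_map_lt_iff {α : Type*} {lt : α → α → Prop}
    (hasymm : ∀ a b, lt a b → ¬ lt b a) {l : List α} (hl : l.Pairwise lt) {f : α → ℕ}
    (hf : Function.Injective f) {a b : α} (ha : a ∈ l) (hb : b ∈ l) :
    (l.map f).idxOf (f a) < (l.map f).idxOf (f b) ↔ lt a b := by
  have key : ∀ a ∈ l, ∃ h : (l.map f).idxOf (f a) < l.length, l[(l.map f).idxOf (f a)] = a := by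
    intro a ha
    have h1 : (l.map f).idxOf (f a) < (l.map f).length :=
      List.idxOf_lt_length_of_mem (List.mem_map_of_mem ha)
    have h2 := List.getElem_idxOf h1
    rw [List.getElem_map] at h2
    exact ⟨by simpa using h1, hf h2⟩
  obtain ⟨hi, hi'⟩ := key a ha
  obtain ⟨hj, hj'⟩ := key b hb
  rw [List.pairwise_iff_getElem] at hl
  constructor
  · intro h
    have := hl _ _ hi hj h
    rwa [hi', hj'] at this
  · intro h
    rcases lt_trichotomy ((l.map f).idxOf (f a)) ((l.map f).idxOf (f b)) with h1 | h1 | h1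
    · exact h1
    · have : a = b := by
        rw [← hi', ← hj']
        simp only [h1]
      subst this
      exact absurd h (hasymm _ _ h)
    · have := hl _ _ hj hi h1
      rw [hi', hj'] at this
      exact absurd h (hasymm _ _ this)

theorem pair_sublist_map_iff {α : Type*} {lt : α → α → Prop}
    (hasymm : ∀ a b, lt a b → ¬ lt b a) {l : List α} (hl : l.Pairwise lt) {f : α → ℕ}
    {x y : ℕ} :
    [x, y].Sublist (l.map f) ↔ ∃ a ∈ l, ∃ b ∈ l, f a = x ∧ f b = y ∧ lt a b := by
  constructor
  · intro h
    obtain ⟨l', h1, h2⟩ := List.sublist_map_iff.1 h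
    rcases l' with _ | ⟨a, _ | ⟨b, _ | ⟨_, _⟩⟩⟩
    · simp at h2
    · simp at h2
    · simp only [List.map_cons, List.map_nil, List.cons.injEq, and_true] at h2
      have h3 := hl.sublist h1
      have ha := h1.subset (show a ∈ [a, b] by simp)
      have hb := h1.subset (show b ∈ [a, b] by simp)
      exact ⟨a, ha, b, hb, h2.1.symm, h2.2.symm, by simpa using h3⟩
    · simp at h2
  · rintro ⟨a, ha, b, hb, rfl, rfl, hab⟩
    induction l with
    | nil => simp at ha
    | cons c l ih =>
      rw [List.pairwise_cons] at hl
      rw [List.map_cons]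
      rcases List.mem_cons.1 ha with rfl | ha'
      · rcases List.mem_cons.1 hb with rfl | hb'
        · exact absurd hab (hasymm _ _ hab)
        · exact List.Sublist.cons_cons _ (List.singleton_sublist.2 (List.mem_map_of_mem hb'))
      · rcases List.mem_cons.1 hb with rfl | hb'
        · exact absurd (hl.1 _ ha') (hasymm _ _ hab)
        · exact (ih hl.2 ha' hb').cons _

/-- The position of a letter in the reading word. -/
def place (T : Filling R) (x : ℕ) : ℕ := (rw T).idxOf x

theorem toGrid_eq_some_iff_entry {T : Filling R} {m : Fin k} {c : ℕ × ℕ} {x : ℕ} :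
    toGrid (T m) c = some x ↔ ∃ b : Box R, b.1 = m ∧ b.pos = c ∧ entry T b = x := by
  rw [toGrid_eq_some]
  constructor
  · rintro ⟨h, h'⟩
    exact ⟨⟨m, ⟨c.1, h.1⟩, ⟨c.2, h.2⟩⟩, rfl, rfl, h'⟩
  · rintro ⟨⟨m, i, j⟩, rfl, rfl, h⟩
    exact ⟨⟨i.2, j.2⟩, h⟩

/-- Weight zero elements, in a form that avoids counting. -/
structure IsStd (n : ℕ) (T : Filling R) : Prop where
  mem : T ∈ crystal n R
  inj : ∀ c d, entry T c = entry T d → c = d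
  surj : ∀ x, 1 ≤ x → x ≤ n → ∃ c, entry T c = x

theorem isStd_iff {n : ℕ} {T : Filling R} : IsStd n T ↔ T ∈ crystal n R ∧ IsWeightZero n T := by
  have hnd : (boxes R).Nodup := (pairwise_boxes R).imp (by
    rintro a _ h rfl
    exact h.asymm h)
  constructor
  · intro h
    refine ⟨h.mem, fun x h1 h2 => ?_⟩
    obtain ⟨c, rfl⟩ := h.surj x h1 h2
    exact List.count_eq_one_of_mem (hnd.map fun c d hcd => h.inj c d hcd)
      (List.mem_map_of_mem (mem_boxes c))
  · rintro ⟨h1, h2⟩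
    have hbd : ∀ c, 1 ≤ entry T c ∧ entry T c ≤ n := fun c =>
      ⟨(h1 c.1).pos _ _, (h1 c.1).le _ _⟩
    refine ⟨h1, fun c d hcd => ?_, fun x hx1 hx2 => ?_⟩
    · have h3 : (rw T).Nodup := by
        rw [List.nodup_iff_count_le_one]
        intro x
        by_cases hx : x ∈ rw T
        · obtain ⟨e, -, rfl⟩ := List.mem_map.1 hx
          exact (h2 _ (hbd e).1 (hbd e).2).le
        · rw [List.count_eq_zero_of_not_mem hx]; exact Nat.zero_le _
      exact List.inj_on_of_nodup_map h3 (mem_boxes c) (mem_boxes d) hcd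
    · have := h2 x hx1 hx2
      have h3 : x ∈ rw T := List.count_pos_iff.1 (by omega)
      obtain ⟨c, -, hc⟩ := List.mem_map.1 h3
      exact ⟨c, hc⟩

theorem IsStd.one_le {n : ℕ} {T : Filling R} (h : IsStd n T) (c : Box R) : 1 ≤ entry T c :=
  (h.mem c.1).pos _ _

theorem IsStd.le {n : ℕ} {T : Filling R} (h : IsStd n T) (c : Box R) : entry T c ≤ n :=
  (h.mem c.1).le _ _

theorem IsStd.facStd {n : ℕ} {T : Filling R} (h : IsStd n T) (m : Fin k) : FacStd n (T m) := by
  refine ⟨h.mem m, fun i j i' j' he => ?_⟩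
  have := h.inj ⟨m, i, j⟩ ⟨m, i', j'⟩ he
  simpa using this

theorem IsStd.exists_at {n : ℕ} {T : Filling R} (h : IsStd n T) {x : ℕ} (h1 : 1 ≤ x)
    (h2 : x ≤ n) : ∃ m c, toGrid (T m) c = some x := by
  obtain ⟨c, hc⟩ := h.surj x h1 h2
  exact ⟨c.1, c.pos, toGrid_eq_some_iff_entry.2 ⟨c, rfl, rfl, hc⟩⟩

theorem IsStd.at_unique {n : ℕ} {T : Filling R} (h : IsStd n T) {x : ℕ} {m m' : Fin k}
    {c c' : ℕ × ℕ} (h1 : toGrid (T m) c = some x) (h2 : toGrid (T m') c' = some x) :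
    m = m' ∧ c = c' := by
  obtain ⟨b, rfl, rfl, h3⟩ := toGrid_eq_some_iff_entry.1 h1
  obtain ⟨b', rfl, rfl, h4⟩ := toGrid_eq_some_iff_entry.1 h2
  obtain rfl := h.inj _ _ (h3.trans h4.symm)
  exact ⟨rfl, rfl⟩

theorem IsStd.bounds {n : ℕ} {T : Filling R} (h : IsStd n T) {x : ℕ} {m : Fin k}
    {c : ℕ × ℕ} (h1 : toGrid (T m) c = some x) : 1 ≤ x ∧ x ≤ n := by
  obtain ⟨b, rfl, rfl, h3⟩ := toGrid_eq_some_iff_entry.1 h1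
  rw [← h3]
  exact ⟨h.one_le b, h.le b⟩

theorem IsStd.place_lt_iff {n : ℕ} {T : Filling R} (h : IsStd n T) {x y : ℕ} {m m' : Fin k}
    {c c' : ℕ × ℕ} (h1 : toGrid (T m) c = some x) (h2 : toGrid (T m') c' = some y) :
    place T x < place T y ↔ BoxBefore m c m' c' := by
  obtain ⟨b, rfl, rfl, rfl⟩ := toGrid_eq_some_iff_entry.1 h1
  obtain ⟨b', rfl, rfl, rfl⟩ := toGrid_eq_some_iff_entry.1 h2
  exact idxOf_map_lt_iff (lt := fun c d : Box R => BoxBefore c.1 c.pos d.1 d.pos)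
    (fun _ _ h => h.asymm) (pairwise_boxes R) (fun _ _ h' => h.inj _ _ h')
    (mem_boxes _) (mem_boxes _)

theorem IsStd.place_ne {n : ℕ} {T : Filling R} (h : IsStd n T) {x y : ℕ} (hx1 : 1 ≤ x)
    (hxn : x ≤ n) (hxy : x ≠ y) : place T x ≠ place T y := by
  obtain ⟨c, rfl⟩ := h.surj x hx1 hxn
  intro he
  exact hxy ((List.idxOf_inj (List.mem_map_of_mem (mem_boxes c))).1 he)

theorem IsStd.sublist_iff {n : ℕ} {T : Filling R} (h : IsStd n T) {x y : ℕ} (hx1 : 1 ≤ x)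
    (hxn : x ≤ n) (hy1 : 1 ≤ y) (hyn : y ≤ n) :
    [x, y].Sublist (rw T) ↔ place T x < place T y := by
  rw [rw, pair_sublist_map_iff (lt := fun c d : Box R => BoxBefore c.1 c.pos d.1 d.pos)
    (fun _ _ h => h.asymm) (pairwise_boxes R)]
  constructor
  · rintro ⟨a, -, b, -, rfl, rfl, hab⟩
    exact (h.place_lt_iff (toGrid_eq_some_iff_entry.2 ⟨a, rfl, rfl, rfl⟩)
      (toGrid_eq_some_iff_entry.2 ⟨b, rfl, rfl, rfl⟩)).2 hab
  · intro hlt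
    obtain ⟨a, rfl⟩ := h.surj x hx1 hxn
    obtain ⟨b, rfl⟩ := h.surj y hy1 hyn
    exact ⟨a, mem_boxes _, b, mem_boxes _, rfl, rfl,
      (h.place_lt_iff (toGrid_eq_some_iff_entry.2 ⟨a, rfl, rfl, rfl⟩)
      (toGrid_eq_some_iff_entry.2 ⟨b, rfl, rfl, rfl⟩)).1 hlt⟩

theorem IsStd.mem_classicalDescents {n : ℕ} {T : Filling R} (h : IsStd n T) {i : ℕ} :
    i ∈ classicalDescents n T ↔ 1 ≤ i ∧ i < n ∧ place T (i + 1) < place T i := by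
  simp only [classicalDescents, Set.mem_ofPred_eq]
  constructor
  · rintro ⟨h1, h2, h3⟩
    exact ⟨h1, h2, (h.sublist_iff (by omega) (by omega) h1 h2.le).1 h3⟩
  · rintro ⟨h1, h2, h3⟩
    exact ⟨h1, h2, (h.sublist_iff (by omega) (by omega) h1 h2.le).2 h3⟩

/-! ### Relabelling -/

/-- Apply a function to all entries. -/
def relabel (φ : ℕ → ℕ) (T : Filling R) : Filling R := fun m i j => φ (T m i j)

@[simp] theorem entry_relabel (φ : ℕ → ℕ) (T : Filling R) (c : Box R) :
    entry (relabel φ T) c = φ (entry T c) := rfl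

theorem filling_ext {T T' : Filling R} (h : ∀ c, entry T c = entry T' c) : T = T' := by
  funext m i j
  exact h ⟨m, i, j⟩

theorem toGrid_relabel (φ : ℕ → ℕ) (T : Filling R) (m : Fin k) (c : ℕ × ℕ) :
    toGrid (relabel φ T m) c = (toGrid (T m) c).map φ := by
  simp only [toGrid, relabel]
  split_ifs <;> rfl

theorem place_relabel {T : Filling R} (φ : Equiv.Perm ℕ) (x : ℕ) :
    place (relabel φ T) (φ x) = place T x := by
  have : rw (relabel φ T) = (rw T).map φ := by
    simp only [rw, List.map_map]
    rfl
  rw [place, this, place]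
  generalize rw T = l
  induction l with
  | nil => rfl
  | cons a l ih =>
    by_cases h : a = x
    · simp [h]
    · rw [List.map_cons, List.idxOf_cons_ne _ h,
        List.idxOf_cons_ne _ (fun h' => h (φ.injective h')), ih]

/-! ### Promotion of fillings -/

theorem pr_perm (n : ℕ) (T : Filling R) : ∃ σ : Equiv.Perm (Box R), (∀ c, (σ c).1 = c.1) ∧
    ∀ c, entry (pr n T) c = cyc n (entry T (σ c)) := by
  choose σ hσ using fun m => facPr_perm n (T m)
  exact ⟨Equiv.sigmaCongrRight σ, fun c => rfl, fun c => hσ c.1 c.2.1 c.2.2⟩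

theorem cyc_inj {n x y : ℕ} (hx : 1 ≤ x) (hy : 1 ≤ y) (h : cyc n x = cyc n y) : x = y := by
  simp only [cyc] at h
  split_ifs at h <;> omega

theorem IsStd.pr {n : ℕ} {T : Filling R} (h : IsStd n T) : IsStd n (pr n T) := by
  obtain ⟨σ, -, hσ⟩ := pr_perm n T
  refine ⟨fun m => (h.facStd m).facPr.ssyt, fun c d hcd => ?_, fun x h1 h2 => ?_⟩
  · rw [hσ, hσ] at hcd
    exact σ.injective (h.inj _ _ (cyc_inj (h.one_le _) (h.one_le _) hcd))
  · by_cases hx : x = 1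
    · obtain ⟨c, hc⟩ := h.surj n (by omega) le_rfl
      exact ⟨σ.symm c, by rw [hσ, Equiv.apply_symm_apply, hc, cyc, if_pos rfl, hx]⟩
    · obtain ⟨c, hc⟩ := h.surj (x - 1) (by omega) (by omega)
      exact ⟨σ.symm c, by rw [hσ, Equiv.apply_symm_apply, hc, cyc, if_neg (by omega)]; omega⟩

/-- Promotion permutes boxes and acts cyclically on letters, so standardness can be pulled back to
any semistandard preimage, such as one chosen by `prInv`. -/
theorem IsStd.of_pr {n : ℕ} {T : Filling R} (h : IsStd n (KR.pr n T)) (hT : T ∈ crystal n R) :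
    IsStd n T := by
  obtain ⟨σ, -, hσ⟩ := pr_perm n T
  have hbd : ∀ c, 1 ≤ entry T c := fun c => (hT c.1).pos _ _
  refine ⟨hT, fun c d hcd => ?_, fun x h1 h2 => ?_⟩
  · have := h.inj (σ.symm c) (σ.symm d) (by simp [hσ, hcd])
    exact σ.symm.injective this
  · obtain ⟨c, hc⟩ := h.surj (cyc n x) (by rw [cyc]; split_ifs <;> omega)
      (by rw [cyc]; split_ifs <;> omega)
    rw [hσ] at hc
    exact ⟨σ c, cyc_inj (hbd _) h1 hc⟩

theorem IsStd.pr_inj {n : ℕ} {T T' : Filling R} (h : IsStd n T) (h' : IsStd n T')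
    (he : KR.pr n T = KR.pr n T') : T = T' :=
  funext fun m => facPr_injective (h.facStd m) (h'.facStd m) (congrFun he m)

/-- Promotion is an injective self-map of the finite set of standard fillings. -/
theorem IsStd.exists_pr_eq {n : ℕ} {T : Filling R} (h : IsStd n T) :
    ∃ T', IsStd n T' ∧ KR.pr n T' = T := by
  let F : {T : Filling R // IsStd n T} → {T : Filling R // IsStd n T} :=
    fun T => ⟨KR.pr n T.1, T.2.pr⟩
  have hF : Function.Injective F := fun T T' he =>
    Subtype.ext (T.2.pr_inj T'.2 (congrArg Subtype.val he))
  have : Finite {T : Filling R // IsStd n T} := by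
    let G : {T : Filling R // IsStd n T} → (Box R → Fin (n + 1)) :=
      fun T c => ⟨entry T.1 c, Nat.lt_succ_of_le (T.2.le c)⟩
    refine Finite.of_injective G fun T T' he => Subtype.ext (filling_ext fun c => ?_)
    exact congrArg Fin.val (congrFun he c)
  obtain ⟨T', hT'⟩ := Finite.surjective_of_injective hF ⟨T, h⟩
  exact ⟨T'.1, T'.2, congrArg Subtype.val hT'⟩

/-- Only that `prInv` picks some preimage in the crystal; that it is the expected one has to be
argued each time. -/
theorem prInv_spec {n : ℕ} {T : Filling R} (h : T ∈ crystal n R) :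
    prInv n (pr n T) ∈ crystal n R ∧ pr n (prInv n (pr n T)) = pr n T := by
  have hex : ∃ a ∈ crystal n R, pr n a = pr n T := ⟨T, h, rfl⟩
  exact ⟨Function.invFunOn_mem hex, Function.invFunOn_eq hex⟩

theorem IsStd.prInv_pr {n : ℕ} {T : Filling R} (h : IsStd n T) : prInv n (KR.pr n T) = T := by
  obtain ⟨h1, h2⟩ := prInv_spec h.mem
  refine IsStd.pr_inj (.of_pr ?_ h1) h h2
  rw [h2]
  exact h.pr

/-- Keeps track only of the factor containing a letter; the case `x = 0` covers the `n` that becomes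
`1`. -/
theorem at_pr_succ {n : ℕ} {T : Filling R} {x : ℕ} (hx : x < n)
    {m : Fin k} : (∃ c, toGrid (KR.pr n T m) c = some (x + 1)) ↔
      (∃ c, toGrid (T m) c = some x) ∨ x = 0 ∧ ∃ c, toGrid (T m) c = some n := by
  obtain ⟨σ, hσm, hσ⟩ := pr_perm n T
  constructor
  · rintro ⟨c, hc⟩
    obtain ⟨b, rfl, -, hb⟩ := toGrid_eq_some_iff_entry.1 hc
    rw [hσ, cyc] at hb
    split_ifs at hb with hbn
    · exact .inr ⟨by omega, (σ b).pos, toGrid_eq_some_iff_entry.2 ⟨σ b, hσm b, rfl, hbn⟩⟩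
    · exact .inl ⟨(σ b).pos, toGrid_eq_some_iff_entry.2 ⟨σ b, hσm b, rfl, by omega⟩⟩
  · rintro (⟨c, hc⟩ | ⟨rfl, c, hc⟩) <;> obtain ⟨b, rfl, -, hb⟩ := toGrid_eq_some_iff_entry.1 hc
    · refine ⟨(σ.symm b).pos, toGrid_eq_some_iff_entry.2 ⟨σ.symm b, ?_, rfl, ?_⟩⟩
      · rw [← hσm, Equiv.apply_symm_apply]
      · rw [hσ, Equiv.apply_symm_apply, hb, cyc, if_neg (by omega)]
    · refine ⟨(σ.symm b).pos, toGrid_eq_some_iff_entry.2 ⟨σ.symm b, ?_, rfl, ?_⟩⟩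
      · rw [← hσm, Equiv.apply_symm_apply]
      · rw [hσ, Equiv.apply_symm_apply, hb, cyc, if_pos rfl]

theorem at_pr (n : ℕ) {T : Filling R} {x : ℕ} (hx : x < n)
    {m : Fin k} {c : ℕ × ℕ} (hc : toGrid (T m) c = some x) :
    ∃ c, toGrid (KR.pr n T m) c = some (x + 1) := (KR.at_pr_succ hx).2 (.inl ⟨c, hc⟩)

theorem at_pr_one (n : ℕ) {T : Filling R} (hn : 0 < n)
    {m : Fin k} {c : ℕ × ℕ} (hc : toGrid (T m) c = some n) :
    ∃ c, toGrid (KR.pr n T m) c = some 1 := (KR.at_pr_succ (x := 0) hn).2 (.inr ⟨rfl, c, hc⟩)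

theorem FacStd.readBefore_iff {n r s : ℕ} {t : Fac r s} (h : FacStd n t) {p q : ℕ × ℕ} {x y : ℕ}
    (hp : toGrid t p = some x) (hq : toGrid t q = some y) (hxy : x < y) :
    ReadBefore q p ↔ p.1 < q.1 := by
  refine ⟨?_, .inl⟩
  rintro (h1 | ⟨h1, h2⟩)
  · exact h1
  · obtain ⟨h3, rfl⟩ := toGrid_eq_some.1 hp
    obtain ⟨h4, rfl⟩ := toGrid_eq_some.1 hq
    have := h.lt (i := ⟨q.1, h4.1⟩) (j := ⟨q.2, h4.2⟩) (i' := ⟨p.1, h3.1⟩) (j' := ⟨p.2, h3.2⟩)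
      h1.le h2.le (by simp only [Fin.mk.injEq]; omega)
    omega

/-- Promotion shifts descents. -/
theorem IsStd.descent_pr {n : ℕ} {T : Filling R} (h : IsStd n T) {i : ℕ} (h1 : 1 ≤ i)
    (h2 : i + 1 < n) : place (KR.pr n T) (i + 2) < place (KR.pr n T) (i + 1) ↔
      place T (i + 1) < place T i := by
  obtain ⟨m, p, hp⟩ := h.exists_at h1 (by omega)
  obtain ⟨m', q, hq⟩ := h.exists_at (x := i + 1) (by omega) (by omega)
  obtain ⟨p', hp'⟩ := at_pr n (by omega) hp
  obtain ⟨q', hq'⟩ := at_pr n h2 hq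
  rw [h.place_lt_iff hq hp, h.pr.place_lt_iff hq' hp']
  by_cases hm : m = m'
  · subst hm
    simp only [BoxBefore, lt_irrefl, true_and, false_or]
    rw [(h.facStd m).readBefore_iff hp hq (by omega),
      (h.pr.facStd m).readBefore_iff hp' hq' (by omega)]
    exact ((h.facStd m).facPr_row_lt h2 hp hq hp' hq').symm
  · simp [BoxBefore, Ne.symm hm]

/-- Here `n` passes through the value 1, so `IsStd.descent_pr` does not apply. Within one factor,
`n` is below `n - 1` exactly if `n - 1` is not in the last row, and then the second slide ends below
the origin, where it leaves the letter 2. -/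
theorem IsStd.descent_pr_pr {n : ℕ} {T : Filling R} (h : IsStd n T) (hn : 3 ≤ n) :
    place (KR.pr n (KR.pr n T)) 2 < place (KR.pr n (KR.pr n T)) 1 ↔
      place T n < place T (n - 1) := by
  obtain ⟨m, p, hp⟩ := h.exists_at (x := n - 1) (by omega) (by omega)
  obtain ⟨m', q, hq⟩ := h.exists_at (x := n) (by omega) (by omega)
  obtain ⟨p', hp'⟩ := at_pr n (by omega) hp
  obtain ⟨q', hq'⟩ := at_pr_one n (by omega) hq
  obtain ⟨p'', hp''⟩ := at_pr_one n (by omega) (show toGrid _ p' = some n by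
    rw [hp']; congr 1; omega)
  obtain ⟨q'', hq''⟩ := at_pr n (by omega) hq'
  rw [h.place_lt_iff hq hp, h.pr.pr.place_lt_iff hq'' hp'']
  by_cases hm : m = m'
  · subst hm
    simp only [BoxBefore, lt_irrefl, true_and, false_or]
    rw [(h.facStd m).readBefore_iff hp hq (by omega),
      (h.pr.pr.facStd m).readBefore_iff hp'' hq'' (by omega)]
    obtain ⟨g₁, g₂, d, k₁, k₂, H⟩ := (h.facStd m).exists_twoSlides ⟨q, hq⟩ ⟨p, hp⟩ (by omega)
    have hqc := (H.corner q).1 hq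
    have hm := H.start.mem
    simp only at hm
    have hQ := H.facPr_facPr
    have hd : d = (0, 1) ∨ d = (1, 0) := by
      by_cases hrow : p.1 = (R m).1 - 1
      · exact .inl (H.right ⟨p, hp, hrow⟩)
      · exact .inr (H.below ⟨p, hp, hrow⟩)
    have hdm := H.punctured₂.mem
    have hp0 : p'' = (0, 0) := by
      have h0 : toGrid (KR.pr n (KR.pr n T) m) (0, 0) = some 1 :=
        toGrid_eq_some.2 ⟨⟨by simp only; omega, by simp only; omega⟩,
          (hQ ⟨0, _⟩ ⟨0, _⟩).trans (by simp)⟩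
      exact (h.pr.pr.at_unique hp'' h0).2
    have hqd : q'' = d := by
      have h0 : toGrid (KR.pr n (KR.pr n T) m) d = some 2 := by
        refine toGrid_eq_some.2 ⟨hdm, (hQ ⟨d.1, _⟩ ⟨d.2, _⟩).trans ?_⟩
        rcases hd with rfl | rfl <;> simp
      exact (h.pr.pr.at_unique hq'' h0).2
    rw [hqd, hp0, hqc]
    by_cases hrow : p.1 = (R m).1 - 1
    · rw [H.right ⟨p, hp, hrow⟩]
      simp [hrow]
    · rw [H.below ⟨p, hp, hrow⟩]
      have := (toGrid_eq_some.1 hp).1.1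
      simp only [zero_lt_one, true_iff]
      omega
  · simp [BoxBefore, Ne.symm hm]

theorem IsStd.pr_relabel {n : ℕ} {T : Filling R} (h : IsStd n T) {φ : ℕ → ℕ}
    (hφ : StrictMonoOn φ (Set.Icc 2 (n - 1))) (hn : ∀ x, 1 ≤ x → x ≤ n → (φ x = n ↔ x = n)) :
    KR.pr n (relabel φ T) =
      relabel (fun x => if x = 1 then 1 else φ (x - 1) + 1) (KR.pr n T) :=
  funext fun m => (h.facStd m).facPr_comp hφ hn

/-- On `[2, n - 1]` the transposition of 1 and 2 only lowers 2 to 1, so it is still strictly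
monotone there. -/
theorem IsStd.pr_swap_one {n : ℕ} {T : Filling R} (h : IsStd n T) (hn : 3 ≤ n) :
    KR.pr n (relabel (Equiv.swap 1 2) T) = relabel (Equiv.swap 2 3) (KR.pr n T) := by
  rw [h.pr_relabel]
  · refine filling_ext fun c => ?_
    have h1 := h.pr.one_le c
    simp only [entry_relabel, Equiv.swap_apply_def]
    split_ifs <;> omega
  · rintro x ⟨hx1, hx2⟩ y ⟨hy1, hy2⟩ hxy
    simp only [Equiv.swap_apply_def]
    split_ifs <;> omega
  · intro x h1 h2
    simp only [Equiv.swap_apply_def]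
    split_ifs <;> omega

theorem pr_of_forall_ne {n : ℕ} {T : Filling R} (h : ∀ c, entry T c ≠ n) :
    pr n T = relabel (· + 1) T :=
  funext fun m => facPr_of_forall_ne fun i j => h ⟨m, i, j⟩

theorem facPr_facPr_of_forall_ne {n r s : ℕ} {t : Fac r s}
    (hn : 2 ≤ n) (h1 : ∀ i j, t i j ≠ n - 1) :
    KR.facPr n (KR.facPr n t) = fun i j => KR.facPr n t i j + 1 := by
  refine facPr_of_forall_ne fun i j => ?_
  obtain ⟨σ, hσ⟩ := facPr_perm n t
  rw [hσ, cyc]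
  have := h1 (σ (i, j)).1 (σ (i, j)).2
  split_ifs <;> omega

/-- Since both fillings are standard, `n - 1` and `n` lie in different factors. In each factor there
is at most one slide, and swapping the letters only changes in which of the two promotions it takes
place. -/
theorem IsStd.pr_pr_swap {n : ℕ} {T : Filling R} (h : IsStd n T) (hn : 3 ≤ n)
    (h' : IsStd n (relabel (Equiv.swap (n - 1) n) T)) :
    KR.pr n (KR.pr n (relabel (Equiv.swap (n - 1) n) T)) =
      relabel (Equiv.swap 1 2) (KR.pr n (KR.pr n T)) := by
  funext m
  -- In a common factor both letters would have to occupy the outer corner, `n` before and `n - 1`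
  -- after the swap.
  have hdisj : (∃ c, toGrid (T m) c = some n) → (∃ c, toGrid (T m) c = some (n - 1)) → False := by
    rintro ⟨p, hp⟩ ⟨q, hq⟩
    have h1 := (h.facStd m).eq_corner hp
    have h2 := (h'.facStd m).eq_corner (c := q) (by rw [toGrid_relabel, hq]; simp)
    rw [h1] at hp
    rw [h2, hp] at hq
    simp at hq
    omega
  change facPr n (facPr n _) = fun i j => Equiv.swap 1 2 (facPr n (facPr n (T m)) i j)
  by_cases hn1 : ∃ c, toGrid (T m) c = some n
  · have h1 : ∀ i j, T m i j ≠ n - 1 := fun i j hij => hdisj hn1 ⟨(i, j), by simp [hij]⟩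
    rw [← (h.facStd m).facPr_facPr_pred (by omega) hn1 h1]
    congr 2
    funext i j
    have := h1 i j
    simp only [relabel, Equiv.swap_apply_def]
    split_ifs <;> omega
  · have h1 : ∀ i j, T m i j ≠ n := fun i j hij => hn1 ⟨(i, j), by simp [hij]⟩
    by_cases hn2 : ∃ c, toGrid (T m) c = some (n - 1)
    · have h2 : ∃ c, toGrid (relabel (Equiv.swap (n - 1) n) T m) c = some n := by
        obtain ⟨c, hc⟩ := hn2
        exact ⟨c, by rw [toGrid_relabel, hc]; simp⟩
      have h3 : ∀ i j, relabel (Equiv.swap (n - 1) n) T m i j ≠ n - 1 := by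
        intro i j
        have := h1 i j
        simp only [relabel, Equiv.swap_apply_def]
        split_ifs <;> omega
      have h4 := (h'.facStd m).facPr_facPr_pred (by omega) h2 h3
      have h5 : (fun i j => if relabel (Equiv.swap (n - 1) n) T m i j = n then n - 1 else
          relabel (Equiv.swap (n - 1) n) T m i j) = T m := by
        funext i j
        have := h1 i j
        simp only [relabel, Equiv.swap_apply_def]
        split_ifs <;> omega
      rw [h5] at h4
      rw [h4]
      simp
    · have h2 : ∀ i j, T m i j ≠ n - 1 := fun i j hij => hn2 ⟨(i, j), by simp [hij]⟩
      have h3 : relabel (Equiv.swap (n - 1) n) T m = T m := by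
        funext i j
        exact Equiv.swap_apply_of_ne_of_ne (h2 i j) (h1 i j)
      rw [h3, facPr_facPr_of_forall_ne (by omega) h2, facPr_of_forall_ne h1]
      funext i j
      have := (h.facStd m).ssyt.pos i j
      beta_reduce
      rw [Equiv.swap_apply_of_ne_of_ne] <;> omega

/-- The image under promotion of a tableau in which `n` occurs twice. -/
theorem IsStd.pr_relabel_pred {n : ℕ} {T : Filling R} (h : IsStd n T) (hn : 3 ≤ n)
    (hD : place T (n - 1) < place T n) :
    relabel (· + 1) (KR.pr n (relabel (fun x => if x = n - 1 then n else x) T)) =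
      relabel (fun x => if x = 1 then 2 else x) (KR.pr n (KR.pr n T)) := by
  funext m
  change (fun i j => facPr n _ i j + 1) = fun i j => if facPr n (facPr n (T m)) i j = 1 then 2 else
    facPr n (facPr n (T m)) i j
  by_cases hn2 : ∃ c, toGrid (T m) c = some (n - 1)
  · by_cases hn1 : ∃ c, toGrid (T m) c = some n
    · obtain ⟨p, hp⟩ := hn2
      obtain ⟨q, hq⟩ := hn1
      have h1 : ¬ place T n < place T (n - 1) := by omega
      rw [h.place_lt_iff hq hp, BoxBefore, not_or] at h1
      have h2 : ¬ ReadBefore q p := fun h2 => h1.2 ⟨rfl, h2⟩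
      rw [(h.facStd m).readBefore_iff hp hq (by omega)] at h2
      have h3 := (h.facStd m).eq_corner hq
      have h4 := (toGrid_eq_some.1 hp).1.1
      have h5 : p.1 = (R m).1 - 1 := by
        rw [h3] at h2
        simp only at h2
        omega
      funext i j
      exact (h.facStd m).facPr_pred_succ (by omega) ⟨q, hq⟩ ⟨p, hp, h5⟩ i j
    · have h1 : ∀ i j, T m i j ≠ n := fun i j hij => hn1 ⟨(i, j), by simp [hij]⟩
      -- This tableau contains `n` but not `n - 1`, and lowering its `n` gives back `T m`; so the
      -- comparison of double promotions applies to it, in the reverse direction.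
      set x : Fac (R m).1 (R m).2 := relabel (fun x => if x = n - 1 then n else x) T m with hx
      have hxv : ∀ i j, x i j = if T m i j = n - 1 then n else T m i j := fun i j => rfl
      have hle : ∀ i j, T m i j ≤ n := (h.facStd m).ssyt.le
      have hxs : FacStd n x := by
        refine ⟨⟨fun i j => ?_, fun i j => ?_, fun i j j' hj => ?_, fun i i' j hi => ?_⟩, ?_⟩
        · have := (h.facStd m).ssyt.pos i j
          rw [hxv]; split_ifs <;> omega
        · have := hle i j
          rw [hxv]; split_ifs <;> omega
        · have := (h.facStd m).ssyt.row_weak i j j' hj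
          have := hle i j
          have := hle i j'
          have := h1 i j'
          rw [hxv, hxv]; split_ifs <;> omega
        · have := (h.facStd m).ssyt.col_strict i i' j hi
          have := hle i j
          have := hle i' j
          have := h1 i' j
          rw [hxv, hxv]; split_ifs <;> omega
        · intro i j i' j' he
          refine (h.facStd m).inj _ _ _ _ ?_
          have := h1 i j
          have := h1 i' j'
          rw [hxv, hxv] at he
          split_ifs at he <;> omega
      have hxn : ∃ c, toGrid x c = some n := by
        obtain ⟨c, hc⟩ := hn2
        exact ⟨c, by rw [hx, toGrid_relabel, hc]; simp⟩
      have hxp : ∀ i j, x i j ≠ n - 1 := by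
        intro i j
        rw [hxv]
        split_ifs <;> omega
      have h2 := hxs.facPr_facPr_pred (by omega) hxn hxp
      have h3 : (fun i j => if x i j = n then n - 1 else x i j) = T m := by
        funext i j
        have := h1 i j
        rw [hxv]
        split_ifs <;> omega
      rw [h3, facPr_facPr_of_forall_ne (by omega) hxp] at h2
      rw [h2]
      funext i j
      have := hxs.facPr.ssyt.pos i j
      simp only [Equiv.swap_apply_def]
      split_ifs <;> omega
  · have h2 : ∀ i j, T m i j ≠ n - 1 := fun i j hij => hn2 ⟨(i, j), by simp [hij]⟩
    have h3 : relabel (fun x => if x = n - 1 then n else x) T m = T m := by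
      funext i j
      exact if_neg (h2 i j)
    rw [h3, facPr_facPr_of_forall_ne (by omega) h2]
    funext i j
    have := (h.facStd m).facPr.ssyt.pos i j
    beta_reduce
    rw [if_neg (by omega)]

/-! ### Positions of small letters -/

theorem FacStd.grid_lt {n r s : ℕ} {t : Fac r s} (h : FacStd n t) {p q : ℕ × ℕ} {x y : ℕ}
    (hp : toGrid t p = some x) (hq : toGrid t q = some y) (hle : p ≤ q) (hne : p ≠ q) :
    x < y := by
  obtain ⟨h1, rfl⟩ := toGrid_eq_some.1 hp
  obtain ⟨h2, rfl⟩ := toGrid_eq_some.1 hq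
  refine h.lt (i := ⟨p.1, h1.1⟩) (j := ⟨p.2, h1.2⟩) (i' := ⟨q.1, h2.1⟩) (j' := ⟨q.2, h2.2⟩)
    hle.1 hle.2 fun h3 => hne (Prod.ext ?_ ?_)
  · simpa using h3.1
  · simpa using h3.2

theorem FacStd.grid_inj {n r s : ℕ} {t : Fac r s} (h : FacStd n t) {p q : ℕ × ℕ} {x : ℕ}
    (hp : toGrid t p = some x) (hq : toGrid t q = some x) : p = q := by
  obtain ⟨h1, h2⟩ := toGrid_eq_some.1 hp
  obtain ⟨h3, h4⟩ := toGrid_eq_some.1 hq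
  have h5 := h.inj _ _ _ _ (h2.trans h4.symm)
  simp only [Fin.mk.injEq] at h5
  exact Prod.ext h5.1 h5.2

theorem exists_toGrid_of_le {r s : ℕ} {t : Fac r s} {p q : ℕ × ℕ} {y : ℕ}
    (hq : toGrid t q = some y) (hle : p ≤ q) : ∃ x, toGrid t p = some x := by
  obtain ⟨h1, -⟩ := toGrid_eq_some.1 hq
  exact ⟨_, toGrid_eq_some.2 ⟨⟨hle.1.trans_lt h1.1, hle.2.trans_lt h1.2⟩, rfl⟩⟩

theorem FacStd.pos_of_toGrid {n r s : ℕ} {t : Fac r s} (h : FacStd n t) {p : ℕ × ℕ} {x : ℕ}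
    (hp : toGrid t p = some x) : 1 ≤ x := by
  obtain ⟨h1, rfl⟩ := toGrid_eq_some.1 hp
  exact h.ssyt.pos _ _

theorem FacStd.eq_origin {n r s : ℕ} {t : Fac r s} (h : FacStd n t) {p : ℕ × ℕ}
    (hp : toGrid t p = some 1) : p = (0, 0) := by
  by_contra hne
  have hle : ((0, 0) : ℕ × ℕ) ≤ p := ⟨Nat.zero_le _, Nat.zero_le _⟩
  obtain ⟨x, hx⟩ := exists_toGrid_of_le hp hle
  have h1 := h.grid_lt hx hp hle (Ne.symm hne)
  have h2 := h.pos_of_toGrid hx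
  omega

/-- Consecutive letters in comparable boxes are not separated in the reading word by the letter
before or after them. -/
theorem FacStd.not_le_of_between {n r s : ℕ} {t : Fac r s} (h : FacStd n t) {p q c : ℕ × ℕ}
    {x z : ℕ} (hp : toGrid t p = some x) (hq : toGrid t q = some (x + 1))
    (hc : toGrid t c = some z) (hz : z + 1 = x ∨ z = x + 2)
    (hb : ReadBefore p c ∧ ReadBefore c q ∨ ReadBefore q c ∧ ReadBefore c p) : ¬ p ≤ q := by
  intro hle
  -- No letter fits between `x` and `x + 1`, so comparable boxes carrying them are adjacent.
  have hmid : ∀ d, p ≤ d → d ≤ q → d = p ∨ d = q := by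
    intro d h1 h2
    by_contra! hne
    obtain ⟨w, hw⟩ := exists_toGrid_of_le hq h2
    have := h.grid_lt hp hw h1 hne.1.symm
    have := h.grid_lt hw hq h2 hne.2
    omega
  obtain ⟨a, b⟩ := p
  obtain ⟨a', b'⟩ := q
  obtain ⟨u, v⟩ := c
  simp only [Prod.mk_le_mk] at hle
  simp only [ReadBefore] at hb
  have h1 := hmid (a, b') (by simp [hle.2]) (by simp [hle.1])
  simp only [Prod.mk.injEq, true_and, and_true] at h1
  rcases h1 with rfl | rfl
  · have h2 : a' ≤ a + 1 := by
      by_contra h2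
      have := hmid (a + 1, b') (by simp) (by simp; omega)
      simp only [Prod.mk.injEq, and_true] at this
      omega
    -- In the vertical case, the fourth vertex of the rectangle spanned by the two adjacent boxes
    -- and `c` would have to carry `x + 1` or `x` a second time. In the horizontal case nothing is
    -- read in between.
    have h3 : a' = u ∧ b' < v ∨ a = u ∧ v < b' := by omega
    rcases h3 with ⟨rfl, h3⟩ | ⟨rfl, h3⟩
    · have hz' := h.grid_lt hq hc (by simp; omega) (by simp; omega)
      have h4 : a < a' := by omega
      obtain ⟨w, hw⟩ := exists_toGrid_of_le (p := (a, v)) hc (by simp; omega)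
      have h5 := h.grid_lt hp hw (by simp; omega) (by simp; omega)
      have h6 := h.grid_lt hw hc (by simp; omega) (by simp; omega)
      obtain rfl : w = x + 1 := by omega
      have := h.grid_inj hw hq
      simp only [Prod.mk.injEq] at this
      omega
    · have hz' := h.grid_lt hc hp (by simp; omega) (by simp; omega)
      have h4 : a < a' := by omega
      obtain ⟨w, hw⟩ := exists_toGrid_of_le (p := (a', v)) hq (by simp; omega)
      have h5 := h.grid_lt hc hw (by simp; omega) (by simp; omega)
      have h6 := h.grid_lt hw hq (by simp; omega) (by simp; omega)
      obtain rfl : w = x := by omega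
      have := h.grid_inj hw hp
      simp only [Prod.mk.injEq] at this
      omega
  · have h2 : b' ≤ b + 1 := by
      by_contra h2
      have := hmid (a, b + 1) (by simp) (by simp; omega)
      simp only [Prod.mk.injEq, true_and] at this
      omega
    omega

/-- If the letters `2`, `1`, `3` appear in this order in a standard rectangle, they form a hook. -/
theorem FacStd.hook {n r s : ℕ} {t : Fac r s} (h : FacStd n t) {p q c : ℕ × ℕ}
    (hp : toGrid t p = some 1) (hq : toGrid t q = some 2) (hc : toGrid t c = some 3)
    (h1 : ReadBefore q p) (h2 : ReadBefore q c) : q = (1, 0) ∧ c = (0, 1) := by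
  obtain rfl := h.eq_origin hp
  have hq1 : q = (1, 0) := by
    obtain ⟨a, b⟩ := q
    simp only [ReadBefore] at h1
    obtain ⟨w, hw⟩ := exists_toGrid_of_le (p := (a - 1, b)) hq (by simp)
    have h3 := h.grid_lt hw hq (by simp) (by simp; omega)
    have h4 := h.pos_of_toGrid hw
    obtain rfl : w = 1 := by omega
    have := h.grid_inj hw hp
    simp only [Prod.mk.injEq] at this ⊢
    omega
  subst hq1
  refine ⟨rfl, ?_⟩
  obtain ⟨a, b⟩ := c
  have hne0 : (a, b) ≠ (0, 0) := by
    intro h3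
    rw [h3, hp] at hc
    simp at hc
  simp only [ReadBefore] at h2
  have hb : 0 < b := by
    by_contra hb
    obtain rfl : b = 0 := by omega
    simp only [ne_eq, Prod.mk.injEq, and_true] at hne0
    omega
  have hle : ((a, b - 1) : ℕ × ℕ) ≤ (a, b) := by simp
  obtain ⟨w, hw⟩ := exists_toGrid_of_le hc hle
  have h3 := h.grid_lt hw hc hle (by simp; omega)
  have h4 := h.pos_of_toGrid hw
  obtain rfl | rfl : w = 1 ∨ w = 2 := by omega
  · have := h.grid_inj hw hp
    simp only [Prod.mk.injEq] at this ⊢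
    omega
  · have h5 := h.grid_inj hw hq
    simp only [Prod.mk.injEq] at h5
    obtain ⟨rfl, h5⟩ := h5
    have hle : ((0, b) : ℕ × ℕ) ≤ (1, b) := by simp
    obtain ⟨w, hw'⟩ := exists_toGrid_of_le hc hle
    have h6 := h.grid_lt hw' hc hle (by simp)
    have h7 := h.pos_of_toGrid hw'
    obtain rfl | rfl : w = 1 ∨ w = 2 := by omega
    · have := h.grid_inj hw' hp
      simp only [Prod.mk.injEq] at this ⊢
      omega
    · have := h.grid_inj hw' hq
      simp at this

/-! ### Swapping consecutive letters -/

/-- Exchange the letters `i` and `i + 1`. -/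
abbrev sw (i : ℕ) (T : Filling R) : Filling R := relabel (Equiv.swap i (i + 1)) T

theorem sw_sw (i : ℕ) (T : Filling R) : sw i (sw i T) = T :=
  filling_ext fun c => by simp

theorem place_sw_left (i : ℕ) (T : Filling R) : place (sw i T) i = place T (i + 1) := by
  have := place_relabel (T := T) (Equiv.swap i (i + 1)) (i + 1)
  rwa [Equiv.swap_apply_right] at this

theorem place_sw_right (i : ℕ) (T : Filling R) : place (sw i T) (i + 1) = place T i := by
  have := place_relabel (T := T) (Equiv.swap i (i + 1)) i
  rwa [Equiv.swap_apply_left] at this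

theorem place_sw_of_ne {i x : ℕ} (h1 : x ≠ i) (h2 : x ≠ i + 1) (T : Filling R) :
    place (sw i T) x = place T x := by
  have := place_relabel (T := T) (Equiv.swap i (i + 1)) x
  rwa [Equiv.swap_apply_of_ne_of_ne h1 h2] at this

theorem IsStd.sw {n i : ℕ} {T : Filling R} (h : IsStd n T) (h1 : 1 ≤ i) (hi : i < n)
    (hle : ∀ m p q, toGrid (T m) p = some i → toGrid (T m) q = some (i + 1) → ¬ p ≤ q) :
    IsStd n (sw i T) := by
  have hlt : ∀ m a b a' b', a ≤ a' → b ≤ b' → ¬ (a = a' ∧ b = b') →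
      Equiv.swap i (i + 1) (T m a b) < Equiv.swap i (i + 1) (T m a' b') := by
    intro m a b a' b' ha hb hne
    have h2 := (h.facStd m).lt ha hb hne
    have h3 : ¬ (T m a b = i ∧ T m a' b' = i + 1) := fun h3 =>
      hle m (a, b) (a', b') (toGrid_eq_some.2 ⟨⟨a.2, b.2⟩, h3.1⟩)
        (toGrid_eq_some.2 ⟨⟨a'.2, b'.2⟩, h3.2⟩) ⟨ha, hb⟩
    simp only [Equiv.swap_apply_def]
    split_ifs <;> omega
  refine ⟨fun m => ⟨fun a b => ?_, fun a b => ?_, fun a b b' hb => ?_, fun a a' b ha => ?_⟩,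
    fun c d hcd => h.inj _ _ ((Equiv.swap i (i + 1)).injective hcd), fun x hx1 hx2 => ?_⟩
  · have := h.one_le ⟨m, a, b⟩
    simp only [entry] at this
    simp only [relabel, Equiv.swap_apply_def]
    split_ifs <;> omega
  · have := h.le ⟨m, a, b⟩
    simp only [entry] at this
    simp only [relabel, Equiv.swap_apply_def]
    split_ifs <;> omega
  · exact (hlt m a b a b' le_rfl hb.le (by simp [hb.ne])).le
  · exact hlt m a b a' b ha.le le_rfl (by simp [ha.ne])
  · obtain ⟨c, hc⟩ := h.surj (Equiv.swap i (i + 1) x)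
      (by simp only [Equiv.swap_apply_def]; split_ifs <;> omega)
      (by simp only [Equiv.swap_apply_def]; split_ifs <;> omega)
    exact ⟨c, by rw [entry_relabel, hc, Equiv.swap_apply_self]⟩

theorem IsStd.sw_of_ne {n i : ℕ} {T : Filling R} (h : IsStd n T) (h1 : 1 ≤ i) (hi : i < n)
    {m m' : Fin k} {p q : ℕ × ℕ} (hp : toGrid (T m) p = some i)
    (hq : toGrid (T m') q = some (i + 1)) (hne : m ≠ m') : IsStd n (KR.sw i T) :=
  h.sw h1 hi fun _ _ _ hp' hq' =>
    absurd ((h.at_unique hp hp').1.trans (h.at_unique hq hq').1.symm) hne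

/-- In a common factor both 1 and 2 would have to be at the origin, one before and one after the
swap. -/
theorem IsStd.ne_of_sw_one {n : ℕ} {T : Filling R} (h : IsStd n T) (h' : IsStd n (KR.sw 1 T))
    {m m' : Fin k} {p q : ℕ × ℕ} (hp : toGrid (T m) p = some 1)
    (hq : toGrid (T m') q = some 2) : m ≠ m' := by
  rintro rfl
  have h1 := (h.facStd m).eq_origin hp
  have h2 := (h'.facStd m).eq_origin (p := q) (by rw [toGrid_relabel, hq]; rfl)
  rw [h1, ← h2, hq] at hp
  simp at hp

/-- The letter `y` is strictly between `x` and `z` in the reading word. -/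
def Between (T : Filling R) (x y z : ℕ) : Prop :=
  place T x < place T y ∧ place T y < place T z ∨ place T z < place T y ∧ place T y < place T x

/-- Elementary dual equivalence on the letters `i`, `i + 1`, `i + 2`. -/
def DualStep (i : ℕ) (T T' : Filling R) : Prop :=
  T' = sw i T ∧ Between T i (i + 2) (i + 1) ∨ T' = sw (i + 1) T ∧ Between T (i + 1) i (i + 2)

theorem DualStep.symm {i : ℕ} {T T' : Filling R} (h : DualStep i T T') : DualStep i T' T := by
  rcases h with ⟨rfl, h⟩ | ⟨rfl, h⟩
  · refine .inl ⟨(sw_sw _ _).symm, ?_⟩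
    rw [Between, place_sw_left, place_sw_right, place_sw_of_ne (by omega) (by omega)]
    exact h.symm
  · refine .inr ⟨(sw_sw _ _).symm, ?_⟩
    rw [Between, place_sw_left, place_sw_right (i + 1), place_sw_of_ne (by omega) (by omega)]
    exact h.symm

theorem IsStd.not_le_of_between {n x z : ℕ} {T : Filling R} (h : IsStd n T) (hz1 : 1 ≤ z)
    (hzn : z ≤ n) (hz : z + 1 = x ∨ z = x + 2) (hb : Between T x z (x + 1)) {m : Fin k}
    {p q : ℕ × ℕ} (hp : toGrid (T m) p = some x) (hq : toGrid (T m) q = some (x + 1)) :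
    ¬ p ≤ q := by
  obtain ⟨m', c, hc⟩ := h.exists_at hz1 hzn
  rw [Between, h.place_lt_iff hp hc, h.place_lt_iff hc hq, h.place_lt_iff hq hc,
    h.place_lt_iff hc hp] at hb
  simp only [BoxBefore] at hb
  obtain rfl : m = m' := by omega
  simp only [lt_irrefl, true_and, false_or] at hb
  exact (h.facStd m).not_le_of_between hp hq hc hz hb

theorem IsStd.dualStep {n i : ℕ} {T T' : Filling R} (h : IsStd n T) (h1 : 1 ≤ i)
    (hi : i + 2 ≤ n) (hd : DualStep i T T') : IsStd n T' := by
  rcases hd with ⟨rfl, hd⟩ | ⟨rfl, hd⟩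
  · exact h.sw h1 (by omega) fun m p q hp hq =>
      h.not_le_of_between (by omega) hi (.inr rfl) hd hp hq
  · exact h.sw (by omega) (by omega) fun m p q hp hq =>
      h.not_le_of_between h1 (by omega) (.inl rfl) hd hp hq

/-! ### Descents and incomparability -/

theorem IsStd.mem_descents {n : ℕ} {T : Filling R} (h : IsStd n T) (hn : 3 ≤ n) {i : ℕ} :
    i ∈ descents n T ↔ (1 ≤ i ∧ i < n ∧ place T (i + 1) < place T i) ∨
      i = n ∧ place (KR.pr n T) 2 < place (KR.pr n T) 1 := by
  simp only [descents, Set.mem_union, h.mem_classicalDescents, Set.mem_ofPred_eq,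
    h.pr.mem_classicalDescents]
  constructor
  · rintro (h1 | ⟨h1, -, -, h2⟩)
    · exact .inl h1
    · exact .inr ⟨h1, h2⟩
  · rintro (h1 | ⟨h1, h2⟩)
    · exact .inl h1
    · exact .inr ⟨h1, le_rfl, by omega, h2⟩

theorem Incomparable.of_mem {n a b : ℕ} {T T' : Filling R}
    (h : (a ∈ descents n T ∧ a ∉ descents n T' ∧ b ∈ descents n T' ∧ b ∉ descents n T) ∨
      (a ∈ descents n T' ∧ a ∉ descents n T ∧ b ∈ descents n T ∧ b ∉ descents n T')) :
    Incomparable n T T' := by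
  rcases h with ⟨h1, h2, h3, h4⟩ | ⟨h1, h2, h3, h4⟩
  · exact ⟨fun h => h2 (h h1), fun h => h4 (h h3)⟩
  · exact ⟨fun h => h4 (h h3), fun h => h2 (h h1)⟩

/-- Making `i` a descent by a swap cannot destroy the descent `n` when `2 ≤ i ≤ n - 2`. If 1 and `n`
are in different factors, that descent depends only on the order of the factors; otherwise it says
that the slide of `n` enters the origin from below, and `FacStd.facPr_swap_mono` applies. -/
theorem IsStd.descents_mono {n i : ℕ} {T : Filling R} (h : IsStd n T) (h' : IsStd n (KR.sw i T))
    (hi : 2 ≤ i) (hin : i + 1 < n) (hd : place T i < place T (i + 1))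
    (h2 : place (KR.pr n T) 2 < place (KR.pr n T) 1) :
    place (KR.pr n (KR.sw i T)) 2 < place (KR.pr n (KR.sw i T)) 1 := by
  obtain ⟨m, p, hp⟩ := h.exists_at (x := n) (by omega) le_rfl
  obtain ⟨m', q, hq⟩ := h.exists_at (x := 1) (by omega) (by omega)
  have hp0 : toGrid (KR.sw i T m) p = some n := by
    rw [toGrid_relabel, hp, Option.map_some,
      Equiv.swap_apply_of_ne_of_ne (by omega) (by omega)]
  have hq0 : toGrid (KR.sw i T m') q = some 1 := by
    rw [toGrid_relabel, hq, Option.map_some,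
      Equiv.swap_apply_of_ne_of_ne (by omega) (by omega)]
  obtain ⟨p₁, hp₁⟩ := at_pr_one n (by omega) hp
  obtain ⟨q₁, hq₁⟩ := at_pr n (by omega) hq
  obtain ⟨p₂, hp₂⟩ := at_pr_one n (by omega) hp0
  obtain ⟨q₂, hq₂⟩ := at_pr n (by omega) hq0
  rw [h.pr.place_lt_iff hq₁ hp₁] at h2
  rw [h'.pr.place_lt_iff hq₂ hp₂]
  by_cases hm : m' = m
  · subst hm
    refine .inr ⟨rfl, .inl ?_⟩
    simp only [BoxBefore, lt_irrefl, true_and, false_or] at h2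
    have h3 := (h.pr.facStd m').eq_origin hp₁
    have h4 := (h'.pr.facStd m').eq_origin hp₂
    subst h3
    subst h4
    have hq₁' : q₁ = (1, 0) := by
      obtain ⟨a, b⟩ := q₁
      simp only [ReadBefore] at h2
      obtain ⟨w, hw⟩ := exists_toGrid_of_le (p := (a - 1, b)) hq₁ (by simp)
      have h3 := (h.pr.facStd m').grid_lt hw hq₁ (by simp) (by simp; omega)
      have h4 := (h.pr.facStd m').pos_of_toGrid hw
      obtain rfl : w = 1 := by omega
      have := (h.pr.facStd m').grid_inj hw hp₁
      simp only [Prod.mk.injEq] at this ⊢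
      omega
    subst hq₁'
    have h5 := (h.facStd m').facPr_swap_mono (h'.facStd m') hi hin (fun _ _ => rfl) ⟨p, hp⟩
      ⟨q, hq⟩ (fun c d hc hd' => ?_) hq₁
    · have := (h'.pr.facStd m').grid_inj h5 hq₂
      rw [← this]
      simp
    · rw [h.place_lt_iff hc hd'] at hd
      simp only [BoxBefore, lt_irrefl, true_and, false_or] at hd
      rcases hd with hd | hd <;> omega
  · simp only [BoxBefore, hm, false_and, or_false] at h2 ⊢
    exact h2

/-! ### Moves and elementary dual equivalences -/

theorem mem_facWord {r s : ℕ} {t : Fac r s} {x : ℕ} :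
    x ∈ facWord t ↔ ∃ c, toGrid t c = some x := by
  simp only [facWord, List.mem_map]
  constructor
  · rintro ⟨c, -, hc⟩
    exact ⟨(c.1, c.2), toGrid_eq_some.2 ⟨⟨c.1.2, c.2.2⟩, hc⟩⟩
  · rintro ⟨c, hc⟩
    obtain ⟨h1, h2⟩ := toGrid_eq_some.1 hc
    exact ⟨(⟨c.1, h1.1⟩, ⟨c.2, h1.2⟩), mem_facBoxes _, h2⟩

theorem pair_sublist_facWord {r s : ℕ} {t : Fac r s} {x y : ℕ} :
    [x, y].Sublist (facWord t) ↔
      ∃ p q, toGrid t p = some x ∧ toGrid t q = some y ∧ ReadBefore p q := by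
  rw [facWord, pair_sublist_map_iff (lt := fun c d : Fin r × Fin s =>
    ReadBefore (c.1, c.2) (d.1, d.2)) ?_ (pairwise_facBoxes r s)]
  · constructor
    · rintro ⟨a, -, b, -, h1, h2, h3⟩
      exact ⟨_, _, toGrid_eq_some.2 ⟨⟨a.1.2, a.2.2⟩, h1⟩, toGrid_eq_some.2 ⟨⟨b.1.2, b.2.2⟩, h2⟩, h3⟩
    · rintro ⟨p, q, hp, hq, h⟩
      obtain ⟨h1, h2⟩ := toGrid_eq_some.1 hp
      obtain ⟨h3, h4⟩ := toGrid_eq_some.1 hq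
      exact ⟨(⟨p.1, h1.1⟩, ⟨p.2, h1.2⟩), mem_facBoxes _, (⟨q.1, h3.1⟩, ⟨q.2, h3.2⟩),
        mem_facBoxes _, h2, h4, h⟩
  · intro a b h1 h2
    simp only [ReadBefore] at h1 h2
    omega

theorem IsStd.eq_of_pr_eq {n : ℕ} {T T' : Filling R} (h : IsStd n T) (h' : IsStd n T')
    {m : Fin k} (he : ∀ a b, facPr n (T' m) a b = facPr n (T m) a b) : T' m = T m :=
  facPr_injective (h'.facStd m) (h.facStd m) (funext fun a => funext fun b => he a b)

theorem IsStd.entry_ne {n : ℕ} {T : Filling R} (h : IsStd n T) {x : ℕ} {m m' : Fin k}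
    {p : ℕ × ℕ} (hp : toGrid (T m) p = some x) (hne : m' ≠ m) (a : Fin (R m').1)
    (b : Fin (R m').2) : T m' a b ≠ x := fun hab =>
  hne (h.at_unique (toGrid_eq_some.2 ⟨⟨a.2, b.2⟩, hab⟩ : toGrid (T m') (a, b) = some x) hp).1

/-- The letters `n` and 1 of `T` are 1 and 2 in its promotion, so the move t_n is the swap of 1 and
2 seen through promotion. In factors with neither letter injectivity of promotion gives equality. -/
theorem IsStd.update_of_pr_sw_one {n : ℕ} {T T' : Filling R} (h : IsStd n T) (h' : IsStd n T')
    (hn : 3 ≤ n) (he : KR.pr n T' = KR.sw 1 (KR.pr n T)) {l j : Fin k} {p q : ℕ × ℕ}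
    (hp : toGrid (T l) p = some n) (hq : toGrid (T j) q = some 1) :
    l ≠ j ∧
      T' = Function.update (Function.update T l (replaceMax n (T l))) j (replaceMin n (T j)) := by
  obtain ⟨p₁, hp₁⟩ := at_pr_one n (by omega) hp
  obtain ⟨q₁, hq₁⟩ := at_pr n (by omega) hq
  have hlj : l ≠ j := h.pr.ne_of_sw_one (he ▸ h'.pr) hp₁ hq₁
  have hm : ∀ m a b, facPr n (T' m) a b = Equiv.swap 1 2 (facPr n (T m) a b) :=
    fun m a b => congrFun (congrFun (congrFun he m) a) b
  refine ⟨hlj, funext fun m => ?_⟩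
  by_cases hj : m = j
  · subst hj
    rw [Function.update_self]
    exact replaceMin_eq (h.facStd m) (h'.facStd m)
      (fun c hc => hlj (h.at_unique hp hc).1) ⟨q, hq⟩ (hm m)
  · rw [Function.update_of_ne hj]
    by_cases hl : m = l
    · subst hl
      rw [Function.update_self]
      exact replaceMax_eq (h.facStd m) (h'.facStd m) ⟨p, hp⟩
        (fun c hc => hlj (h.at_unique hc hq).1) (hm m)
    · rw [Function.update_of_ne hl]
      refine h.eq_of_pr_eq h' fun a b => ?_
      rw [hm]
      exact Equiv.swap_apply_of_ne_of_ne (h.pr.entry_ne hp₁ hl a b) (h.pr.entry_ne hq₁ hj a b)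

theorem IsStd.update_facTbarOne {n : ℕ} {T T' : Filling R} (h : IsStd n T) (h' : IsStd n T')
    (he : KR.pr n T' = KR.sw 2 (KR.pr n T)) {j : Fin k} {p q c : ℕ × ℕ}
    (hp : toGrid (T j) p = some n) (hq : toGrid (KR.pr n T j) q = some 2)
    (hc : toGrid (KR.pr n T j) c = some 3) : T' = Function.update T j (facTbarOne n (T j)) := by
  have hm : ∀ m a b, facPr n (T' m) a b = Equiv.swap 2 3 (facPr n (T m) a b) :=
    fun m a b => congrFun (congrFun (congrFun he m) a) b
  refine funext fun m => ?_
  by_cases hj : m = j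
  · subst hj
    rw [Function.update_self]
    exact facTbarOne_eq (h.facStd m) (h'.facStd m) ⟨p, hp⟩ (hm m)
  · rw [Function.update_of_ne hj]
    refine h.eq_of_pr_eq h' fun a b => ?_
    rw [hm]
    exact Equiv.swap_apply_of_ne_of_ne (h.pr.entry_ne hq hj a b) (h.pr.entry_ne hc hj a b)

theorem at_of_at_sw {i x : ℕ} {T : Filling R} {m : Fin k} {c : ℕ × ℕ}
    (hc : toGrid (T m) c = some x) :
    toGrid (sw i T m) c = some (Equiv.swap i (i + 1) x) := by
  rw [toGrid_relabel, hc, Option.map_some]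

theorem IsStd.update_facTbarLast {n : ℕ} {T T' : Filling R} (h : IsStd n T) (h' : IsStd n T')
    (hn : 3 ≤ n) (he : KR.pr n (KR.pr n T') = KR.sw 2 (KR.pr n (KR.pr n T))) {j : Fin k}
    {p : ℕ × ℕ} (hp : toGrid (KR.pr n (KR.pr n T) j) p = some 1)
    (hq : toGrid (KR.pr n (KR.pr n T) j) (1, 0) = some 2)
    (hc : toGrid (KR.pr n (KR.pr n T) j) (0, 1) = some 3) :
    T' = Function.update T j (facTbarLast n (T j)) := by
  have hm : ∀ m a b, facPr n (facPr n (T' m)) a b =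
      Equiv.swap 2 3 (facPr n (facPr n (T m)) a b) :=
    fun m a b => congrFun (congrFun (congrFun he m) a) b
  refine funext fun m => ?_
  by_cases hj : m = j
  · subst hj
    rw [Function.update_self]
    -- The letters 1 and 2 of a double promotion are the former `n - 1` and `n`, so these two lie in
    -- the same factor for both fillings and the two-slide analysis is available.
    have key : ∀ U : Filling R, IsStd n U → (∃ c, toGrid (KR.pr n (KR.pr n U) m) c = some 1) →
        (∃ c, toGrid (KR.pr n (KR.pr n U) m) c = some 2) →
        (∃ c, toGrid (U m) c = some n) ∧ ∃ c, toGrid (U m) c = some (n - 1) := by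
      intro U hU h1 h2
      have h3 := (at_pr_succ (x := 1) (by omega)).1 h2
      have h4 := (at_pr_succ (x := 0) (by omega)).1 h1
      have h5 : ∃ c, toGrid (KR.pr n U m) c = some (0 + 1) := by simpa using h3
      have h6 : ∃ c, toGrid (KR.pr n U m) c = some (n - 1 + 1) := by
        rcases h4 with ⟨c, hc⟩ | h4
        · obtain ⟨σ, -, hσ⟩ := pr_perm n U
          obtain ⟨b, -, -, hb⟩ := toGrid_eq_some_iff_entry.1 hc
          rw [hσ, cyc] at hb
          split_ifs at hb
        · rw [Nat.sub_add_cancel (by omega)]; exact h4.2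
      have h7 := (at_pr_succ (by omega)).1 h5
      have h8 := (at_pr_succ (by omega)).1 h6
      refine ⟨?_, by simpa [show n - 1 ≠ 0 by omega] using h8⟩
      rcases h7 with ⟨c, hc⟩ | h7
      · have := (hU.bounds hc).1
        omega
      · exact h7.2
    have k1 := key T h ⟨p, hp⟩ ⟨_, hq⟩
    have hp' := at_of_at_sw (i := 2) hp
    have hc' := at_of_at_sw (i := 2) hc
    rw [← he] at hp' hc'
    have k2 := key T' h' ⟨p, by simpa [Equiv.swap_apply_def] using hp'⟩
      ⟨_, by simpa [Equiv.swap_apply_def] using hc'⟩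
    obtain ⟨_, _, _, _, _, H⟩ := (h.facStd m).exists_twoSlides k1.1 k1.2 (by omega)
    obtain ⟨_, _, _, _, _, H'⟩ := (h'.facStd m).exists_twoSlides k2.1 k2.2 (by omega)
    exact facTbarLast_eq (h.facStd m) H H' hn hq hc (hm m)
  · rw [Function.update_of_ne hj]
    refine h.eq_of_pr_eq h' fun a b => ?_
    refine congrFun (congrFun (h.pr.eq_of_pr_eq h'.pr fun a b => ?_) a) b
    refine (hm m a b).trans ?_
    exact Equiv.swap_apply_of_ne_of_ne (h.pr.pr.entry_ne hq hj a b) (h.pr.pr.entry_ne hc hj a b)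

/-- The swap reverses the descent `i`, so incomparability supplies a `c ≠ i` whose descent changes
in the opposite direction. If `c < n` then `c` is `i - 1` or `i + 1`, and the third letter lies
between the swapped ones. If `c = n` then `i = 1` or `i = n - 1`, and the same conclusion is reached
after one or two promotions. -/
theorem MoveT.dualStep {n i : ℕ} {T T' : Filling R} (h : IsStd n T) (h' : IsStd n T')
    (hn : 3 ≤ n) (h1 : 1 ≤ i) (hi : i < n) (hm : MoveT n i T T') :
    (∃ i, 1 ≤ i ∧ i + 2 ≤ n ∧ DualStep i T T') ∨ DualStep 1 (pr n T) (pr n T') ∨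
      DualStep 1 (pr n (pr n T)) (pr n (pr n T')) := by
  obtain ⟨he, hinc⟩ := hm
  obtain rfl : T' = sw i T := filling_ext he
  obtain ⟨⟨a, ha, ha'⟩, ⟨b, hb, hb'⟩⟩ := (by
    simpa only [Incomparable, Set.not_subset] using hinc :
      (∃ a ∈ descents n T, a ∉ descents n (sw i T)) ∧
        ∃ a ∈ descents n (sw i T), a ∉ descents n T)
  -- reduce to a descent other than `i`
  have key : ∀ c, c ≠ i → (c ∈ descents n T ∧ c ∉ descents n (sw i T) ∧
        place T i < place T (i + 1) ∨
      c ∈ descents n (sw i T) ∧ c ∉ descents n T ∧ place T (i + 1) < place T i) →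
      (∃ i', 1 ≤ i' ∧ i' + 2 ≤ n ∧ DualStep i' T (sw i T)) ∨
      DualStep 1 (pr n T) (pr n (sw i T)) ∨
      DualStep 1 (pr n (pr n T)) (pr n (pr n (sw i T))) := by
    intro c hci hc
    simp only [h.mem_descents hn, h'.mem_descents hn] at hc
    by_cases hcn : c = n
    · subst hcn
      simp only [lt_irrefl, false_and, and_false, true_and, false_or] at hc
      by_cases hi1 : i = 1
      · subst hi1
        rw [show sw 1 T = relabel (Equiv.swap 1 2) T from rfl, h.pr_swap_one hn] at hc ⊢
        rw [show relabel (Equiv.swap 2 3) (pr c T) = sw 2 (pr c T) from rfl] at hc ⊢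
        rw [place_sw_left, place_sw_of_ne (by omega) (by omega)] at hc
        have h2 := h.descent_pr le_rfl (by omega)
        have h3 := h.place_ne (x := 1) (y := 2) le_rfl (by omega) (by omega)
        have h4 := h.pr.place_ne (x := 2) (y := 3) (by omega) (by omega) (by omega)
        have h5 := h.pr.place_ne (x := 1) (y := 3) (by omega) (by omega) (by omega)
        have h6 := h.pr.place_ne (x := 1) (y := 2) (by omega) (by omega) (by omega)
        refine .inr (.inl (.inr ⟨rfl, ?_⟩))
        simp only [Between, Nat.reduceAdd] at *
        omega
      by_cases hin : i = c - 1
      · have hsw : sw i T = relabel (Equiv.swap (c - 1) c) T := by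
          rw [hin, sw, Nat.sub_add_cancel (by omega)]
        have h2 := h.descent_pr_pr hn
        -- The descents `n - 1` and `n` of a filling become 1 and 2 after two promotions, where the
        -- swap of `n - 1` and `n` is a swap of 1 and 2.
        have h3 := h.pr.descent_pr le_rfl (by omega)
        have h3' := h'.pr.descent_pr le_rfl (by omega)
        have h4 := h.place_ne (x := c - 1) (y := c) (by omega) (by omega) (by omega)
        rw [← h3, ← h3'] at hc
        rw [hsw] at h' hc ⊢
        rw [h.pr_pr_swap hn h'] at hc ⊢
        rw [show relabel (Equiv.swap 1 2) (pr c (pr c T)) = sw 1 (pr c (pr c T)) from rfl]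
          at hc ⊢
        rw [place_sw_right, place_sw_of_ne (by omega) (by omega), hin,
          Nat.sub_add_cancel (by omega)] at hc
        have h5 := h.pr.pr.place_ne (x := 1) (y := 3) (by omega) (by omega) (by omega)
        have h6 := h.pr.pr.place_ne (x := 1) (y := 2) (by omega) (by omega) (by omega)
        have h7 := h.pr.pr.place_ne (x := 2) (y := 3) (by omega) (by omega) (by omega)
        refine .inr (.inr (.inl ⟨rfl, ?_⟩))
        simp only [Between, Nat.reduceAdd] at *
        omega
      exfalso
      rcases hc with ⟨h2, h3, h4⟩ | ⟨h2, h3, h4⟩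
      · exact h3 (h.descents_mono h' (by omega) (by omega) h4 h2)
      · have h5 := h'.descents_mono (i := i) (by rwa [sw_sw]) (by omega) (by omega)
          (by rwa [place_sw_left, place_sw_right]) h2
        rw [sw_sw] at h5
        exact h3 h5
    · simp only [hcn, false_and, or_false] at hc
      by_cases hc1 : c = i + 1
      · subst hc1
        rw [place_sw_right, place_sw_of_ne (by omega) (by omega)] at hc
        refine .inl ⟨i, h1, by omega, .inl ⟨rfl, ?_⟩⟩
        have h5 := h.place_ne (x := i) (y := i + 1 + 1) (by omega) (by omega) (by omega)
        have h6 := h.place_ne (x := i + 1) (y := i + 1 + 1) (by omega) (by omega) (by omega)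
        simp only [Between, add_assoc, Nat.reduceAdd] at *
        omega
      by_cases hc2 : c + 1 = i
      · subst hc2
        rw [place_sw_left, place_sw_of_ne (by omega) (by omega)] at hc
        refine .inl ⟨c, by omega, by omega, .inr ⟨rfl, ?_⟩⟩
        have h5 := h.place_ne (x := c) (y := c + 1 + 1) (by omega) (by omega) (by omega)
        have h6 := h.place_ne (x := c) (y := c + 1) (by omega) (by omega) (by omega)
        simp only [Between, add_assoc, Nat.reduceAdd] at *
        omega
      rw [place_sw_of_ne (by omega) (by omega), place_sw_of_ne (by omega) (by omega)] at hc
      omega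
  have hia : (i ∈ descents n T ↔ place T (i + 1) < place T i) := by
    rw [h.mem_descents hn]
    constructor
    · rintro (h2 | h2) <;> omega
    · intro h2; exact .inl ⟨h1, hi, h2⟩
  have hib : (i ∈ descents n (sw i T) ↔ place T i < place T (i + 1)) := by
    rw [h'.mem_descents hn, place_sw_left, place_sw_right]
    constructor
    · rintro (h2 | h2) <;> omega
    · intro h2; exact .inl ⟨h1, hi, h2⟩
  have hne := h.place_ne (x := i) (y := i + 1) h1 hi.le (by omega)
  rcases lt_or_gt_of_ne hne with hlt | hlt
  · refine key a ?_ (.inl ⟨ha, ha', hlt⟩)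
    rintro rfl
    exact absurd (hia.1 ha) (by omega)
  · refine key b ?_ (.inr ⟨hb, hb', hlt⟩)
    rintro rfl
    exact absurd (hib.1 hb) (by omega)

/-- The swap of 1 and 2 in pr T reverses the descent `n` of T. Descents other than 1, `n - 1` and
`n` do not change. An opposite change at 1 is seen in pr T, as a dual equivalence swapping 1 and 2;
one at `n - 1` is seen in pr² T, as a dual equivalence swapping 2 and 3. -/
theorem IsStd.between_swap {n : ℕ} {T : Filling R} (h : IsStd n T) (hn : 3 ≤ n)
    {T' : Filling R} (h' : IsStd n T') (he : KR.pr n T' = KR.sw 1 (KR.pr n T)) :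
    Incomparable n T T' ↔ DualStep 1 (KR.pr n T) (KR.pr n T') ∨
      DualStep 1 (KR.pr n (KR.pr n T)) (KR.pr n (KR.pr n T')) := by
  have he2 : KR.pr n (KR.pr n T') = KR.sw 2 (KR.pr n (KR.pr n T)) := by
    rw [he]; exact h.pr.pr_swap_one hn
  have d1 : ∀ {U : Filling R}, IsStd n U → (n ∈ descents n U ↔
      place (KR.pr n U) 2 < place (KR.pr n U) 1) := by
    intro U hU
    rw [hU.mem_descents hn]
    simp
  have d2 : ∀ {U : Filling R}, IsStd n U → (n ∈ descents n U ↔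
      place (KR.pr n (KR.pr n U)) 3 < place (KR.pr n (KR.pr n U)) 2) := by
    intro U hU
    rw [d1 hU]
    exact (hU.pr.descent_pr le_rfl (by omega)).symm
  have d3 : ∀ {U : Filling R}, IsStd n U → ∀ i, 1 ≤ i → i + 1 < n → (i ∈ descents n U ↔
      place (KR.pr n U) (i + 2) < place (KR.pr n U) (i + 1)) := by
    intro U hU i h1 h2
    rw [hU.mem_descents hn, hU.descent_pr h1 h2]
    constructor
    · rintro (h3 | h3) <;> omega
    · intro h3; exact .inl ⟨h1, by omega, h3⟩
  have d4 : ∀ {U : Filling R}, IsStd n U → (n - 1 ∈ descents n U ↔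
      place (KR.pr n (KR.pr n U)) 2 < place (KR.pr n (KR.pr n U)) 1) := by
    intro U hU
    rw [hU.mem_descents hn, hU.descent_pr_pr hn, Nat.sub_add_cancel (by omega)]
    constructor
    · rintro (h3 | h3) <;> omega
    · intro h3; exact .inl ⟨by omega, by omega, h3⟩
  have e1 := d1 h
  have e1' := d1 h'
  have e2 := d2 h
  have e2' := d2 h'
  have e3 := d3 h 1 le_rfl (by omega)
  have e3' := d3 h' 1 le_rfl (by omega)
  have e4 := d4 h
  have e4' := d4 h'
  have n1 := h.pr.place_ne (x := 1) (y := 2) (by omega) (by omega) (by omega)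
  have n2 := h.pr.place_ne (x := 1) (y := 3) (by omega) (by omega) (by omega)
  have n3 := h.pr.place_ne (x := 2) (y := 3) (by omega) (by omega) (by omega)
  have n4 := h.pr.pr.place_ne (x := 1) (y := 2) (by omega) (by omega) (by omega)
  have n5 := h.pr.pr.place_ne (x := 1) (y := 3) (by omega) (by omega) (by omega)
  have n6 := h.pr.pr.place_ne (x := 2) (y := 3) (by omega) (by omega) (by omega)
  rw [he, show 1 + 1 = 2 from rfl, show 1 + 2 = 3 from rfl, place_sw_right,
    place_sw_of_ne (by omega) (by omega)] at e3'
  rw [he, show place (KR.sw 1 (KR.pr n T)) 2 = _ from place_sw_right 1 _, place_sw_left] at e1'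
  rw [he2, show place (KR.sw 2 (KR.pr n (KR.pr n T))) 3 = _ from place_sw_right 2 _,
    place_sw_left] at e2'
  rw [he2, place_sw_left, place_sw_of_ne (by omega) (by omega)] at e4'
  simp only [Nat.reduceAdd] at e1 e1' e2 e2' e3 e3' e4 e4'
  constructor
  · rintro ⟨i1, i2⟩
    obtain ⟨a, ha, ha'⟩ := Set.not_subset.1 i1
    obtain ⟨b, hb, hb'⟩ := Set.not_subset.1 i2
    have key : ∀ c, c ≠ n → (c ∈ descents n T ∧ c ∉ descents n T' ∧ n ∉ descents n T ∨
        c ∈ descents n T' ∧ c ∉ descents n T ∧ n ∈ descents n T) →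
        DualStep 1 (KR.pr n T) (KR.pr n T') ∨
        DualStep 1 (KR.pr n (KR.pr n T)) (KR.pr n (KR.pr n T')) := by
      intro c hcn hc
      have hrange : 1 ≤ c ∧ c < n := by
        rcases hc with ⟨h1, -⟩ | ⟨h1, -⟩
        · rcases (h.mem_descents hn).1 h1 with h2 | h2 <;> omega
        · rcases (h'.mem_descents hn).1 h1 with h2 | h2 <;> omega
      by_cases hc1 : c = 1
      · subst hc1
        refine .inl (.inl ⟨he, ?_⟩)
        simp only [Between, Nat.reduceAdd]
        rw [e3, e3', e1] at hc
        omega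
      by_cases hc2 : c = n - 1
      · subst hc2
        refine .inr (.inr ⟨he2, ?_⟩)
        simp only [Between, Nat.reduceAdd]
        rw [e4, e4', e2] at hc
        omega
      have e5 := d3 h c hrange.1 (by omega)
      have e5' := d3 h' c hrange.1 (by omega)
      rw [he, place_sw_of_ne (by omega) (by omega), place_sw_of_ne (by omega) (by omega)] at e5'
      rw [e5, e5'] at hc
      omega
    by_cases han : a = n
    · refine key b ?_ (.inr ⟨hb, hb', han ▸ ha⟩)
      rintro rfl
      exact hb' (han ▸ ha)
    · by_cases hbn : b = n
      · exact key a han (.inl ⟨ha, ha', hbn ▸ hb'⟩)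
      · by_cases hnT : n ∈ descents n T
        · exact key b hbn (.inr ⟨hb, hb', hnT⟩)
        · exact key a han (.inl ⟨ha, ha', hnT⟩)
  · rintro ((⟨-, hb⟩ | ⟨h1, -⟩) | (⟨h1, -⟩ | ⟨-, hb⟩))
    · simp only [Between, Nat.reduceAdd] at hb
      apply Incomparable.of_mem (a := n) (b := 1)
      rw [e1, e1', e3, e3']
      omega
    -- A filling obtained by swapping 1 and 2 cannot also be obtained by swapping 2 and 3; the same
    -- argument removes the next case.
    · exfalso
      have := congrArg (place · 1) (he.symm.trans h1)
      simp only [place_sw_left] at this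
      rw [place_sw_of_ne (by omega) (by omega)] at this
      exact n1 this.symm
    · exfalso
      have := congrArg (place · 1) (he2.symm.trans h1)
      simp only [place_sw_left] at this
      rw [place_sw_of_ne (by omega) (by omega)] at this
      exact n4 this
    · simp only [Between, Nat.reduceAdd] at hb
      apply Incomparable.of_mem (a := n) (b := n - 1)
      rw [e2, e2', e4, e4']
      omega

/-- As `n` and 1 lie in different factors, swapping 1 and 2 in the promotion gives a standard
filling; its preimage under promotion is the result of the move. -/
theorem MoveTn.dualStep {n : ℕ} {T T' : Filling R} (h : IsStd n T) (h' : IsStd n T')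
    (hn : 3 ≤ n) (hm : MoveTn n T T') :
    DualStep 1 (pr n T) (pr n T') ∨ DualStep 1 (pr n (pr n T)) (pr n (pr n T')) := by
  obtain ⟨l, j, hlj, hl, hj, he, hinc⟩ := hm
  obtain ⟨p, hp⟩ := mem_facWord.1 hl
  obtain ⟨q, hq⟩ := mem_facWord.1 hj
  obtain ⟨p₁, hp₁⟩ := at_pr_one n (by omega) hp
  obtain ⟨q₁, hq₁⟩ := at_pr n (by omega) hq
  obtain ⟨U, hU, hUe⟩ := (h.pr.sw_of_ne le_rfl (by omega) hp₁ hq₁ hlj).exists_pr_eq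
  obtain rfl : T' = U := by rw [(h.update_of_pr_sw_one hU hn hUe hp hq).2, he]
  exact (h.between_swap hn h' hUe).1 hinc

theorem IsStd.moveTn {n : ℕ} {T T' : Filling R} (h : IsStd n T) (h' : IsStd n T')
    (hn : 3 ≤ n) (he : KR.pr n T' = KR.sw 1 (KR.pr n T))
    (hd : DualStep 1 (KR.pr n T) (KR.pr n T') ∨
      DualStep 1 (KR.pr n (KR.pr n T)) (KR.pr n (KR.pr n T'))) : MoveTn n T T' := by
  obtain ⟨l, p, hp⟩ := h.exists_at (x := n) (by omega) le_rfl
  obtain ⟨j, q, hq⟩ := h.exists_at (x := 1) le_rfl (by omega)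
  obtain ⟨h1, h2⟩ := h.update_of_pr_sw_one h' hn he hp hq
  exact ⟨l, j, h1, mem_facWord.2 ⟨p, hp⟩, mem_facWord.2 ⟨q, hq⟩, h2,
    (h.between_swap hn h' he).2 hd⟩

theorem IsStd.hook {n : ℕ} {T : Filling R} (h : IsStd n T) {j : Fin k} {p q c : ℕ × ℕ}
    (hp : toGrid (T j) p = some 1) (hq : toGrid (T j) q = some 2) (hc : toGrid (T j) c = some 3)
    (h1 : place T 2 < place T 1) (h2 : place T 2 < place T 3) :
    p = (0, 0) ∧ q = (1, 0) ∧ c = (0, 1) ∧ place T 1 < place T 3 := by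
  have h3 := h1
  rw [h.place_lt_iff hq hp] at h1
  rw [h.place_lt_iff hq hc] at h2
  simp only [BoxBefore, lt_irrefl, true_and, false_or] at h1 h2
  have h4 := (h.facStd j).hook hp hq hc h1 h2
  have h5 := (h.facStd j).eq_origin hp
  refine ⟨h5, h4.1, h4.2, (h.place_lt_iff hp hc).2 (.inr ⟨rfl, ?_⟩)⟩
  rw [h5, h4.2]
  right
  simp

theorem facWord_eq_of_row {r s : ℕ} (t : Fac (r + 1) (s + 2)) :
    ∃ u v : List ℕ, facWord t = u ++ [t 0 0, t 0 1] ++ v ∧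
      ∀ a b, a ≠ 0 → t a b ∈ u := by
  refine ⟨(((List.finRange r).map Fin.succ).reverse.flatMap fun i =>
    (List.finRange (s + 2)).map fun j => t i j),
    (List.finRange s).map fun j => t 0 j.succ.succ, ?_, fun a b ha => ?_⟩
  · rw [facWord, facBoxes,
      show List.finRange (r + 1) = 0 :: (List.finRange r).map Fin.succ from List.finRange_succ,
      List.reverse_cons, List.flatMap_append,
      List.map_append, List.map_flatMap]
    simp only [List.map_map, List.flatMap_cons, List.flatMap_nil, List.append_nil,
      List.append_assoc]
    congr 1
    rw [List.finRange_succ, List.finRange_succ]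
    simp [Function.comp_def]
  · obtain ⟨a', rfl⟩ := Fin.exists_succ_eq.2 ha
    simp only [List.mem_flatMap, List.mem_reverse, List.mem_map, List.mem_finRange, true_and]
    exact ⟨a'.succ, ⟨a', rfl⟩, b, rfl⟩

theorem pair_infix_sublist {l u v : List ℕ} {x y z : ℕ} (h : l = u ++ [x, y] ++ v) (hz : z ∈ u) :
    [z, x].Sublist l ∧ [x, y].Sublist l := by
  subst h
  constructor
  · rw [List.append_assoc]
    exact (List.singleton_sublist.2 hz).append (.cons_cons _ (List.nil_sublist _))
  · rw [List.append_assoc]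
    exact ((List.Sublist.refl [x, y]).trans (List.sublist_append_left _ v)).trans
      (List.sublist_append_right _ _)

/-- The positions for the barred moves: with 2 first among 1, 2, 3 in one factor, these letters form
a hook, so 1 is read between 2 and 3, and 2 and 3 are in incomparable boxes and may be swapped. -/
theorem exists_hook_eq {n : ℕ} {T : Filling R} (h : IsStd n T) (hn : 3 ≤ n) {j : Fin k}
    (hp : ∃ c, toGrid (T j) c = some 1) (hq : ∃ c, toGrid (T j) c = some 2)
    (hc : ∃ c, toGrid (T j) c = some 3)
    (h1 : place T 2 < place T 1) (h2 : place T 2 < place T 3) :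
    toGrid (T j) (0, 0) = some 1 ∧ toGrid (T j) (1, 0) = some 2 ∧ toGrid (T j) (0, 1) = some 3 ∧
      Between T 2 1 3 ∧ IsStd n (sw 2 T) := by
  obtain ⟨p, hp⟩ := hp
  obtain ⟨q, hq⟩ := hq
  obtain ⟨c, hc⟩ := hc
  obtain ⟨rfl, rfl, rfl, h3⟩ := h.hook hp hq hc h1 h2
  refine ⟨hp, hq, hc, .inl ⟨h1, h3⟩, h.sw (by omega) (by omega) fun m a b ha hb hle => ?_⟩
  rw [(h.at_unique ha hq).2, (h.at_unique hb hc).2] at hle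
  simp at hle

/-- The pattern of the reading word says that 1 is not a descent of T, hence 2 is not a descent of
pr T, while `n` being a descent makes 1 a descent of pr T. So 2 precedes 1 and 3 in pr T. -/
theorem MoveTbarOne.dualStep {n : ℕ} {T T' : Filling R} (h : IsStd n T)
    (hn : 3 ≤ n) (hm : MoveTbarOne n T T') : DualStep 1 (pr n T) (pr n T') := by
  obtain ⟨j, ⟨u, v, huv, hu⟩, hD, he⟩ := hm
  obtain ⟨hs1, hs2⟩ := pair_infix_sublist huv hu
  obtain ⟨p, q, hp, hq, -⟩ := pair_sublist_facWord.1 hs1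
  obtain ⟨q', c, hq', hc, hqc⟩ := pair_sublist_facWord.1 hs2
  have h1 : place T 1 < place T 2 := (h.place_lt_iff hq' hc).2 (.inr ⟨rfl, hqc⟩)
  have h2 : place (pr n T) 2 < place (pr n T) 1 := by
    rcases (h.mem_descents hn).1 hD with h2 | h2
    · omega
    · exact h2.2
  have h3 := h.descent_pr le_rfl (by omega)
  have h4 := h.pr.place_ne (x := 2) (y := 3) (by omega) (by omega) (by omega)
  simp only [Nat.reduceAdd] at h3
  obtain ⟨-, k2, k3, k4, k5⟩ := exists_hook_eq h.pr hn (at_pr_one n (by omega) hp)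
    (at_pr n (by omega) hq) (at_pr n (by omega) hc) h2 (by omega)
  obtain ⟨U, hU, hUe⟩ := k5.exists_pr_eq
  obtain rfl : T' = U := by rw [h.update_facTbarOne hU hUe hp k2 k3, he]
  exact .inr ⟨hUe, k4⟩

/-- Since `n` precedes `n - 1`, the double promotion has the descent 1; since `n` is not a descent,
it does not have the descent 2. So 2 precedes 1 and 3 there. -/
theorem MoveTbarLast.dualStep {n : ℕ} {T T' : Filling R} (h : IsStd n T)
    (hn : 3 ≤ n) (hm : MoveTbarLast n T T') :
    DualStep 1 (pr n (pr n T)) (pr n (pr n T')) := by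
  obtain ⟨j, hs1, hs2, hD, he⟩ := hm
  obtain ⟨p, q, hp, hq, hpq⟩ := pair_sublist_facWord.1 hs1
  obtain ⟨-, c, -, hc, -⟩ := pair_sublist_facWord.1 hs2
  have h1 := (h.descent_pr_pr hn).2 ((h.place_lt_iff hp hq).2 (.inr ⟨rfl, hpq⟩))
  have h2 : ¬ place (pr n T) 2 < place (pr n T) 1 := fun h2 =>
    hD ((h.mem_descents hn).2 (.inr ⟨rfl, h2⟩))
  have h3 := h.pr.descent_pr le_rfl (by omega)
  have h4 := h.pr.pr.place_ne (x := 2) (y := 3) (by omega) (by omega) (by omega)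
  simp only [Nat.reduceAdd] at h3
  obtain ⟨p₁, hp₁⟩ := at_pr_one n (by omega) hp
  obtain ⟨q₁, hq₁⟩ := at_pr n (by omega) hq
  obtain ⟨c₁, hc₁⟩ := at_pr n (by omega) hc
  rw [Nat.sub_add_cancel (by omega)] at hq₁
  obtain ⟨k1, k2, k3, k4, k5⟩ := exists_hook_eq h.pr.pr hn (at_pr_one n (by omega) hq₁)
    (at_pr n (by omega) hp₁) (at_pr n (by omega) hc₁) h1 (by omega)
  obtain ⟨V, hV, hVe⟩ := k5.exists_pr_eq
  obtain ⟨U, hU, rfl⟩ := hV.exists_pr_eq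
  obtain rfl : T' = U := by rw [h.update_facTbarLast hU hn hVe k1 k2 k3, he]
  exact .inr ⟨hVe, k4⟩

theorem at_of_at_pr (n : ℕ) {T : Filling R} {x : ℕ} (hx1 : 1 ≤ x) (hx : x < n) {m : Fin k}
    {c : ℕ × ℕ} (hc : toGrid (pr n T m) c = some (x + 1)) : ∃ c, toGrid (T m) c = some x := by
  rcases (at_pr_succ hx).1 ⟨c, hc⟩ with h | h
  · exact h
  · omega

theorem IsStd.at_of_at_pr_one {n : ℕ} {T : Filling R} (h : IsStd n T) (hn : 0 < n) {m : Fin k}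
    {c : ℕ × ℕ} (hc : toGrid (KR.pr n T m) c = some 1) : ∃ c, toGrid (T m) c = some n := by
  rcases (at_pr_succ (x := 0) hn).1 ⟨c, hc⟩ with ⟨d, hd⟩ | h1
  · have := (h.bounds hd).1
    omega
  · exact h1.2

theorem facWord_eq_of_corners {n r s : ℕ} {t : Fac r s} (hr : 1 < r) (hs : 1 < s)
    (hn : toGrid t (r - 1, s - 1) = some n) (h1 : toGrid t (0, 0) = some 1)
    (h2 : toGrid t (0, 1) = some 2) : ∃ u v, facWord t = u ++ [1, 2] ++ v ∧ n ∈ u := by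
  obtain ⟨r, rfl⟩ : ∃ r', r = r' + 1 := ⟨r - 1, by omega⟩
  obtain ⟨s, rfl⟩ : ∃ s', s = s' + 2 := ⟨s - 2, by omega⟩
  obtain ⟨u, v, huv, hu⟩ := facWord_eq_of_row t
  refine ⟨u, v, ?_, ?_⟩
  · rw [huv, show t 0 0 = 1 from (toGrid_eq_some.1 h1).2,
      show t 0 1 = 2 from (toGrid_eq_some.1 h2).2]
  · obtain ⟨h6, h7⟩ := toGrid_eq_some.1 hn
    rw [← h7]
    refine hu _ _ fun h8 => ?_
    have := congrArg Fin.val h8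
    simp only [Fin.val_zero] at this
    omega

theorem IsStd.moveTbarOne {n : ℕ} {T T' : Filling R} (h : IsStd n T) (h' : IsStd n T')
    (hn : 3 ≤ n) (he : KR.pr n T' = KR.sw 2 (KR.pr n T)) {j : Fin k} {p q c : ℕ × ℕ}
    (hp : toGrid (KR.pr n T j) p = some 1) (hq : toGrid (KR.pr n T j) q = some 2)
    (hc : toGrid (KR.pr n T j) c = some 3)
    (h1 : place (KR.pr n T) 2 < place (KR.pr n T) 1)
    (h2 : place (KR.pr n T) 2 < place (KR.pr n T) 3) : MoveTbarOne n T T' := by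
  obtain ⟨rfl, rfl, rfl, -⟩ := h.pr.hook hp hq hc h1 h2
  obtain ⟨pn, hpn⟩ := h.at_of_at_pr_one (by omega) hp
  obtain ⟨p₁, hp₁⟩ := at_of_at_pr n le_rfl (by omega) hq
  obtain ⟨p₂, hp₂⟩ := at_of_at_pr n (by omega) (by omega) hc
  have hr := (toGrid_eq_some.1 hq).1.1
  have hs := (toGrid_eq_some.1 hc).1.2
  simp only at hr hs
  have h3 := h.descent_pr le_rfl (by omega)
  have h4 := h.place_ne (x := 1) (y := 2) (by omega) (by omega) (by omega)
  simp only [Nat.reduceAdd] at h3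
  have h5 : place T 1 < place T 2 := by omega
  rw [h.place_lt_iff hp₁ hp₂] at h5
  simp only [BoxBefore, lt_irrefl, true_and, false_or] at h5
  have hpn' := (h.facStd j).eq_corner hpn
  obtain rfl := (h.facStd j).eq_origin hp₁
  have hp₂' : p₂ = (0, 1) := by
    obtain ⟨a, b⟩ := p₂
    simp only [ReadBefore] at h5
    have hle : ((a, b - 1) : ℕ × ℕ) ≤ (a, b) := by simp
    obtain ⟨w, hw⟩ := exists_toGrid_of_le hp₂ hle
    have h6 := (h.facStd j).grid_lt hw hp₂ hle (by simp; omega)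
    have h7 := (h.facStd j).pos_of_toGrid hw
    obtain rfl : w = 1 := by omega
    have := (h.facStd j).grid_inj hw hp₁
    simp only [Prod.mk.injEq] at this ⊢
    omega
  subst hp₂'
  refine ⟨j, ?_, (h.mem_descents hn).2 (.inr ⟨rfl, h1⟩), h.update_facTbarOne h' he hpn hq hc⟩
  exact facWord_eq_of_corners hr hs (hpn' ▸ hpn) hp₁ hp₂

theorem IsStd.moveTbarLast {n : ℕ} {T T' : Filling R} (h : IsStd n T) (h' : IsStd n T')
    (hn : 3 ≤ n) (he : KR.pr n (KR.pr n T') = KR.sw 2 (KR.pr n (KR.pr n T))) {j : Fin k}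
    {p q c : ℕ × ℕ}
    (hp : toGrid (KR.pr n (KR.pr n T) j) p = some 1)
    (hq : toGrid (KR.pr n (KR.pr n T) j) q = some 2)
    (hc : toGrid (KR.pr n (KR.pr n T) j) c = some 3)
    (h1 : place (KR.pr n (KR.pr n T)) 2 < place (KR.pr n (KR.pr n T)) 1)
    (h2 : place (KR.pr n (KR.pr n T)) 2 < place (KR.pr n (KR.pr n T)) 3) :
    MoveTbarLast n T T' := by
  obtain ⟨rfl, rfl, rfl, -⟩ := h.pr.pr.hook hp hq hc h1 h2
  obtain ⟨p₁, hp₁⟩ := h.pr.at_of_at_pr_one (by omega) hp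
  obtain ⟨q₁, hq₁⟩ := at_of_at_pr n le_rfl (by omega) hq
  obtain ⟨c₁, hc₁⟩ := at_of_at_pr n (by omega) (by omega) hc
  obtain ⟨p₂, hp₂⟩ := at_of_at_pr n (x := n - 1) (by omega) (by omega)
    (hp₁.trans (by congr 1; omega))
  obtain ⟨q₂, hq₂⟩ := h.at_of_at_pr_one (by omega) hq₁
  obtain ⟨c₂, hc₂⟩ := at_of_at_pr n le_rfl (by omega) hc₁
  have hr := (toGrid_eq_some.1 hq).1.1
  simp only at hr
  refine ⟨j, pair_sublist_facWord.2 ⟨q₂, p₂, hq₂, hp₂, ?_⟩,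
    pair_sublist_facWord.2 ⟨q₂, c₂, hq₂, hc₂, ?_⟩, fun hD => ?_,
    h.update_facTbarLast h' hn he hp hq hc⟩
  · have h3 := (h.descent_pr_pr hn).1 h1
    rw [h.place_lt_iff hq₂ hp₂] at h3
    simpa only [BoxBefore, lt_irrefl, true_and, false_or] using h3
  · rw [(h.facStd j).eq_corner hq₂, (h.facStd j).eq_origin hc₂]
    left
    simp only
    omega
  · have h3 := h.pr.descent_pr le_rfl (by omega)
    rcases (h.mem_descents hn).1 hD with h4 | h4
    · omega
    · simp only [Nat.reduceAdd] at h3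
      omega

/-- A letter between two letters of the same factor is in that factor. -/
theorem IsStd.exists_at_of_between {n x y z : ℕ} {T : Filling R} (h : IsStd n T) (hy1 : 1 ≤ y)
    (hyn : y ≤ n) (hb : Between T x y z) {j : Fin k} {p q : ℕ × ℕ}
    (hp : toGrid (T j) p = some x) (hq : toGrid (T j) q = some z) :
    ∃ c, toGrid (T j) c = some y := by
  obtain ⟨m, c, hc⟩ := h.exists_at hy1 hyn
  rw [Between, h.place_lt_iff hp hc, h.place_lt_iff hc hq, h.place_lt_iff hq hc,
    h.place_lt_iff hc hp] at hb
  simp only [BoxBefore] at hb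
  obtain rfl : m = j := by omega
  exact ⟨c, hc⟩

theorem IsStd.move_of_dualStep {n i : ℕ} {T T' : Filling R} (h : IsStd n T) (h' : IsStd n T')
    (hn : 3 ≤ n) (h1 : 1 ≤ i) (hi : i + 2 ≤ n) (hd : DualStep i T T') : Move n T T' := by
  rcases hd with ⟨rfl, hb⟩ | ⟨rfl, hb⟩
  · refine .inl ⟨i, h1, by omega, fun c => rfl, .of_mem (a := i) (b := i + 1) ?_⟩
    simp only [h.mem_descents hn, h'.mem_descents hn, place_sw_left, place_sw_right,
      place_sw_of_ne (show i + 1 + 1 ≠ i by omega) (show i + 1 + 1 ≠ i + 1 by omega)]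
    simp only [Between, add_assoc, Nat.reduceAdd] at *
    by_cases hin : i = n
    · omega
    by_cases hin' : i + 1 = n
    · omega
    simp only [hin, hin', false_and, or_false]
    omega
  · refine .inl ⟨i + 1, by omega, by omega, fun c => rfl, .of_mem (a := i) (b := i + 1) ?_⟩
    simp only [h.mem_descents hn, h'.mem_descents hn, place_sw_left, place_sw_right,
      place_sw_of_ne (show i ≠ i + 1 by omega) (show i ≠ i + 1 + 1 by omega)]
    simp only [Between, add_assoc, Nat.reduceAdd] at *
    by_cases hin : i = n
    · omega
    by_cases hin' : i + 1 = n
    · omega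
    simp only [hin, hin', false_and, or_false]
    omega

/-- A swap of 1 and 2 in pr T is t_n. A swap of 2 and 3 in pr T is t_1 if the letters 1 and 2 of T
lie in different factors; otherwise it is the barred move on 1, 2, `n`, applied to whichever of T
and T' has 2 before 3 after promotion. -/
theorem IsStd.move_of_dualStep_pr {n : ℕ} {T T' : Filling R} (h : IsStd n T) (h' : IsStd n T')
    (hn : 3 ≤ n) (hd : DualStep 1 (KR.pr n T) (KR.pr n T')) : Move n T T' ∨ Move n T' T := by
  rcases hd with hd | ⟨he, hb⟩
  · exact .inl (.inr (.inl (h.moveTn h' hn hd.1 (.inl (.inl hd)))))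
  simp only [Nat.reduceAdd] at he hb
  obtain ⟨m, p, hp⟩ := h.exists_at (x := 1) (by omega) (by omega)
  obtain ⟨m', q, hq⟩ := h.exists_at (x := 2) (by omega) (by omega)
  obtain ⟨p₁, hp₁⟩ := at_pr n (by omega) hp
  obtain ⟨q₁, hq₁⟩ := at_pr n (by omega) hq
  simp only [Nat.reduceAdd] at hp₁ hq₁
  by_cases hm : m = m'
  · subst hm
    obtain ⟨c, hc⟩ := h.pr.exists_at_of_between le_rfl (by omega) hb hp₁ hq₁
    rcases hb with hb | hb
    · exact .inl (.inr (.inr (.inl (h.moveTbarOne h' hn he hc hp₁ hq₁ hb.1 (by omega)))))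
    · have he' : KR.pr n T = KR.sw 2 (KR.pr n T') := by rw [he, sw_sw]
      have hc' := at_of_at_sw (i := 2) hc
      have hp₁' := at_of_at_sw (i := 2) hp₁
      have hq₁' := at_of_at_sw (i := 2) hq₁
      rw [← he, Equiv.swap_apply_of_ne_of_ne (by omega) (by omega)] at hc'
      rw [← he, Equiv.swap_apply_left] at hp₁'
      rw [← he, Equiv.swap_apply_right] at hq₁'
      refine .inr (.inr (.inr (.inl (h'.moveTbarOne h hn he' hc' hq₁' hp₁' ?_ ?_))))
      · rw [he, place_sw_left, place_sw_of_ne (by omega) (by omega)]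
        exact hb.1
      · rw [he, place_sw_left, show place (KR.sw 2 _) 3 = _ from place_sw_right 2 _]
        simp only [Nat.reduceAdd]
        omega
  · have h1 := h.sw_of_ne le_rfl (by omega) hp hq hm
    obtain rfl : T' = KR.sw 1 T := h'.pr_inj h1 (he.trans (h.pr_swap_one hn).symm)
    refine .inl (.inl ⟨1, le_rfl, by omega, fun c => rfl, .of_mem (a := 1) (b := n) ?_⟩)
    have h2 := h.descent_pr le_rfl (by omega)
    simp only [h.mem_descents hn, h'.mem_descents hn, place_sw_left, place_sw_right, he,
      place_sw_of_ne (show 1 ≠ 2 by omega) (show 1 ≠ 2 + 1 by omega)]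
    simp only [Between, Nat.reduceAdd, lt_irrefl, false_and, and_false, true_and, false_or,
      show 1 ≠ n by omega, or_false, le_refl, show 1 < n by omega] at *
    have h4 := h.place_ne (x := 1) (y := 2) (by omega) (by omega) (by omega)
    omega

/-- A swap of 1 and 2 in pr² T is t_{n-1}. A swap of 2 and 3 concerns the letters `n` and 1 of T: it
is t_n if these lie in different factors, and otherwise the barred move on 1, `n - 1`, `n`, again
from one of the two ends. -/
theorem IsStd.move_of_dualStep_pr_pr {n : ℕ} {T T' : Filling R} (h : IsStd n T)
    (h' : IsStd n T') (hn : 3 ≤ n)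
    (hd : DualStep 1 (KR.pr n (KR.pr n T)) (KR.pr n (KR.pr n T'))) :
    Move n T T' ∨ Move n T' T := by
  rcases hd with ⟨he, hb⟩ | ⟨he, hb⟩
  · obtain ⟨m, p, hp⟩ := h.exists_at (x := n - 1) (by omega) (by omega)
    obtain ⟨m', q, hq⟩ := h.exists_at (x := n - 1 + 1) (by omega) (by omega)
    have hm : m ≠ m' := by
      obtain ⟨p₁, hp₁⟩ := at_pr n (by omega) hp
      rw [Nat.sub_add_cancel (by omega)] at hp₁ hq
      obtain ⟨q₁, hq₁⟩ := at_pr_one n (by omega) hq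
      obtain ⟨p₂, hp₂⟩ := at_pr_one n (by omega) hp₁
      obtain ⟨q₂, hq₂⟩ := at_pr n (by omega) hq₁
      exact h.pr.pr.ne_of_sw_one (he ▸ h'.pr.pr) hp₂ hq₂
    have h1 := h.sw_of_ne (by omega) (by omega) hp hq hm
    have hsw : KR.sw (n - 1) T = relabel (Equiv.swap (n - 1) n) T := by
      rw [KR.sw, Nat.sub_add_cancel (by omega)]
    obtain rfl : T' = KR.sw (n - 1) T := by
      refine h'.pr_inj h1 (h'.pr.pr_inj h1.pr ?_)
      rw [he]
      rw [hsw] at h1 ⊢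
      exact (h.pr_pr_swap hn h1).symm
    refine .inl (.inl ⟨n - 1, by omega, by omega, fun c => rfl, .of_mem (a := n - 1) (b := n) ?_⟩)
    have h2 := h.descent_pr_pr hn
    have h3 := h.pr.descent_pr le_rfl (by omega)
    have h3' := h'.pr.descent_pr le_rfl (by omega)
    simp only [Nat.reduceAdd] at h3 h3' he hb
    rw [he, show place (KR.sw 1 _) 2 = _ from place_sw_right 1 _,
      place_sw_of_ne (by omega) (by omega)] at h3'
    simp only [h.mem_descents hn, h'.mem_descents hn, ← h3, ← h3', place_sw_left, place_sw_right]
    rw [Nat.sub_add_cancel (by omega)]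
    simp only [Between, lt_irrefl, false_and, and_false, true_and, false_or,
      show n - 1 ≠ n by omega, or_false, show 1 ≤ n - 1 by omega, show n - 1 < n by omega] at *
    have h4 := h.place_ne (x := n - 1) (y := n) (by omega) (by omega) (by omega)
    omega
  · simp only [Nat.reduceAdd] at he hb
    obtain ⟨m, p, hp⟩ := h.pr.exists_at (x := 1) (by omega) (by omega)
    obtain ⟨m', q, hq⟩ := h.pr.exists_at (x := 2) (by omega) (by omega)
    obtain ⟨p₁, hp₁⟩ := at_pr n (by omega) hp
    obtain ⟨q₁, hq₁⟩ := at_pr n (by omega) hq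
    simp only [Nat.reduceAdd] at hp₁ hq₁
    by_cases hm : m = m'
    · subst hm
      obtain ⟨c, hc⟩ := h.pr.pr.exists_at_of_between le_rfl (by omega) hb hp₁ hq₁
      rcases hb with hb | hb
      · exact .inl (.inr (.inr (.inr (h.moveTbarLast h' hn he hc hp₁ hq₁ hb.1 (by omega)))))
      · have he' : KR.pr n (KR.pr n T) = KR.sw 2 (KR.pr n (KR.pr n T')) := by rw [he, sw_sw]
        have hc' := at_of_at_sw (i := 2) hc
        have hp₁' := at_of_at_sw (i := 2) hp₁
        have hq₁' := at_of_at_sw (i := 2) hq₁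
        rw [← he, Equiv.swap_apply_of_ne_of_ne (by omega) (by omega)] at hc'
        rw [← he, Equiv.swap_apply_left] at hp₁'
        rw [← he, Equiv.swap_apply_right] at hq₁'
        refine .inr (.inr (.inr (.inr (h'.moveTbarLast h hn he' hc' hq₁' hp₁' ?_ ?_))))
        · rw [he, place_sw_left, place_sw_of_ne (by omega) (by omega)]
          exact hb.1
        · rw [he, place_sw_left, show place (KR.sw 2 _) 3 = _ from place_sw_right 2 _]
          simp only [Nat.reduceAdd]
          omega
    · have h1 := h.pr.sw_of_ne le_rfl (by omega) hp hq hm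
      have he' : KR.pr n T' = KR.sw 1 (KR.pr n T) :=
        h'.pr.pr_inj h1 (he.trans (h.pr.pr_swap_one hn).symm)
      exact .inl (.inr (.inl (h.moveTn h' hn he' (.inr (.inr ⟨he, hb⟩)))))

/-- Moves in terms of elementary dual equivalences. -/
theorem IsStd.move_or_move_iff {n : ℕ} {T T' : Filling R} (h : IsStd n T) (h' : IsStd n T')
    (hn : 3 ≤ n) : Move n T T' ∨ Move n T' T ↔
      (∃ i, 1 ≤ i ∧ i + 2 ≤ n ∧ DualStep i T T') ∨ DualStep 1 (KR.pr n T) (KR.pr n T') ∨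
        DualStep 1 (KR.pr n (KR.pr n T)) (KR.pr n (KR.pr n T')) := by
  have key : ∀ {T T' : Filling R}, IsStd n T → IsStd n T' → Move n T T' →
      (∃ i, 1 ≤ i ∧ i + 2 ≤ n ∧ DualStep i T T') ∨ DualStep 1 (KR.pr n T) (KR.pr n T') ∨
        DualStep 1 (KR.pr n (KR.pr n T)) (KR.pr n (KR.pr n T')) := by
    rintro T T' h h' (⟨i, h1, hi, hm⟩ | hm | hm | hm)
    · exact hm.dualStep h h' hn h1 hi
    · exact .inr (hm.dualStep h h' hn)
    · exact .inr (.inl (hm.dualStep h hn))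
    · exact .inr (.inr (hm.dualStep h hn))
  constructor
  · rintro (hm | hm)
    · exact key h h' hm
    · rcases key h' h hm with ⟨i, h1, h2, hd⟩ | hd | hd
      · exact .inl ⟨i, h1, h2, hd.symm⟩
      · exact .inr (.inl hd.symm)
      · exact .inr (.inr hd.symm)
  · rintro (⟨i, h1, h2, hd⟩ | hd | hd)
    · exact .inl (h.move_of_dualStep h' hn h1 h2 hd)
    · exact h.move_of_dualStep_pr h' hn hd
    · exact h.move_of_dualStep_pr_pr h' hn hd

/-! ### Crystal operators and commutators as dual equivalences. -/

variable {N : ℕ}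

/-! ### Crystal operators on words -/

/-- The unmatched positions of a word. -/
def wordBrackets (i : ℕ) (w : Fin N → ℕ) : List (Fin N) × List (Fin N) :=
  (List.finRange N).foldl (bracketStep i w) ([], [])

/-- The lowering operator on words. -/
def wordF (i : ℕ) (w : Fin N → ℕ) : Fin N → ℕ :=
  match (wordBrackets i w).1.head? with
  | none => w
  | some j => Function.update w j (i + 1)

/-- The raising operator on words. -/
def wordE (i : ℕ) (w : Fin N → ℕ) : Fin N → ℕ :=
  match (wordBrackets i w).2.getLast? with
  | none => w
  | some j => Function.update w j i

/-- Shift invariance, so that tables for the smallest letters serve all indices. -/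
theorem wordBrackets_add (i d : ℕ) (w : Fin N → ℕ) :
    wordBrackets (i + d) (fun j => w j + d) = wordBrackets i w := by
  have : bracketStep (i + d) (fun j => w j + d) = bracketStep i w := by
    funext st c
    simp only [bracketStep, show w c + d = i + d + 1 ↔ w c = i + 1 by omega,
      show w c + d = i + d ↔ w c = i by omega]
  rw [wordBrackets, wordBrackets, this]

theorem wordF_add (i d : ℕ) (w : Fin N → ℕ) :
    wordF (i + d) (fun j => w j + d) = fun j => wordF i w j + d := by
  rw [wordF, wordF, wordBrackets_add]
  cases (wordBrackets i w).1.head? with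
  | none => rfl
  | some j =>
    funext j'
    simp only [Function.update_apply]
    split_ifs <;> omega

theorem wordE_add (i d : ℕ) (w : Fin N → ℕ) :
    wordE (i + d) (fun j => w j + d) = fun j => wordE i w j + d := by
  rw [wordE, wordE, wordBrackets_add]
  cases (wordBrackets i w).2.getLast? with
  | none => rfl
  | some j =>
    funext j'
    simp only [Function.update_apply]
    split_ifs <;> omega

/-- A sequence of boxes in reading order. -/
def IsFrame (pos : Fin N → Box R) : Prop :=
  ∀ a b, a < b → BoxBefore (pos a).1 (pos a).pos (pos b).1 (pos b).pos

theorem IsFrame.injective {pos : Fin N → Box R} (h : IsFrame pos) : Function.Injective pos := by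
  intro a b hab
  rcases lt_trichotomy a b with h1 | h1 | h1
  · have := h a b h1
    rw [hab] at this
    exact absurd this this.asymm
  · exact h1
  · have := h b a h1
    rw [hab] at this
    exact absurd this this.asymm

open Classical in
/-- Write a word into a sequence of boxes. -/
noncomputable def put (pos : Fin N → Box R) (T : Filling R) (w : Fin N → ℕ) : Filling R :=
  fun m a b => if h : ∃ j, pos j = ⟨m, a, b⟩ then w h.choose else T m a b

theorem entry_put_pos {pos : Fin N → Box R} (h : Function.Injective pos) (T : Filling R)
    (w : Fin N → ℕ) (j : Fin N) : entry (put pos T w) (pos j) = w j := by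
  have hex : ∃ j', pos j' = ⟨(pos j).1, (pos j).2.1, (pos j).2.2⟩ := ⟨j, rfl⟩
  rw [entry, put, dif_pos hex]
  exact congrArg w (h hex.choose_spec)

theorem entry_put_of_ne {pos : Fin N → Box R} {c : Box R} (h : ∀ j, pos j ≠ c) (T : Filling R)
    (w : Fin N → ℕ) : entry (put pos T w) c = entry T c := by
  have hex : ¬ ∃ j', pos j' = ⟨c.1, c.2.1, c.2.2⟩ := fun ⟨j, hj⟩ => h j hj
  rw [entry, put, dif_neg hex, entry]

theorem put_eq_of {pos : Fin N → Box R} (h : Function.Injective pos) {T U : Filling R}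
    {w : Fin N → ℕ} (h1 : ∀ j, entry U (pos j) = w j)
    (h2 : ∀ c, (∀ j, pos j ≠ c) → entry U c = entry T c) : put pos T w = U := by
  refine filling_ext fun c => ?_
  by_cases hc : ∃ j, pos j = c
  · obtain ⟨j, rfl⟩ := hc
    rw [entry_put_pos h, h1]
  · simp only [not_exists] at hc
    rw [entry_put_of_ne hc, h2 c hc]

theorem relabel_put {pos : Fin N → Box R} (h : Function.Injective pos) (φ : ℕ → ℕ)
    (T : Filling R) (w : Fin N → ℕ) :
    relabel φ (put pos T w) = put pos (relabel φ T) fun j => φ (w j) :=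
  (put_eq_of h (fun j => by rw [entry_relabel, entry_put_pos h])
    fun c hc => by rw [entry_relabel, entry_put_of_ne hc, entry_relabel]).symm

theorem entry_setEntry (T : Filling R) (c d : Box R) (x : ℕ) :
    entry (setEntry T c x) d = if d = c then x else entry T d := by
  obtain ⟨m, a, b⟩ := c
  obtain ⟨m', a', b'⟩ := d
  simp only [entry, setEntry]
  by_cases hm : m' = m
  · subst hm
    rw [Function.update_self]
    by_cases ha : a' = a
    · subst ha
      rw [Function.update_self, Function.update_apply]
      simp
    · rw [Function.update_of_ne ha, if_neg (by simp [ha])]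
  · rw [Function.update_of_ne hm, if_neg (by simp [hm])]

theorem setEntry_put {pos : Fin N → Box R} (h : Function.Injective pos) (T : Filling R)
    (w : Fin N → ℕ) (j : Fin N) (x : ℕ) :
    setEntry (put pos T w) (pos j) x = put pos T (Function.update w j x) := by
  refine (put_eq_of h (fun j' => ?_) fun c hc => ?_).symm
  · rw [entry_setEntry, entry_put_pos h, Function.update_apply]
    simp only [h.eq_iff]
  · rw [entry_setEntry, if_neg (fun hcj => hc j hcj.symm), entry_put_of_ne hc]

theorem foldl_bracketStep_map {α β : Type*} (i : ℕ) (pos : α → β) (val : β → ℕ) (l : List α)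
    (st : List α × List α) :
    (l.map pos).foldl (bracketStep i val) (st.1.map pos, st.2.map pos) =
      Prod.map (List.map pos) (List.map pos) (l.foldl (bracketStep i fun a => val (pos a)) st) := by
  induction l generalizing st with
  | nil => rfl
  | cons a l ih =>
    rw [List.map_cons, List.foldl_cons, List.foldl_cons, ← ih]
    congr 1
    obtain ⟨s1, s2⟩ := st
    simp only [bracketStep]
    split_ifs
    · rfl
    · cases s2 <;> rfl
    · rfl

theorem foldl_bracketStep_filter {α : Type*} (i : ℕ) (val : α → ℕ) (p : α → Bool)
    (hp : ∀ a, p a = false → val a ≠ i ∧ val a ≠ i + 1) (l : List α) (st : List α × List α) :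
    l.foldl (bracketStep i val) st = (l.filter p).foldl (bracketStep i val) st := by
  induction l generalizing st with
  | nil => rfl
  | cons a l ih =>
    rw [List.foldl_cons, ih, List.filter_cons]
    cases ha : p a with
    | true => rfl
    | false =>
      have h1 := hp a ha
      simp [bracketStep, h1.1, h1.2]

/-- Letters other than `i` and `i + 1` do not affect the bracketing, so the operator acts on the
short word in the frame. -/
theorem brackets_put {pos : Fin N → Box R} (h : IsFrame pos) {i : ℕ} {T : Filling R}
    (hT : ∀ c, (∀ j, pos j ≠ c) → entry T c ≠ i ∧ entry T c ≠ i + 1) (w : Fin N → ℕ) :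
    brackets i (put pos T w) =
      Prod.map (List.map pos) (List.map pos) (wordBrackets i w) := by
  classical
  have h1 : (boxes R).filter (fun c => decide (∃ j, pos j = c)) = (List.finRange N).map pos := by
    refine list_eq_of_pairwise (lt := fun c d : Box R => BoxBefore c.1 c.pos d.1 d.pos)
      (fun a ha => ha.asymm ha) (fun _ _ ha => ha.asymm) ((pairwise_boxes R).filter _) ?_ ?_
    · rw [List.pairwise_map]
      exact (List.pairwise_lt_finRange N).imp fun hab => h _ _ hab
    · intro a
      simp [mem_boxes]
  rw [brackets, foldl_bracketStep_filter i _ (fun c => decide (∃ j, pos j = c)), h1]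
  · have := foldl_bracketStep_map i pos (entry (put pos T w)) (List.finRange N) ([], [])
    simp only [List.map_nil] at this
    rw [this, wordBrackets]
    simp only [entry_put_pos h.injective]
  · intro c hc
    have hc' : ∀ j, pos j ≠ c := by simpa using hc
    rw [entry_put_of_ne hc']
    exact hT c hc'

theorem fClassical_put {pos : Fin N → Box R} (h : IsFrame pos) {i : ℕ} {T : Filling R}
    (hT : ∀ c, (∀ j, pos j ≠ c) → entry T c ≠ i ∧ entry T c ≠ i + 1) (w : Fin N → ℕ) :
    fClassical i (put pos T w) = put pos T (wordF i w) := by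
  rw [fClassical, brackets_put h hT, wordF]
  simp only [Prod.map_fst, List.head?_map]
  cases (wordBrackets i w).1.head? with
  | none => rfl
  | some j => exact setEntry_put h.injective T w j _

theorem eClassical_put {pos : Fin N → Box R} (h : IsFrame pos) {i : ℕ} {T : Filling R}
    (hT : ∀ c, (∀ j, pos j ≠ c) → entry T c ≠ i ∧ entry T c ≠ i + 1) (w : Fin N → ℕ) :
    eClassical i (put pos T w) = put pos T (wordE i w) := by
  rw [eClassical, brackets_put h hT, wordE]
  simp only [Prod.map_snd, List.getLast?_map]
  cases (wordBrackets i w).2.getLast? with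
  | none => rfl
  | some j => exact setEntry_put h.injective T w j _

/-- The boxes of the letters `i, …, i + N - 1` in reading order. -/
theorem IsStd.exists_frame {n : ℕ} {T : Filling R} (h : IsStd n T) (N : ℕ) {i : ℕ} (h1 : 1 ≤ i)
    (hi : i + N ≤ n + 1) : ∃ (pos : Fin N → Box R) (σ : Equiv.Perm (Fin N)), IsFrame pos ∧
      (∀ j, entry T (pos j) = σ j + i) ∧
      (∀ c, (∀ j, pos j ≠ c) → entry T c < i ∨ i + N ≤ entry T c) ∧
      ∀ x y : Fin N, place T (x + i) < place T (y + i) ↔ σ.symm x < σ.symm y := by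
  choose b hb using fun x : Fin N => h.surj (x + i) (by omega) (by omega)
  let g : Fin N → ℕ := fun x => place T (x + i)
  have hg : Function.Injective g := by
    intro x y hxy
    by_contra hne
    exact h.place_ne (x := x + i) (y := y + i) (by omega) (by omega)
      (fun h2 => hne (Fin.ext (by omega))) hxy
  have hmono : StrictMono (g ∘ Tuple.sort g) :=
    (Tuple.monotone_sort g).strictMono_of_injective (hg.comp (Tuple.sort g).injective)
  refine ⟨fun j => b (Tuple.sort g j), Tuple.sort g, ?_, fun j => hb _, ?_, ?_⟩
  · intro x y hxy
    exact (h.place_lt_iff (toGrid_eq_some_iff_entry.2 ⟨_, rfl, rfl, hb _⟩)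
      (toGrid_eq_some_iff_entry.2 ⟨_, rfl, rfl, hb _⟩)).1 (hmono hxy)
  · intro c hc
    by_contra! hcon
    refine hc ((Tuple.sort g).symm ⟨entry T c - i, by omega⟩) (h.inj _ _ ?_)
    simp only [Equiv.apply_symm_apply, hb]
    omega
  · intro x y
    have := hmono.lt_iff_lt (a := (Tuple.sort g).symm x) (b := (Tuple.sort g).symm y)
    simpa only [Function.comp_apply, Equiv.apply_symm_apply] using this

/-! ### Tables -/

/-- The classical commutator on words. -/
def wordComm (i : ℕ) (w : Fin N → ℕ) : Fin N → ℕ :=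
  wordE i (wordE (i + 1) (wordF i (wordF (i + 1) w)))

/-- Merge the letters `1` and `2`, and decrease the larger letters. -/
def mergeOne (x : ℕ) : ℕ := if x = 1 then 1 else x - 1

/-- Merge the letters `2` and `3`, and decrease the larger letters. -/
def mergeTwo (x : ℕ) : ℕ := if x ≤ 2 then x else x - 1

/-- Change the letter `i` into `i + 1`. -/
def raise (i x : ℕ) : ℕ := if x = i then i + 1 else x

/-- The words are the permutations of 1, 2, 3. Those beginning with 2 move, 213 to 312 and 231 to
132; the other four are fixed. -/
theorem wordComm_table (σ : Equiv.Perm (Fin 3)) :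
    (σ.symm 1 < σ.symm 0 ∧ σ.symm 1 < σ.symm 2 →
      (wordComm 1 (fun j => (σ j : ℕ) + 1) = fun j => Equiv.swap 1 2 ((σ j : ℕ) + 1)) ∧
          σ.symm 2 < σ.symm 0 ∨
        (wordComm 1 (fun j => (σ j : ℕ) + 1) = fun j => Equiv.swap 2 3 ((σ j : ℕ) + 1)) ∧
          σ.symm 0 < σ.symm 2) ∧
    (¬ (σ.symm 1 < σ.symm 0 ∧ σ.symm 1 < σ.symm 2) →
      wordComm 1 (fun j => (σ j : ℕ) + 1) = fun j => (σ j : ℕ) + 1) := by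
  revert σ
  decide

/-- Covers the case where the lowering operators have merged 1 and 2. The inner word is affected by
one raising operator, promotion adds one to it, and the second raising operator completes the
commutator. The bound by 2 ensures that no letter `n` is present, so that promotion is a mere shift.
-/
theorem wordE_mergeOne_table (σ : Equiv.Perm (Fin 3)) (h1 : σ.symm 0 < σ.symm 1)
    (h2 : σ.symm 2 < σ.symm 1) :
    (wordE 1 (fun j => wordE 1 (fun j => mergeOne ((σ j : ℕ) + 1)) j + 1) =
        wordComm 1 fun j => (σ j : ℕ) + 1) ∧
      (wordE 1 (fun j => mergeOne ((σ j : ℕ) + 1)) = fun j => mergeOne ((σ j : ℕ) + 1)) ∧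
      ∀ j, wordE 1 (fun j => mergeOne ((σ j : ℕ) + 1)) j ≤ 2 := by
  revert σ
  decide

/-- The analogue for 2 and 3 merged. The second clause is used for C_{n-1}: after one raising
operator the word is the result of the commutator with 1 and 2 merged. -/
theorem wordE_mergeTwo_table (σ : Equiv.Perm (Fin 3)) (h : σ.symm 1 < σ.symm 2) :
    (wordE 1 (fun j => wordE 1 (fun j => mergeTwo ((σ j : ℕ) + 1)) j + 1) =
        wordComm 1 fun j => (σ j : ℕ) + 1) ∧
      (wordE 1 (fun j => mergeTwo ((σ j : ℕ) + 1)) =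
        fun j => mergeOne (wordComm 1 (fun j => (σ j : ℕ) + 1) j)) ∧
      ∀ j, wordE 1 (fun j => mergeTwo ((σ j : ℕ) + 1)) j ≤ 2 := by
  revert σ
  decide

theorem word_pair_table (σ : Equiv.Perm (Fin 2)) :
    (σ.symm 1 < σ.symm 0 →
      (wordF 0 (fun j => (σ j : ℕ)) = fun j => (σ j : ℕ)) ∧
        wordE 0 (fun j => (σ j : ℕ)) = fun j => (σ j : ℕ)) ∧
    (σ.symm 0 < σ.symm 1 →
      (wordF 0 (fun j => (σ j : ℕ)) = fun j => raise 0 (σ j)) ∧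
        wordE 0 (fun j => raise 0 (σ j)) = fun j => (σ j : ℕ)) := by
  revert σ
  decide

theorem word_single_table : wordF 0 (fun _ : Fin 1 => 0) = fun _ => 1 := by
  decide

/-! ### Crystal operators near standard fillings -/

theorem relabel_relabel (φ ψ : ℕ → ℕ) (T : Filling R) :
    relabel φ (relabel ψ T) = relabel (fun x => φ (ψ x)) T := rfl

theorem put_congr {pos : Fin N → Box R} {T T' : Filling R} {w w' : Fin N → ℕ}
    (hw : ∀ j, w j = w' j) (h : ∀ c, (∀ j, pos j ≠ c) → entry T c = entry T' c) :
    put pos T w = put pos T' w' := by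
  obtain rfl : w = w' := funext hw
  refine filling_ext fun c => ?_
  by_cases hc : ∃ j, pos j = c
  · simp only [entry, put]
    rw [dif_pos hc, dif_pos hc]
  · simp only [not_exists] at hc
    rw [entry_put_of_ne hc, entry_put_of_ne hc, h c hc]

theorem IsStd.pair_spec {n i : ℕ} {T : Filling R} (h : IsStd n T) (h1 : 1 ≤ i) (hi : i < n) :
    (place T (i + 1) < place T i → fClassical i T = T ∧ eClassical i T = T) ∧
      (place T i < place T (i + 1) → fClassical i T = relabel (raise i) T ∧
        eClassical i (relabel (raise i) T) = T) := by
  obtain ⟨pos, σ, hpos, hσ, hoff, hpl⟩ := h.exists_frame 2 h1 (by omega)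
  have hTp : put pos T (fun j => (σ j : ℕ) + i) = T :=
    put_eq_of hpos.injective hσ fun _ _ => rfl
  have hoff' : ∀ c, (∀ j, pos j ≠ c) → entry T c ≠ i ∧ entry T c ≠ i + 1 := by
    intro c hc
    rcases hoff c hc with h2 | h2 <;> omega
  have hrp : put pos T (fun j => raise 0 (σ j) + i) = relabel (raise i) T := by
    refine put_eq_of hpos.injective (fun j => ?_) fun c hc => ?_
    · rw [entry_relabel, hσ, raise, raise]
      split_ifs <;> omega
    · rw [entry_relabel, raise, if_neg (hoff' c hc).1]
  have hF := wordF_add 0 i (fun j => (σ j : ℕ))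
  have hE := wordE_add 0 i (fun j => (σ j : ℕ))
  have hE' := wordE_add 0 i (fun j => raise 0 (σ j))
  rw [zero_add] at hF hE hE'
  have h2 := hpl 1 0
  have h3 := hpl 0 1
  simp only [Fin.val_zero, Fin.val_one, zero_add, add_comm 1 i] at h2 h3
  rw [h2, h3]
  obtain ⟨t1, t2⟩ := word_pair_table σ
  constructor
  · intro hlt
    obtain ⟨t3, t4⟩ := t1 hlt
    constructor
    · conv_lhs => rw [← hTp]
      rw [fClassical_put hpos hoff', hF, t3, hTp]
    · conv_lhs => rw [← hTp]
      rw [eClassical_put hpos hoff', hE, t4, hTp]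
  · intro hlt
    obtain ⟨t3, t4⟩ := t2 hlt
    constructor
    · conv_lhs => rw [← hTp]
      rw [fClassical_put hpos hoff', hF, t3, hrp]
    · rw [← hrp, eClassical_put hpos hoff', hE', t4, hTp]

theorem fClassical_of_single {i : ℕ} {T : Filling R} {c : Box R} (hc : entry T c = i)
    (h : ∀ d, d ≠ c → entry T d ≠ i ∧ entry T d ≠ i + 1) :
    fClassical i T = relabel (raise i) T := by
  let pos : Fin 1 → Box R := fun _ => c
  have hpos : IsFrame pos := fun a b hab => absurd hab (by omega)
  have hoff : ∀ d, (∀ j, pos j ≠ d) → entry T d ≠ i ∧ entry T d ≠ i + 1 :=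
    fun d hd => h d fun hdc => hd 0 hdc.symm
  have hTp : put pos T (fun _ => i) = T :=
    put_eq_of hpos.injective (fun _ => hc) fun _ _ => rfl
  have hF := wordF_add 0 i (fun _ : Fin 1 => 0)
  rw [word_single_table] at hF
  simp only [zero_add] at hF
  conv_lhs => rw [← hTp]
  rw [fClassical_put hpos hoff, hF]
  refine put_eq_of hpos.injective (fun j => ?_) fun d hd => ?_
  · rw [entry_relabel, hc, raise, if_pos rfl, add_comm]
  · rw [entry_relabel, raise, if_neg (hoff d hd).1]

/-- The classical commutator. -/
def classicalComm (i : ℕ) (T : Filling R) : Filling R :=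
  eClassical i (eClassical (i + 1) (fClassical i (fClassical (i + 1) T)))

theorem classicalComm_put {pos : Fin N → Box R} (h : IsFrame pos) {i : ℕ} {T : Filling R}
    (hT : ∀ c, (∀ j, pos j ≠ c) → entry T c < i ∨ i + 3 ≤ entry T c) (w : Fin N → ℕ) :
    classicalComm i (put pos T w) = put pos T (wordComm i w) := by
  have h1 : ∀ c, (∀ j, pos j ≠ c) → entry T c ≠ i ∧ entry T c ≠ i + 1 := by
    intro c hc
    rcases hT c hc with h2 | h2 <;> omega
  have h2 : ∀ c, (∀ j, pos j ≠ c) → entry T c ≠ i + 1 ∧ entry T c ≠ i + 1 + 1 := by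
    intro c hc
    rcases hT c hc with h2 | h2 <;> omega
  rw [classicalComm, fClassical_put h h2, fClassical_put h h1, eClassical_put h h2,
    eClassical_put h h1, wordComm]

theorem wordComm_add (i d : ℕ) (w : Fin N → ℕ) :
    wordComm (i + d) (fun j => w j + d) = fun j => wordComm i w j + d := by
  simp only [wordComm]
  rw [add_right_comm i d 1, wordF_add, wordF_add, wordE_add, wordE_add]

theorem IsStd.classicalComm_spec {n i : ℕ} {T : Filling R} (h : IsStd n T) (h1 : 1 ≤ i)
    (hi : i + 2 ≤ n) :
    (place T (i + 1) < place T i ∧ place T (i + 1) < place T (i + 2) →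
      DualStep i T (classicalComm i T)) ∧
    (¬ (place T (i + 1) < place T i ∧ place T (i + 1) < place T (i + 2)) →
      classicalComm i T = T) := by
  obtain ⟨pos, σ, hpos, hσ, hoff, hpl⟩ := h.exists_frame 3 h1 (by omega)
  obtain ⟨d, rfl⟩ : ∃ d, i = 1 + d := ⟨i - 1, by omega⟩
  have hTp : put pos T (fun j => (σ j : ℕ) + 1 + d) = T :=
    put_eq_of hpos.injective (fun j => by rw [hσ, add_assoc]) fun _ _ => rfl
  have hK : classicalComm (1 + d) T =
      put pos T fun j => wordComm 1 (fun j => (σ j : ℕ) + 1) j + d := by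
    conv_lhs => rw [← hTp]
    rw [classicalComm_put hpos hoff, wordComm_add 1 d]
  have hsw : ∀ x, (x = 1 ∨ x = 2) →
      (put pos T fun j => Equiv.swap x (x + 1) ((σ j : ℕ) + 1) + d) = KR.sw (x + d) T := by
    intro x hx
    refine put_eq_of hpos.injective (fun j => ?_) fun c hc => ?_
    · rw [entry_relabel, hσ]
      simp only [Equiv.swap_apply_def]
      split_ifs <;> omega
    · rw [entry_relabel]
      refine Equiv.swap_apply_of_ne_of_ne ?_ ?_ <;> rcases hoff c hc with h2 | h2 <;> omega
  have p01 := hpl 0 1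
  have p10 := hpl 1 0
  have p02 := hpl 0 2
  have p20 := hpl 2 0
  have p12 := hpl 1 2
  have p21 := hpl 2 1
  simp only [Fin.val_zero, Fin.val_one, Fin.val_two, zero_add] at p01 p10 p02 p20 p12 p21
  rw [add_comm 1 (1 + d)] at p01 p10 p12 p21
  rw [add_comm 2 (1 + d)] at p02 p20 p12 p21
  obtain ⟨t1, t2⟩ := wordComm_table σ
  rw [p10, p12]
  constructor
  · intro hlt
    rcases t1 hlt with ⟨t3, t4⟩ | ⟨t3, t4⟩
    · refine .inl ⟨?_, ?_⟩
      · rw [hK, t3]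
        exact hsw 1 (.inl rfl)
      · rw [← p12] at hlt
        rw [← p20] at t4
        exact .inr ⟨hlt.2, t4⟩
    · refine .inr ⟨?_, ?_⟩
      · rw [hK, t3, show 1 + d + 1 = 2 + d by omega]
        exact hsw 2 (.inr rfl)
      · rw [← p10] at hlt
        rw [← p02] at t4
        exact .inl ⟨hlt.1, t4⟩
  · intro hlt
    rw [hK, t2 hlt, hTp]

theorem IsStd.isStd_classicalComm {n i : ℕ} {T : Filling R} (h : IsStd n T) (h1 : 1 ≤ i)
    (hi : i + 2 ≤ n) : IsStd n (classicalComm i T) := by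
  obtain ⟨h2, h3⟩ := h.classicalComm_spec h1 hi
  by_cases hc : place T (i + 1) < place T i ∧ place T (i + 1) < place T (i + 2)
  · exact h.dualStep h1 hi (h2 hc)
  · rwa [h3 hc]

/-- In a dual equivalent pair the letter `i + 1` comes first among the three letters in one member
and last in the other. The commutator moves the former to the latter and fixes the latter, hence the
symmetric formulation. Partners are unique because the two kinds of swap have exclusive conditions.
-/
theorem IsStd.classicalComm_iff {n i : ℕ} {T T' : Filling R} (h : IsStd n T) (h' : IsStd n T')
    (h1 : 1 ≤ i) (hi : i + 2 ≤ n) :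
    T ≠ T' ∧ (classicalComm i T = T' ∨ classicalComm i T' = T) ↔ DualStep i T T' := by
  have key : ∀ {T T' : Filling R}, IsStd n T → T ≠ T' → classicalComm i T = T' →
      DualStep i T T' := by
    rintro T T' h hne rfl
    obtain ⟨h2, h3⟩ := h.classicalComm_spec h1 hi
    by_cases hc : place T (i + 1) < place T i ∧ place T (i + 1) < place T (i + 2)
    · exact h2 hc
    · exact absurd (h3 hc).symm hne
  have uniq : ∀ {T A B : Filling R}, DualStep i T A → DualStep i T B → A = B := by
    rintro T A B (⟨rfl, h2⟩ | ⟨rfl, h2⟩) (⟨rfl, h3⟩ | ⟨rfl, h3⟩)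
    · rfl
    · simp only [Between] at h2 h3; omega
    · simp only [Between] at h2 h3; omega
    · rfl
  constructor
  · rintro ⟨hne, h2 | h2⟩
    · exact key h hne h2
    · exact (key h' hne.symm h2).symm
  · intro hd
    have n1 := h.place_ne (x := i) (y := i + 1) (by omega) (by omega) (by omega)
    have n2 := h.place_ne (x := i + 1) (y := i + 2) (by omega) (by omega) (by omega)
    constructor
    · rintro rfl
      rcases hd with ⟨h2, -⟩ | ⟨h2, -⟩
      · have := congrArg (place · i) h2
        simp only [place_sw_left] at this
        exact n1 this
      · have := congrArg (place · (i + 1)) h2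
        simp only [place_sw_left] at this
        exact n2 this
    · by_cases hc : place T (i + 1) < place T i ∧ place T (i + 1) < place T (i + 2)
      · exact .inl (uniq ((h.classicalComm_spec h1 hi).1 hc) hd)
      · refine .inr (uniq ((h'.classicalComm_spec h1 hi).1 ?_) hd.symm)
        rcases hd with ⟨rfl, h2⟩ | ⟨rfl, h2⟩
        · rw [place_sw_left, place_sw_right, place_sw_of_ne (by omega) (by omega)]
          simp only [Between] at h2
          omega
        · rw [place_sw_left, show place (KR.sw (i + 1) T) (i + 2) = _ from place_sw_right (i + 1) T,
            place_sw_of_ne (by omega) (by omega)]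
          simp only [Between] at h2
          simp only [add_assoc, Nat.reduceAdd] at *
          omega

/-! ### Inverse promotion near standard fillings -/

/-- Letters are merged only across non-descents, so equal letters are read in increasing order of
their old values. In a column the larger old entry is read first, so equal letters never share a
column. -/
theorem IsStd.relabel_mem_crystal {n : ℕ} {T : Filling R} (h : IsStd n T) {φ : ℕ → ℕ}
    (hb : ∀ x, 1 ≤ x → x ≤ n → 1 ≤ φ x ∧ φ x ≤ n) (hm : ∀ x, 1 ≤ x → x < n → φ x ≤ φ (x + 1))
    (hs : ∀ x, 1 ≤ x → x < n → place T (x + 1) < place T x → φ x < φ (x + 1)) :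
    relabel φ T ∈ crystal n R := by
  have key : ∀ y, ∀ x, 1 ≤ x → x ≤ y → y ≤ n → φ x ≤ φ y ∧ (φ x = φ y → place T x ≤ place T y) := by
    intro y
    induction y with
    | zero => intro x h1 h2; omega
    | succ y ih =>
      intro x h1 h2 h3
      rcases h2.lt_or_eq with h4 | rfl
      · obtain ⟨h5, h6⟩ := ih x h1 (by omega) (by omega)
        have h7 := hm y (by omega) (by omega)
        have h8 := hs y (by omega) (by omega)
        refine ⟨by omega, fun h9 => ?_⟩
        have h10 := h6 (by omega)
        by_contra h11
        have := h8 (by omega)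
        omega
      · exact ⟨le_rfl, fun _ => le_rfl⟩
  intro m
  refine ⟨fun a b => (hb _ (h.one_le ⟨m, a, b⟩) (h.le ⟨m, a, b⟩)).1,
    fun a b => (hb _ (h.one_le ⟨m, a, b⟩) (h.le ⟨m, a, b⟩)).2, fun a b b' hlt => ?_,
    fun a a' b hlt => ?_⟩
  · exact (key _ _ (h.one_le ⟨m, a, b⟩)
      ((h.facStd m).lt le_rfl hlt.le (by simp [hlt.ne])).le (h.le ⟨m, a, b'⟩)).1
  · obtain ⟨h2, h3⟩ := key _ _ (h.one_le ⟨m, a, b⟩)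
      ((h.facStd m).lt hlt.le le_rfl (by simp [hlt.ne])).le (h.le ⟨m, a', b⟩)
    refine h2.lt_of_ne fun h4 => ?_
    have h5 := h3 h4
    refine h5.not_gt ((h.place_lt_iff (m := m) (c := (a', b)) (m' := m) (c' := (a, b))
      (toGrid_eq_some_iff_entry.2 ⟨⟨m, a', b⟩, rfl, rfl, rfl⟩)
      (toGrid_eq_some_iff_entry.2 ⟨⟨m, a, b⟩, rfl, rfl, rfl⟩)).2 (.inr ⟨rfl, .inl ?_⟩))
    simpa using hlt

/-- The argument of `prInv` has no letter 1, so no semistandard preimage contains `n`. On such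
fillings promotion is the injective shift by one. -/
theorem prInv_relabel_succ {n : ℕ} {T : Filling R} (h : T ∈ crystal n R)
    (hn : ∀ c, entry T c ≠ n) : prInv n (relabel (· + 1) T) = T := by
  have h1 := pr_of_forall_ne hn
  obtain ⟨h2, h3⟩ := prInv_spec h
  rw [h1] at h2 h3
  obtain ⟨σ, -, hσ⟩ := pr_perm n (prInv n (relabel (· + 1) T))
  have h4 : ∀ c, entry (prInv n (relabel (· + 1) T)) c ≠ n := by
    intro c hc
    have h5 := hσ (σ.symm c)
    rw [h3, Equiv.apply_symm_apply, hc, cyc, if_pos rfl, entry_relabel] at h5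
    have := (h (σ.symm c).1).pos (σ.symm c).2.1 (σ.symm c).2.2
    simp only [entry] at h5
    omega
  rw [pr_of_forall_ne h4] at h3
  refine filling_ext fun c => ?_
  have := congrArg (entry · c) h3
  simpa using this

/-- After 1 is merged into 2, the reading order still tells which of the two letters was the 1. -/
theorem IsStd.eq_of_relabel_raise_one {n : ℕ} {A B : Filling R} (hA : IsStd n A)
    (hB : IsStd n B) (hn : 2 ≤ n) (hdA : place A 1 < place A 2) (hdB : place B 1 < place B 2)
    (he : relabel (raise 1) A = relabel (raise 1) B) : A = B := by
  have hc : ∀ c, raise 1 (entry A c) = raise 1 (entry B c) := fun c => congrArg (entry · c) he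
  have hlt : ∀ {U : Filling R}, IsStd n U → place U 1 < place U 2 → ∀ {a b : Box R},
      entry U a = 1 → entry U b = 2 → BoxBefore a.1 a.pos b.1 b.pos := fun hU hd _ _ ha hb =>
    (hU.place_lt_iff (toGrid_eq_some_iff_entry.2 ⟨_, rfl, rfl, ha⟩)
      (toGrid_eq_some_iff_entry.2 ⟨_, rfl, rfl, hb⟩)).1 hd
  obtain ⟨a, ha⟩ := hA.surj 1 le_rfl (by omega)
  obtain ⟨b, hb⟩ := hA.surj 2 (by omega) hn
  have ha' : entry B a = 1 := by
    have h1 := hc a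
    have h2 := hc b
    by_contra hne
    simp only [raise] at h1 h2
    rw [if_pos ha, if_neg hne] at h1
    have h3 : entry B b = 1 := by
      by_contra h3
      rw [if_neg (by omega), if_neg h3] at h2
      have := hB.inj a b (by omega)
      rw [this] at ha
      omega
    exact (hlt hA hdA ha hb).asymm (hlt hB hdB h3 h1.symm)
  have hb' : entry B b = 2 := by
    have h2 := hc b
    have h3 : entry B b ≠ 1 := fun h3 => by
      have := hB.inj a b (by omega)
      rw [this] at ha
      omega
    simp only [raise] at h2
    rw [if_neg (by omega), if_neg h3] at h2
    omega
  refine filling_ext fun c => ?_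
  have h1 := hc c
  simp only [raise] at h1
  split_ifs at h1 with h2 h3 h3
  · omega
  · rw [hA.inj c a (by omega), ha, ha']
  · rw [hB.inj c a (by omega), ha, ha']
  · exact h1

theorem IsStd.relabel_raise_pr {n : ℕ} {T : Filling R} (h : IsStd n T) (hn : 3 ≤ n)
    (hd : place T (n - 1) < place T n) :
    relabel (· + 1) (KR.pr n (relabel (raise (n - 1)) T)) =
      relabel (raise 1) (KR.pr n (KR.pr n T)) := by
  have h1 := h.pr_relabel_pred hn hd
  have h2 : raise (n - 1) = fun x => if x = n - 1 then n else x := by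
    funext x
    rw [raise, Nat.sub_add_cancel (by omega)]
  rw [h2]
  exact h1

theorem IsStd.pr_relabel_raise {n : ℕ} {T : Filling R} (h : IsStd n T) (hn : 3 ≤ n)
    (hd : place T (n - 1) < place T n) :
    KR.pr n (relabel (raise (n - 1)) T) = relabel mergeOne (KR.pr n (KR.pr n T)) := by
  refine filling_ext fun c => ?_
  have h1 := congrArg (entry · c) (h.relabel_raise_pr hn hd)
  have h2 := h.pr.pr.one_le c
  simp only [entry_relabel, raise, mergeOne] at h1 h2 ⊢
  split_ifs at h1 ⊢ <;> omega

/-- Shows that the chosen preimage `Y` is the filling `X` with two letters `n`. Renaming the first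
`n` of `Y` to `n - 1` yields a standard `Z`. Its double promotion agrees with that of `T` up to
merging 1 and 2, and since 1 precedes 2 in both, `Z = T`. -/
theorem IsStd.prInv_pr_relabel_raise {n : ℕ} {T : Filling R} (h : IsStd n T) (hn : 3 ≤ n)
    (hd : place T (n - 1) < place T n) :
    prInv n (KR.pr n (relabel (raise (n - 1)) T)) = relabel (raise (n - 1)) T := by
  set X := relabel (raise (n - 1)) T with hX
  have hXm : X ∈ crystal n R := by
    refine h.relabel_mem_crystal (fun x h1 h2 => ?_) (fun x h1 h2 => ?_) fun x h1 h2 h3 => ?_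
    · rw [raise]; split_ifs <;> omega
    · rw [raise, raise]; split_ifs <;> omega
    · by_cases hx : x = n - 1
      · rw [hx, Nat.sub_add_cancel (by omega)] at h3
        omega
      · rw [raise, raise]; split_ifs <;> omega
  obtain ⟨hYm, hY⟩ := prInv_spec hXm
  set Y := prInv n (KR.pr n X) with hYdef
  obtain ⟨σ, -, hσ⟩ := pr_perm n X
  obtain ⟨ρ, -, hρ⟩ := pr_perm n Y
  obtain ⟨p, hp⟩ := h.surj (n - 1) (by omega) (by omega)
  obtain ⟨q, hq⟩ := h.surj n (by omega) (by omega)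
  have hpq : p ≠ q := by
    rintro rfl
    omega
  have hXp : entry X p = n := by
    rw [hX, entry_relabel, hp, raise, if_pos rfl]; omega
  have hXq : entry X q = n := by
    rw [hX, entry_relabel, hq, raise, if_neg (by omega)]
  have hYX : ∀ c, entry Y c = entry X (σ (ρ.symm c)) := by
    intro c
    have h1 := hσ (ρ.symm c)
    rw [← hY, hρ, Equiv.apply_symm_apply] at h1
    exact cyc_inj ((hYm c.1).pos _ _) ((hXm _).pos _ _) h1
  -- The boxes of `Y` and `X` are matched by equal entries. The two boxes with `n` may be matched
  -- either way; the choice makes the earlier one in `Y` correspond to the `n - 1` of `T`.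
  obtain ⟨τ, hτ, hτb⟩ : ∃ τ : Equiv.Perm (Box R), (∀ c, entry Y c = entry X (τ c)) ∧
      BoxBefore (τ.symm p).1 (τ.symm p).pos (τ.symm q).1 (τ.symm q).pos := by
    obtain ⟨τ₀, hτ₀⟩ : ∃ τ₀ : Equiv.Perm (Box R), ∀ c, entry Y c = entry X (τ₀ c) :=
      ⟨ρ.symm.trans σ, hYX⟩
    have htot : ∀ a b : Box R, a ≠ b →
        BoxBefore a.1 a.pos b.1 b.pos ∨ BoxBefore b.1 b.pos a.1 a.pos := by
      intro a b hab
      simp only [BoxBefore, ReadBefore]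
      by_contra! hcon
      obtain ⟨⟨h1, h2⟩, h3, h4⟩ := hcon
      have h5 := le_antisymm h3 h1
      refine hab (Box.ext_pos h5 (Prod.ext ?_ ?_)) <;>
        · have := h2 h5
          have := h4 h5.symm
          omega
    rcases htot (τ₀.symm p) (τ₀.symm q) (fun h1 => hpq (τ₀.symm.injective h1)) with h1 | h1
    · exact ⟨τ₀, hτ₀, h1⟩
    · refine ⟨τ₀.trans (Equiv.swap p q), fun c => ?_, ?_⟩
      · rw [hτ₀, Equiv.trans_apply]
        by_cases h2 : τ₀ c = p
        · rw [h2, Equiv.swap_apply_left, hXp, hXq]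
        · by_cases h3 : τ₀ c = q
          · rw [h3, Equiv.swap_apply_right, hXp, hXq]
          · rw [Equiv.swap_apply_of_ne_of_ne h2 h3]
      · simpa only [Equiv.symm_trans_apply, Equiv.symm_swap, Equiv.swap_apply_left,
          Equiv.swap_apply_right] using h1
  let Z : Filling R := fun m a b => entry T (τ ⟨m, a, b⟩)
  have hZ : ∀ c, entry Z c = entry T (τ c) := fun c => rfl
  have hYZ : Y = relabel (raise (n - 1)) Z := filling_ext fun c => by
    rw [hτ, hX, entry_relabel, entry_relabel, hZ]
  have hYe : ∀ m a b, Y m a b = raise (n - 1) (Z m a b) := fun m a b =>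
    congrArg (entry · ⟨m, a, b⟩) hYZ
  have hZp : entry Z (τ.symm p) = n - 1 := by rw [hZ, Equiv.apply_symm_apply, hp]
  have hZq : entry Z (τ.symm q) = n := by rw [hZ, Equiv.apply_symm_apply, hq]
  have hZinj : ∀ c d, entry Z c = entry Z d → c = d := fun c d hcd =>
    τ.injective (h.inj _ _ hcd)
  -- Splitting the two letters `n` could only fail in a row with `n` left of `n - 1`, against the
  -- order fixed by `hτb`.
  have hZs : IsStd n Z := by
    refine ⟨fun m => ⟨fun a b => h.one_le _, fun a b => h.le _, fun a b b' hlt => ?_,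
      fun a a' b hlt => ?_⟩, hZinj, fun x h1 h2 => ?_⟩
    · by_contra hcon
      have h1 := (hYm m).row_weak a b b' hlt
      rw [hYe, hYe, raise, raise] at h1
      have h2 : Z m a b ≤ n := h.le _
      have h3 : Z m a b = n ∧ Z m a b' = n - 1 := by
        split_ifs at h1 <;> omega
      have h4 := hZinj ⟨m, a, b⟩ _ (h3.1.trans hZq.symm)
      have h5 := hZinj ⟨m, a, b'⟩ _ (h3.2.trans hZp.symm)
      rw [← h4, ← h5] at hτb
      refine hτb.asymm (.inr ⟨rfl, .inr ⟨rfl, ?_⟩⟩)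
      simpa [Box.pos] using hlt
    · have h1 := (hYm m).col_strict a a' b hlt
      rw [hYe, hYe, raise, raise] at h1
      have h2 : Z m a b ≤ n := h.le _
      have h3 : Z m a' b ≤ n := h.le _
      split_ifs at h1 <;> omega
    · obtain ⟨c, hc⟩ := h.surj x h1 h2
      exact ⟨τ.symm c, by rw [hZ, Equiv.apply_symm_apply, hc]⟩
  have hZd : place Z (n - 1) < place Z n :=
    (hZs.place_lt_iff (toGrid_eq_some_iff_entry.2 ⟨_, rfl, rfl, hZp⟩)
      (toGrid_eq_some_iff_entry.2 ⟨_, rfl, rfl, hZq⟩)).2 hτb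
  have h1 := hZs.relabel_raise_pr hn hZd
  rw [← hYZ, hY, h.relabel_raise_pr hn hd] at h1
  have n1 := h.pr.pr.place_ne (x := 1) (y := 2) (by omega) (by omega) (by omega)
  have n2 := hZs.pr.pr.place_ne (x := 1) (y := 2) (by omega) (by omega) (by omega)
  have d1 := h.descent_pr_pr hn
  have d2 := hZs.descent_pr_pr hn
  have h2 := h.pr.pr.eq_of_relabel_raise_one hZs.pr.pr (by omega) (by omega) (by omega) h1
  have h3 := h.pr_inj hZs (h.pr.pr_inj hZs.pr h2)
  rw [hYZ, hX, h3]

/-! ### The affine commutators -/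

theorem f_of_ne {n i : ℕ} (h : i ≠ n) (T : Filling R) : f n i T = fClassical i T := if_neg h

theorem e_of_ne {n i : ℕ} (h : i ≠ n) (T : Filling R) : e n i T = eClassical i T := if_neg h

theorem f_self (n : ℕ) (T : Filling R) : f n n T = prInv n (fClassical 1 (pr n T)) := if_pos rfl

theorem e_self (n : ℕ) (T : Filling R) : e n n T = prInv n (eClassical 1 (pr n T)) := if_pos rfl

theorem commutator_of_lt {n i : ℕ} (hi : i + 2 ≤ n) (T : Filling R) :
    commutator n i T = classicalComm i T := by
  rw [commutator, succIdx, if_neg (by omega), f_of_ne (by omega), f_of_ne (by omega),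
    e_of_ne (by omega), e_of_ne (by omega), classicalComm]

/-- The data on the letters `1`, `2`, `3` that is used in the tables. -/
theorem IsStd.exists_frame_three {n : ℕ} {T : Filling R} (h : IsStd n T) (hn : 3 ≤ n) :
    ∃ (pos : Fin 3 → Box R) (σ : Equiv.Perm (Fin 3)), IsFrame pos ∧
      (∀ j, entry T (pos j) = (σ j : ℕ) + 1) ∧
      (∀ c, (∀ j, pos j ≠ c) → 4 ≤ entry T c) ∧
      (place T 1 < place T 2 ↔ σ.symm 0 < σ.symm 1) ∧
      (place T 2 < place T 3 ↔ σ.symm 1 < σ.symm 2) ∧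
      (place T 3 < place T 2 ↔ σ.symm 2 < σ.symm 1) ∧
      classicalComm 1 T = put pos T (wordComm 1 fun j => (σ j : ℕ) + 1) := by
  obtain ⟨pos, σ, hpos, hσ, hoff, hpl⟩ := h.exists_frame 3 le_rfl (by omega)
  refine ⟨pos, σ, hpos, hσ, fun c hc => ?_, hpl 0 1, hpl 1 2, hpl 2 1, ?_⟩
  · have := hoff c hc
    have := h.one_le c
    omega
  · have hTp : put pos T (fun j => (σ j : ℕ) + 1) = T :=
      put_eq_of hpos.injective hσ fun _ _ => rfl
    conv_lhs => rw [← hTp]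
    exact classicalComm_put hpos hoff _

/-- If `φ` merges two of the letters `1`, `2`, `3` and the raising operators act on the result as
in the tables, then they compute the classical commutator. -/
theorem IsStd.pr_eClassical_relabel {n : ℕ} {T : Filling R} (hn : 3 ≤ n)
    {pos : Fin 3 → Box R} {σ : Equiv.Perm (Fin 3)} (hpos : IsFrame pos)
    (hT : IsStd n T) (hσ : ∀ j, entry T (pos j) = (σ j : ℕ) + 1)
    (hoff : ∀ c, (∀ j, pos j ≠ c) → 4 ≤ entry T c)
    (hK : classicalComm 1 T = put pos T (wordComm 1 fun j => (σ j : ℕ) + 1)) {φ : ℕ → ℕ}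
    (hφ : ∀ x, 4 ≤ x → φ x = x - 1)
    (h1 : wordE 1 (fun j => wordE 1 (fun j => φ ((σ j : ℕ) + 1)) j + 1) =
        wordComm 1 fun j => (σ j : ℕ) + 1)
    (h2 : ∀ j, wordE 1 (fun j => φ ((σ j : ℕ) + 1)) j ≤ 2) :
    eClassical 1 (KR.pr n (eClassical 1 (relabel φ T))) = classicalComm 1 T := by
  have hTp : put pos (relabel φ T) (fun j => φ ((σ j : ℕ) + 1)) = relabel φ T :=
    put_eq_of hpos.injective (fun j => by rw [entry_relabel, hσ]) fun _ _ => rfl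
  rw [← hTp, eClassical_put hpos]
  -- Letters in the frame are at most `2 < n` and the others have been lowered by one, so there is
  -- no `n` and promotion adds one.
  · rw [pr_of_forall_ne, relabel_put hpos.injective, eClassical_put hpos, h1, hK]
    · refine put_congr (fun _ => rfl) fun c hc => ?_
      have := hoff c hc
      simp only [entry_relabel, hφ _ this]
      omega
    · intro c hc
      have := hoff c hc
      simp only [entry_relabel, hφ _ this]
      omega
    · intro c hc
      by_cases hj : ∃ j, pos j = c
      · obtain ⟨j, rfl⟩ := hj
        rw [entry_put_pos hpos.injective] at hc
        have := h2 j
        omega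
      · simp only [not_exists] at hj
        have h3 := hoff c hj
        have h4 := hT.le c
        rw [entry_put_of_ne hj, entry_relabel, hφ _ h3] at hc
        omega
  · intro c hc
    have := hoff c hc
    simp only [entry_relabel, hφ _ this]
    omega

theorem IsStd.prInv_relabel {n : ℕ} {T : Filling R} (h : IsStd n T) {φ ψ : ℕ → ℕ}
    (hψ : ∀ x, 1 ≤ x → x ≤ n → ψ x = φ x + 1) (hb : ∀ x, 1 ≤ x → x ≤ n → 1 ≤ φ x ∧ φ x < n)
    (hm : ∀ x, 1 ≤ x → x < n → φ x ≤ φ (x + 1))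
    (hs : ∀ x, 1 ≤ x → x < n → place T (x + 1) < place T x → φ x < φ (x + 1)) :
    prInv n (relabel ψ T) = relabel φ T := by
  have h1 : relabel ψ T = relabel (· + 1) (relabel φ T) :=
    filling_ext fun c => hψ _ (h.one_le c) (h.le c)
  rw [h1]
  refine prInv_relabel_succ (h.relabel_mem_crystal (fun x h1 h2 => ?_) hm hs) fun c => ?_
  · have := hb x h1 h2
    omega
  · exact (hb _ (h.one_le c) (h.le c)).2.ne

/-- Without the letter 1, inverse promotion subtracts one. The result is semistandard because 1 is
not a descent. -/
theorem IsStd.prInv_raise_one {n : ℕ} {T : Filling R} (h : IsStd n T) (hn : 3 ≤ n)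
    (hd : place T 1 < place T 2) : prInv n (relabel (raise 1) T) = relabel mergeOne T := by
  refine h.prInv_relabel (fun x h1 h2 => ?_) (fun x h1 h2 => ?_) (fun x h1 h2 => ?_)
    fun x h1 h2 h3 => ?_
  · rw [raise, mergeOne]; split_ifs <;> omega
  · rw [mergeOne]; split_ifs <;> omega
  · rw [mergeOne, mergeOne]; split_ifs <;> omega
  · by_cases hx : x = 1
    · subst hx
      simp only [Nat.reduceAdd] at h3
      omega
    · rw [mergeOne, mergeOne]; split_ifs <;> omega

theorem IsStd.prInv_raise_two {n : ℕ} {T : Filling R} (h : IsStd n T) (hn : 3 ≤ n)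
    (hd : place T 2 < place T 3) :
    prInv n (relabel (raise 1) (relabel (raise 2) T)) = relabel mergeTwo T := by
  rw [relabel_relabel]
  refine h.prInv_relabel (fun x h1 h2 => ?_) (fun x h1 h2 => ?_) (fun x h1 h2 => ?_)
    fun x h1 h2 h3 => ?_
  · simp only [raise, mergeTwo]; split_ifs <;> omega
  · rw [mergeTwo]; split_ifs <;> omega
  · rw [mergeTwo, mergeTwo]; split_ifs <;> omega
  · by_cases hx : x = 2
    · subst hx
      simp only [Nat.reduceAdd] at h3
      omega
    · rw [mergeTwo, mergeTwo]; split_ifs <;> omega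

theorem IsStd.pr_raise_one {n : ℕ} {T : Filling R} (h : IsStd n T) (hn : 3 ≤ n) :
    KR.pr n (relabel (raise 1) T) = relabel (raise 2) (KR.pr n T) := by
  rw [h.pr_relabel]
  · refine filling_ext fun c => ?_
    have := h.pr.one_le c
    simp only [entry_relabel, raise]
    split_ifs <;> omega
  · rintro x ⟨h1, h2⟩ y ⟨h3, h4⟩ hxy
    simp only [raise]
    split_ifs <;> omega
  · intro x h1 h2
    simp only [raise]
    split_ifs <;> omega

/-- The cases follow the lowering operators f_1 and f_n. If both act trivially, the letters are in
the order 3, 2, 1 in pr T and C_1 fixes it. If only f_n acts, 1 and 2 of pr T get merged; if f_1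
acts, 2 and 3 get merged, and the tables finish both cases. -/
theorem IsStd.commutator_self {n : ℕ} {T : Filling R} (h : IsStd n T) (hn : 3 ≤ n) :
    ∃ U, IsStd n U ∧ commutator n n T = U ∧ KR.pr n U = classicalComm 1 (KR.pr n T) := by
  obtain ⟨U, hU, hUe⟩ := (h.pr.isStd_classicalComm le_rfl hn).exists_pr_eq
  refine ⟨U, hU, ?_, hUe⟩
  have h1n : 1 ≠ n := by omega
  rw [commutator, succIdx, if_pos rfl, f_of_ne h1n, e_of_ne h1n, f_self, e_self]
  obtain ⟨pos, σ, hpos, hσ, hoff, p01, p12, p21, hK⟩ := h.pr.exists_frame_three hn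
  have h1 := h.descent_pr le_rfl (by omega)
  simp only [Nat.reduceAdd] at h1
  have n1 := h.place_ne (x := 1) (y := 2) (by omega) (by omega) (by omega)
  have n2 := h.pr.place_ne (x := 1) (y := 2) (by omega) (by omega) (by omega)
  have n3 := h.pr.place_ne (x := 2) (y := 3) (by omega) (by omega) (by omega)
  obtain ⟨t1, t2⟩ := h.pair_spec le_rfl (show 1 < n by omega)
  obtain ⟨s1, s2⟩ := h.pr.pair_spec le_rfl (show 1 < n by omega)
  simp only [Nat.reduceAdd] at t1 t2 s1 s2
  by_cases hd : place (KR.pr n T) 3 < place (KR.pr n T) 2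
  · have hdT := h1.1 hd
    rw [(t1 hdT).1]
    by_cases hd' : place (KR.pr n T) 2 < place (KR.pr n T) 1
    · rw [(s1 hd').1, h.prInv_pr, (t1 hdT).2, (s1 hd').2, h.prInv_pr]
      rw [(h.pr.classicalComm_spec le_rfl hn).2 (by simp only [Nat.reduceAdd]; omega)] at hUe
      exact h.pr_inj hU hUe.symm
    · have hd' : place (KR.pr n T) 1 < place (KR.pr n T) 2 := by omega
      rw [(s2 hd').1, h.pr.prInv_raise_one hn hd']
      have ht := wordE_mergeOne_table σ (p01.1 hd') (p21.1 hd)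
      rw [h.pr.pr_eClassical_relabel hn hpos hσ hoff hK (φ := mergeOne)
        (fun x hx => if_neg (by omega)) ht.1 ht.2.2, ← hUe, hU.prInv_pr]
  · have hd' : place (KR.pr n T) 2 < place (KR.pr n T) 3 := by omega
    rw [(t2 (by omega)).1, h.pr_raise_one hn]
    obtain ⟨c, hc⟩ := h.pr.surj 1 le_rfl (by omega)
    -- No letter 2 is left after `raise 2`, so the only 1 is unmatched and is raised regardless of
    -- its position.
    rw [fClassical_of_single (c := c), h.pr.prInv_raise_two hn hd']
    · have ht := wordE_mergeTwo_table σ (p12.1 hd')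
      rw [h.pr.pr_eClassical_relabel hn hpos hσ hoff hK (φ := mergeTwo)
        (fun x hx => if_neg (by omega)) ht.1 ht.2.2, ← hUe, hU.prInv_pr]
    · rw [entry_relabel, hc, raise, if_neg (by omega)]
    · intro d hdc
      have h2 : entry (KR.pr n T) d ≠ 1 := fun h2 => hdc (h.pr.inj _ _ (h2.trans hc.symm))
      rw [entry_relabel, raise]
      split_ifs <;> omega

/-- If f_n acts trivially, 2 is a descent of pr² T and C_1 fixes it; whatever f_{n-1} does is undone
by e_{n-1}, because e_n acts trivially in between. Otherwise, after both lowering operators, the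
promotion is pr² T with 2 and 3 merged, and e_1 turns this into C_1 pr² T with 1 and 2 merged. That
is the promotion of `U` with its `n - 1` raised to `n`, and e_{n-1} restores `U`. -/
theorem IsStd.commutator_pred {n : ℕ} {T : Filling R} (h : IsStd n T) (hn : 3 ≤ n) :
    ∃ U, IsStd n U ∧ commutator n (n - 1) T = U ∧
      KR.pr n (KR.pr n U) = classicalComm 1 (KR.pr n (KR.pr n T)) := by
  obtain ⟨V, hV, hVe⟩ := (h.pr.pr.isStd_classicalComm le_rfl hn).exists_pr_eq
  obtain ⟨U, hU, rfl⟩ := hV.exists_pr_eq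
  refine ⟨U, hU, ?_, hVe⟩
  have h1n : n - 1 ≠ n := by omega
  rw [commutator, succIdx, if_neg h1n, Nat.sub_add_cancel (by omega), f_of_ne h1n,
    e_of_ne h1n, f_self, e_self]
  obtain ⟨pos, σ, hpos, hσ, hoff, p01, p12, p21, hK⟩ := h.pr.pr.exists_frame_three hn
  have h1 := h.pr.descent_pr le_rfl (by omega)
  have h2 := h.descent_pr_pr hn
  simp only [Nat.reduceAdd] at h1
  have n1 := h.place_ne (x := n - 1) (y := n) (by omega) (by omega) (by omega)
  have n2 := h.pr.place_ne (x := 1) (y := 2) (by omega) (by omega) (by omega)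
  have n3 := h.pr.pr.place_ne (x := 2) (y := 3) (by omega) (by omega) (by omega)
  have n4 := h.pr.pr.place_ne (x := 1) (y := 2) (by omega) (by omega) (by omega)
  obtain ⟨t1, t2⟩ := h.pair_spec (show 1 ≤ n - 1 by omega) (show n - 1 < n by omega)
  obtain ⟨s1, s2⟩ := h.pr.pair_spec le_rfl (show 1 < n by omega)
  rw [Nat.sub_add_cancel (by omega)] at t1 t2
  simp only [Nat.reduceAdd] at s1 s2
  -- the raising operator `e_1` on the promotion of a tableau with letters `1`, `1`, `2`
  have hput : ∀ {φ : ℕ → ℕ}, (∀ x, 4 ≤ x → φ x = x - 1) →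
      eClassical 1 (relabel φ (KR.pr n (KR.pr n T))) =
        put pos (relabel φ (KR.pr n (KR.pr n T)))
          (wordE 1 fun j => φ ((σ j : ℕ) + 1)) := by
    intro φ hφ
    have hTp : put pos (relabel φ (KR.pr n (KR.pr n T))) (fun j => φ ((σ j : ℕ) + 1)) =
        relabel φ (KR.pr n (KR.pr n T)) :=
      put_eq_of hpos.injective (fun j => by rw [entry_relabel, hσ]) fun _ _ => rfl
    conv_lhs => rw [← hTp]
    refine eClassical_put hpos (fun c hc => ?_) _
    have := hoff c hc
    rw [entry_relabel, hφ _ this]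
    omega
  by_cases hd : place (KR.pr n T) 2 < place (KR.pr n T) 1
  · rw [(h.pr.pr.classicalComm_spec le_rfl hn).2 (by simp only [Nat.reduceAdd]; omega)] at hVe
    obtain rfl := h.pr_inj hU (h.pr.pr_inj hU.pr hVe.symm)
    rw [(s1 hd).1, h.prInv_pr]
    by_cases hd' : place T n < place T (n - 1)
    · rw [(t1 hd').1, (s1 hd).2, h.prInv_pr, (t1 hd').2]
    · have hd' : place T (n - 1) < place T n := by omega
      rw [(t2 hd').1]
      have ht := wordE_mergeOne_table σ (p01.1 (by omega)) (p21.1 (by omega))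
      have h3 : eClassical 1 (KR.pr n (relabel (raise (n - 1)) T)) =
          KR.pr n (relabel (raise (n - 1)) T) := by
        rw [h.pr_relabel_raise hn hd', hput (φ := mergeOne) fun x hx => if_neg (by omega), ht.2.1]
        exact put_eq_of hpos.injective (fun j => by rw [entry_relabel, hσ]) fun _ _ => rfl
      rw [h3, h.prInv_pr_relabel_raise hn hd', (t2 hd').2]
  · have hd : place (KR.pr n T) 1 < place (KR.pr n T) 2 := by omega
    have hd' : place (KR.pr n (KR.pr n T)) 2 < place (KR.pr n (KR.pr n T)) 3 := by omega
    rw [(s2 hd).1, h.pr.prInv_raise_one hn hd]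
    obtain ⟨c, hc⟩ := h.pr.surj n (by omega) le_rfl
    have h3 : fClassical (n - 1) (relabel mergeOne (KR.pr n T)) =
        relabel (raise (n - 1)) (relabel mergeOne (KR.pr n T)) := by
      -- After `mergeOne` the former `n` is the only `n - 1`, and no `n` remains.
      refine fClassical_of_single (c := c) ?_ fun d hdc => ?_
      · rw [entry_relabel, hc, mergeOne, if_neg (by omega)]
      · have h3 : entry (KR.pr n T) d ≠ n := fun h3 => hdc (h.pr.inj _ _ (h3.trans hc.symm))
        have h4 := h.pr.le d
        rw [entry_relabel, mergeOne]
        split_ifs <;> omega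
    have h4 : KR.pr n (relabel (raise (n - 1)) (relabel mergeOne (KR.pr n T))) =
        relabel mergeTwo (KR.pr n (KR.pr n T)) := by
      rw [relabel_relabel, h.pr.pr_relabel]
      · refine filling_ext fun c => ?_
        have := h.pr.pr.one_le c
        have := h.pr.pr.le c
        simp only [entry_relabel, raise, mergeOne, mergeTwo]
        split_ifs <;> omega
      · rintro x ⟨h1, h2⟩ y ⟨h3, h4⟩ hxy
        simp only [raise, mergeOne]
        split_ifs <;> omega
      · intro x h1 h2
        simp only [raise, mergeOne]
        split_ifs <;> omega
    have ht := wordE_mergeTwo_table σ (p12.1 hd')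
    -- the commutator has no descent `1`
    have hdV : place (classicalComm 1 (KR.pr n (KR.pr n T))) 1 <
        place (classicalComm 1 (KR.pr n (KR.pr n T))) 2 := by
      obtain ⟨c1, c2⟩ := h.pr.pr.classicalComm_spec le_rfl hn
      simp only [Nat.reduceAdd] at c1 c2
      by_cases hc : place (KR.pr n (KR.pr n T)) 2 < place (KR.pr n (KR.pr n T)) 1
      · rcases c1 ⟨hc, hd'⟩ with ⟨c3, c4⟩ | ⟨c3, c4⟩
        · rw [c3, place_sw_left, show place (KR.sw 1 _) 2 = _ from place_sw_right 1 _]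
          exact hc
        · simp only [Between, Nat.reduceAdd] at c3 c4
          rw [c3, place_sw_left, place_sw_of_ne (by omega) (by omega)]
          simp only [Nat.reduceAdd]
          omega
      · rw [c2 (fun h5 => hc h5.1)]
        omega
    have hdU : place U (n - 1) < place U n := by
      have h5 := hU.descent_pr_pr hn
      have h6 := hU.place_ne (x := n - 1) (y := n) (by omega) (by omega) (by omega)
      rw [hVe] at h5
      omega
    -- The second clause of the table replaces the raising operator on the word with 2 and 3 merged
    -- by a merging of 1 and 2 in the commutator; outside the frame both mergings subtract one.
    have h5 : eClassical 1 (relabel mergeTwo (KR.pr n (KR.pr n T))) =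
        KR.pr n (relabel (raise (n - 1)) U) := by
      rw [hU.pr_relabel_raise hn hdU, hVe, hK, hput (φ := mergeTwo) fun x hx => if_neg (by omega), ht.2.1,
        relabel_put hpos.injective]
      refine put_congr (fun _ => rfl) fun c hc => ?_
      have := hoff c hc
      rw [entry_relabel, entry_relabel, mergeOne, mergeTwo, if_neg (by omega), if_neg (by omega)]
    obtain ⟨u1, u2⟩ := hU.pair_spec (show 1 ≤ n - 1 by omega) (show n - 1 < n by omega)
    rw [Nat.sub_add_cancel (by omega)] at u2
    rw [h3, h4, h5, hU.prInv_pr_relabel_raise hn hdU, (u2 hdU).2]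

theorem eq_of_rw_eq {T T' : Filling R} (he : rw T = rw T') : T = T' := by
  refine filling_ext fun c => ?_
  exact List.map_inj_left.1 he c (mem_boxes c)

/-- Commutators in terms of elementary dual equivalences. -/
theorem IsStd.commutator_iff {n : ℕ} {T T' : Filling R} (h : IsStd n T) (h' : IsStd n T')
    (hn : 3 ≤ n) : (T ≠ T' ∧ ∃ i, 1 ≤ i ∧ i ≤ n ∧
        (commutator n i T = T' ∨ commutator n i T' = T)) ↔
      (∃ i, 1 ≤ i ∧ i + 2 ≤ n ∧ DualStep i T T') ∨ DualStep 1 (KR.pr n T) (KR.pr n T') ∨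
        DualStep 1 (KR.pr n (KR.pr n T)) (KR.pr n (KR.pr n T')) := by
  have hself : ∀ {T T' : Filling R}, IsStd n T → IsStd n T' → (commutator n n T = T' ↔
      classicalComm 1 (KR.pr n T) = KR.pr n T') := by
    intro T T' h h'
    obtain ⟨U, hU, hU1, hU2⟩ := h.commutator_self hn
    rw [hU1, ← hU2]
    exact ⟨fun h1 => by rw [h1], fun h1 => hU.pr_inj h' h1⟩
  have hpred : ∀ {T T' : Filling R}, IsStd n T → IsStd n T' → (commutator n (n - 1) T = T' ↔
      classicalComm 1 (KR.pr n (KR.pr n T)) = KR.pr n (KR.pr n T')) := by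
    intro T T' h h'
    obtain ⟨U, hU, hU1, hU2⟩ := h.commutator_pred hn
    rw [hU1, ← hU2]
    exact ⟨fun h1 => by rw [h1], fun h1 => hU.pr_inj h' (hU.pr.pr_inj h'.pr h1)⟩
  have hne : KR.pr n T ≠ KR.pr n T' ↔ T ≠ T' :=
    not_congr ⟨fun h1 => h.pr_inj h' h1, fun h1 => by rw [h1]⟩
  have hne' : KR.pr n (KR.pr n T) ≠ KR.pr n (KR.pr n T') ↔ T ≠ T' := by
    rw [← hne]
    exact not_congr ⟨fun h1 => h.pr.pr_inj h'.pr h1, fun h1 => by rw [h1]⟩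
  rw [← h.pr.classicalComm_iff h'.pr le_rfl hn, ← h.pr.pr.classicalComm_iff h'.pr.pr le_rfl hn,
    ← hself h h', ← hself h' h, ← hpred h h', ← hpred h' h, hne, hne']
  constructor
  · rintro ⟨h1, i, hi1, hi2, hc⟩
    by_cases hin : i = n
    · subst hin
      exact .inr (.inl ⟨h1, hc⟩)
    by_cases hin' : i = n - 1
    · subst hin'
      exact .inr (.inr ⟨h1, hc⟩)
    · refine .inl ⟨i, hi1, by omega, (h.classicalComm_iff h' hi1 (by omega)).1 ⟨h1, ?_⟩⟩
      rwa [commutator_of_lt (by omega), commutator_of_lt (by omega)] at hc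
  · rintro (⟨i, hi1, hi2, hd⟩ | ⟨h1, hc⟩ | ⟨h1, hc⟩)
    · obtain ⟨h1, hc⟩ := (h.classicalComm_iff h' hi1 hi2).2 hd
      refine ⟨h1, i, hi1, by omega, ?_⟩
      rwa [commutator_of_lt (by omega), commutator_of_lt (by omega)]
    · exact ⟨h1, n, by omega, le_rfl, hc⟩
    · exact ⟨h1, n - 1, by omega, by omega, hc⟩

end KR

/-! ### The theorem, from the common description of both kinds of edges. -/

theorem theoremt {k : ℕ} (R : Fin k → ℕ × ℕ) (hR : ∀ m, 0 < (R m).1 ∧ 0 < (R m).2)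
    (n : ℕ) (hn : 3 ≤ n) (T T' : KR.Vertex n R) :
    KR.Adj T T' ↔
      KR.rw T.val ≠ KR.rw T'.val ∧
        ∃ i, 1 ≤ i ∧ i ≤ n ∧
          (KR.commutator n i T.val = T'.val ∨ KR.commutator n i T'.val = T.val) := by
  have h : KR.IsStd n T.val := KR.isStd_iff.2 ⟨T.mem_crystal, T.weight_zero⟩
  have h' : KR.IsStd n T'.val := KR.isStd_iff.2 ⟨T'.mem_crystal, T'.weight_zero⟩
  have hne : KR.rw T.val ≠ KR.rw T'.val ↔ T.val ≠ T'.val :=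
    not_congr ⟨KR.eq_of_rw_eq, fun h1 => by rw [h1]⟩
  rw [hne, h.commutator_iff h' hn]
  exact h.move_or_move_iff h' hn
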